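/- Throughout, rings are commutative and unital, algebras are unital and associative, and $2$ is invertible. Let $R$ be a semilocal ring (i.e. with finitely many maximal ideals) with $2\in R^\times$, and let $(A,\sigma)$ be an Azumaya $R$-algebra with involution: $A$ is an $R$-algebra that is projective as an $R$-module and separable over $R$ (projective over $A\otimes_R A^{\mathrm{op}}$), $\sigma$ is an $R$-linear involution of $A$, and $r\mapsto r\cdot 1_A$ identifies $R$ with the ring of $\sigma$-fixed elements of the centre $Z=\mathrm{Cent}(A)$. Let $\varepsilon\in Z$ with $\varepsilon^\sigma\varepsilon=1$. An $\varepsilon$-hermitian space over $(A,\sigma)$ is a pair $(P,f)$ where $P$ is a finitely generated projective right $A$-module and $f:P\times P\to A$ is biadditive with $f(xa,yb)=a^\sigma f(x,y)b$ and $f(x,y)=\varepsilon f(y,x)^\sigma$. It is unimodular if $x\mapsto f(x,-)$ is an isomorphism from $P$ to $P^*=\mathrm{Hom}_A(P,A)$, where $P^*$ is a right $A$-module through $(\phi a)x=a^\sigma(\phi x)$. It is hyperbolic if $P=L\oplus M$ for submodules $L,M$ with $f(L,L)=0=f(M,M)$. For a finitely generated projective right $A$-module $V$, $\mathbb{H}^\varepsilon_V$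 is the form on $V\oplus V^*$ given by $\mathbb{H}^\varepsilon_V(x\oplus\phi,x'\oplus\phi')=\phi x'+\varepsilon(\phi' x)^\sigma$. The Witt group $W_\varepsilon(A,\sigma)$ is the Grothendieck group of isometry classes of unimodular $\varepsilon$-hermitian spaces under orthogonal sum, modulo the subgroup generated by the hyperbolic spaces; $[f]$ is the class of $(P,f)$ in it. The reduced rank of $P$ is the function on $\mathrm{Spec}\, Z$ given by $\mathrm{rrk}_A P=\mathrm{rank}_Z P/\deg A$, where $\deg A=\sqrt{\mathrm{rank}_Z A}$; reduced ranks are compared pointwise. **Theorem.** Let $(P,f)$ and $(P',f')$ be unimodular $\varepsilon$-hermitian spaces over $(A,\sigma)$. 1. If $[f]=[f']$ and $\mathrm{rrk}_A P\le \mathrm{rrk}_A P'$, then there is a finitely generated projective right $A$-module $V$ such that $f\oplus\mathbb{H}^\varepsilon_V\cong f'$. 2. If $[f]=0$, then $f$ is hyperbolic. 3. If $[f]=[f']$ and $\mathrm{rrk}_A P=\mathrm{rrk}_A P'$, then $f\cong f'$. -/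

import Mathlib

open MulOpposite
open scoped TensorProduct

universe u v

namespace AzumayaWitt

/-! ### Algebras with involution

A right `A`-module is a module over `Aᵐᵒᵖ`, with `x · a` written `op a • x`. In particular `A`
is a right module over itself through `op a • x = x * a`. -/

section Algebras

variable (R : Type u) (A : Type v) [CommRing R] [Ring A] [Algebra R A]

/-- An `R`-linear involution of the `R`-algebra `A`. -/
structure AlgInvolution extends A →ₗ[R] A where
  map_mul' : ∀ a b : A, toFun (a * b) = toFun b * toFun a
  involutive' : ∀ a : A, toFun (toFun a) = a

instance : CoeFun (AlgInvolution R A) (fun _ => A → A) := ⟨fun σ => σ.toFun⟩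

/-- `A` is a separable `R`-algebra: it is projective as a module over its enveloping algebra,
where `a ⊗ op b` acts on `A` by `x ↦ a * x * b`. -/
def IsSeparableAlgebra : Prop :=
  letI : Module (A ⊗[R] Aᵐᵒᵖ) A := TensorProduct.Algebra.module
  Module.Projective (A ⊗[R] Aᵐᵒᵖ) A

variable {R A}

/-- `(A, σ)` is an Azumaya `R`-algebra with involution: `A` is separable and projective over `R`,
and `r ↦ r · 1` identifies `R` with the ring of `σ`-fixed elements of the centre of `A`. -/
structure IsAzumayaWithInvolution (σ : AlgInvolution R A) : Prop where
  projective : Module.Projective R A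
  separable : IsSeparableAlgebra R A
  injective : Function.Injective (algebraMap R A)
  range_eq : Set.range (algebraMap R A) = {a : A | a ∈ Set.center A ∧ σ a = a}

theorem AlgInvolution.map_one (σ : AlgInvolution R A) : σ 1 = 1 := by
  have h := σ.map_mul' (σ 1) 1
  rw [mul_one, σ.involutive'] at h
  simpa using h.symm

theorem AlgInvolution.map_add (σ : AlgInvolution R A) (a b : A) : σ (a + b) = σ a + σ b :=
  σ.toLinearMap.map_add a b

theorem AlgInvolution.map_zero (σ : AlgInvolution R A) : σ 0 = 0 :=
  σ.toLinearMap.map_zero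

/-- The ring homomorphism `Aᵐᵒᵖ → A` given by `op a ↦ σ a`. -/
def AlgInvolution.ofOp (σ : AlgInvolution R A) : Aᵐᵒᵖ →+* A where
  toFun a := σ a.unop
  map_one' := σ.map_one
  map_mul' a b := σ.map_mul' b.unop a.unop
  map_zero' := σ.map_zero
  map_add' a b := σ.map_add a.unop b.unop

end Algebras

/-! ### Ranks over the centre -/

section Ranks

variable (A : Type v) [Ring A]

/-- The inclusion of the centre of `A` in `Aᵐᵒᵖ`, through which the centre acts on right
`A`-modules. -/
def centerToOp : Subring.center A →+* Aᵐᵒᵖ :=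
  (Subring.center A).subtype.toOpposite fun x y => (Subring.mem_center_iff.1 y.2 x.1)

/-- The rank over the centre `Z` of `A` of a right `A`-module `P`: the function on `Spec Z`
sending `𝔭` to the dimension of `P ⊗ k(𝔭)` over the residue field `k(𝔭)`. -/
noncomputable def centerRank (P : Type*) [AddCommGroup P] [Module Aᵐᵒᵖ P]
    (p : PrimeSpectrum (Subring.center A)) : ℕ :=
  letI : Module (Subring.center A) P := Module.compHom P (centerToOp A)
  Module.finrank p.asIdeal.ResidueField (p.asIdeal.ResidueField ⊗[Subring.center A] P)

/-- The degree of an algebra `A` that is Azumaya over its centre `Z`, as a function on `Spec Z`: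
the square root of the rank of `A` over `Z` (which is a perfect square at every point). -/
noncomputable def degree (p : PrimeSpectrum (Subring.center A)) : ℕ :=
  Nat.sqrt (centerRank A A p)

/-- The reduced rank of a right `A`-module `P`, as a function on the spectrum of the centre:
the rank of `P` divided by the degree of `A`. The quotient is formed in `ℚ`, so nothing is
rounded. -/
noncomputable def reducedRank (P : Type*) [AddCommGroup P] [Module Aᵐᵒᵖ P]
    (p : PrimeSpectrum (Subring.center A)) : ℚ :=
  (centerRank A P p : ℚ) / (degree A p : ℚ)

end Ranks

/-! ### Hermitian forms -/

section Forms

variable {R : Type u} {A : Type v} [CommRing R] [Ring A] [Algebra R A]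

/-- An `ε`-hermitian form over `(A, σ)` on the right `A`-module `P`. -/
@[ext]
structure HermForm (σ : AlgInvolution R A) (ε : A) (P : Type*) [AddCommGroup P]
    [Module Aᵐᵒᵖ P] where
  toFun : P → P → A
  add_left : ∀ x x' y, toFun (x + x') y = toFun x y + toFun x' y
  add_right : ∀ x y y', toFun x (y + y') = toFun x y + toFun x y'
  smul_smul : ∀ x y (a b : A), toFun (op a • x) (op b • y) = σ a * toFun x y * b
  symm : ∀ x y, toFun x y = ε * σ (toFun y x)

namespace HermForm

variable {σ : AlgInvolution R A} {ε : A}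
variable {P : Type*} [AddCommGroup P] [Module Aᵐᵒᵖ P]
variable {Q : Type*} [AddCommGroup Q] [Module Aᵐᵒᵖ Q]

/-- The right `A`-linear map `f(x, -) : P → A`. -/
def toHom (f : HermForm σ ε P) (x : P) : P →ₗ[Aᵐᵒᵖ] A where
  toFun y := f.toFun x y
  map_add' y y' := f.add_right x y y'
  map_smul' b y := by
    have h := f.smul_smul x y 1 b.unop
    simpa [σ.map_one] using h

/-- `f` is unimodular: `x ↦ f(x, -)` is a bijection from `P` to `Hom_A(P, A)`. -/
def Unimodular (f : HermForm σ ε P) : Prop := Function.Bijective f.toHom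

/-- `f` is hyperbolic: `P` is the direct sum of two totally isotropic submodules. -/
def Hyperbolic (f : HermForm σ ε P) : Prop :=
  ∃ L M : Submodule Aᵐᵒᵖ P, IsCompl L M ∧
    (∀ x ∈ L, ∀ y ∈ L, f.toFun x y = 0) ∧ (∀ x ∈ M, ∀ y ∈ M, f.toFun x y = 0)

/-- There is an isometry from `(P, f)` to `(Q, g)`. -/
def Isometric (f : HermForm σ ε P) (g : HermForm σ ε Q) : Prop :=
  ∃ φ : P ≃ₗ[Aᵐᵒᵖ] Q, ∀ x y, g.toFun (φ x) (φ y) = f.toFun x y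

/-- The orthogonal sum of two `ε`-hermitian forms. -/
def prod (f : HermForm σ ε P) (g : HermForm σ ε Q) : HermForm σ ε (P × Q) where
  toFun x y := f.toFun x.1 y.1 + g.toFun x.2 y.2
  add_left x x' y := by
    simp only [Prod.fst_add, Prod.snd_add, f.add_left, g.add_left]; abel
  add_right x y y' := by
    simp only [Prod.fst_add, Prod.snd_add, f.add_right, g.add_right]; abel
  smul_smul x y a b := by
    simp only [Prod.smul_fst, Prod.smul_snd, f.smul_smul, g.smul_smul, mul_add, add_mul]
  symm x y := by
    rw [f.symm x.1 y.1, g.symm x.2 y.2, σ.map_add, mul_add]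

/-- The zero form on the zero module. -/
def zero (σ : AlgInvolution R A) (ε : A) : HermForm σ ε PUnit.{v + 1} where
  toFun _ _ := 0
  add_left _ _ _ := by simp
  add_right _ _ _ := by simp
  smul_smul _ _ _ _ := by simp
  symm _ _ := by simp [σ.map_zero]

theorem zero_left (f : HermForm σ ε P) (y : P) : f.toFun 0 y = 0 := by
  simpa using f.add_left 0 0 y

theorem zero_right (f : HermForm σ ε P) (x : P) : f.toFun x 0 = 0 := by
  simpa using f.add_right x 0 0

theorem Unimodular.prod {f : HermForm σ ε P} {g : HermForm σ ε Q} (hf : f.Unimodular)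
    (hg : g.Unimodular) : (f.prod g).Unimodular := by
  constructor
  · intro x x' h
    have h' : ∀ y, (f.prod g).toFun x y = (f.prod g).toFun x' y := fun y => LinearMap.congr_fun h y
    refine Prod.ext (hf.1 ?_) (hg.1 ?_)
    · ext y
      simpa [HermForm.prod, zero_right, toHom] using h' (y, 0)
    · ext y
      simpa [HermForm.prod, zero_right, toHom] using h' (0, y)
  · intro φ
    obtain ⟨x, hx⟩ := hf.2 (φ.comp (LinearMap.inl Aᵐᵒᵖ P Q))
    obtain ⟨y, hy⟩ := hg.2 (φ.comp (LinearMap.inr Aᵐᵒᵖ P Q))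
    refine ⟨(x, y), LinearMap.ext fun z => ?_⟩
    have h1 : f.toFun x z.1 = φ (z.1, 0) := LinearMap.congr_fun hx z.1
    have h2 : g.toFun y z.2 = φ (0, z.2) := LinearMap.congr_fun hy z.2
    change f.toFun x z.1 + g.toFun y z.2 = φ z
    rw [h1, h2, ← _root_.map_add]
    simp

theorem zero_unimodular : (zero σ ε).Unimodular := by
  constructor
  · intro x y _
    rfl
  · intro φ
    refine ⟨PUnit.unit, LinearMap.ext fun z => ?_⟩
    have hz : z = 0 := rfl
    rw [hz, _root_.map_zero, _root_.map_zero]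

end HermForm

/-! ### Duals and the standard hyperbolic form -/

/-- The dual `P* = Hom_A(P, A)` of a right `A`-module, with the right `A`-module structure
`(φ · a) x = σ a * φ x`. -/
def StarDual (_σ : AlgInvolution R A) (P : Type*) [AddCommGroup P] [Module Aᵐᵒᵖ P] :=
  P →ₗ[Aᵐᵒᵖ] A

section StarDual

variable (σ : AlgInvolution R A) (P : Type*) [AddCommGroup P] [Module Aᵐᵒᵖ P]

instance : AddCommGroup (StarDual σ P) := inferInstanceAs (AddCommGroup (P →ₗ[Aᵐᵒᵖ] A))

instance : Module Aᵐᵒᵖ (StarDual σ P) :=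
  letI : Module A (StarDual σ P) := inferInstanceAs (Module A (P →ₗ[Aᵐᵒᵖ] A))
  Module.compHom (StarDual σ P) σ.ofOp

instance : FunLike (StarDual σ P) P A := inferInstanceAs (FunLike (P →ₗ[Aᵐᵒᵖ] A) P A)

variable {σ P}

theorem StarDual.add_apply (φ ψ : StarDual σ P) (x : P) : (φ + ψ) x = φ x + ψ x := rfl

theorem StarDual.smul_apply (φ : StarDual σ P) (a : A) (x : P) : (op a • φ) x = σ a * φ x := rfl

theorem StarDual.apply_add (φ : StarDual σ P) (x y : P) : φ (x + y) = φ x + φ y :=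
  LinearMap.map_add (σ := RingHom.id Aᵐᵒᵖ) φ x y

theorem StarDual.apply_smul (φ : StarDual σ P) (a : A) (x : P) : φ (op a • x) = φ x * a :=
  LinearMap.map_smul (R := Aᵐᵒᵖ) φ (op a) x

end StarDual

/-- The hyperbolic `ε`-hermitian form `ℍ(V)` on `V ⊕ V*`, given by
`((x, φ), (x', φ')) ↦ φ x' + ε * σ (φ' x)`. -/
def hypForm (σ : AlgInvolution R A) (ε : A) (hε : ε ∈ Set.center A) (hεσ : σ ε * ε = 1)
    (V : Type*) [AddCommGroup V] [Module Aᵐᵒᵖ V] : HermForm σ ε (V × StarDual σ V) where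
  toFun z w := z.2 w.1 + ε * σ (w.2 z.1)
  add_left z z' w := by
    simp only [Prod.fst_add, Prod.snd_add, StarDual.add_apply, StarDual.apply_add, σ.map_add,
      mul_add]
    abel
  add_right z w w' := by
    simp only [Prod.fst_add, Prod.snd_add, StarDual.add_apply, StarDual.apply_add, σ.map_add,
      mul_add]
    abel
  smul_smul z w a b := by
    have hc : ∀ c, ε * c = c * ε := fun c => (Set.mem_center_iff.1 hε).comm c
    simp only [Prod.smul_fst, Prod.smul_snd, StarDual.smul_apply, StarDual.apply_smul,
      σ.map_mul', σ.involutive', mul_add, add_mul, mul_assoc]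
    rw [← mul_assoc ε (σ a), hc (σ a), mul_assoc]
  symm z w := by
    have hc : ∀ c, ε * c = c * ε := fun c => (Set.mem_center_iff.1 hε).comm c
    have h1 : ε * σ ε = 1 := by rw [hc, hεσ]
    rw [σ.map_add, σ.map_mul', σ.involutive', mul_add, ← mul_assoc, hc (z.2 w.1), mul_assoc, h1,
      mul_one, add_comm]

/-! ### Unimodular hermitian spaces and the Witt group -/

/-- A unimodular `ε`-hermitian space over `(A, σ)`: a finitely generated projective right
`A`-module together with a unimodular `ε`-hermitian form. -/
structure HermSpace (σ : AlgInvolution R A) (ε : A) where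
  carrier : Type v
  [addCommGroup : AddCommGroup carrier]
  [module : Module Aᵐᵒᵖ carrier]
  [finite : Module.Finite Aᵐᵒᵖ carrier]
  [projective : Module.Projective Aᵐᵒᵖ carrier]
  form : HermForm σ ε carrier
  unimodular : form.Unimodular

attribute [instance] HermSpace.addCommGroup HermSpace.module HermSpace.finite
  HermSpace.projective

namespace HermSpace

variable (σ : AlgInvolution R A) (ε : A)

/-- Isometry of unimodular `ε`-hermitian spaces, as an equivalence relation. -/
instance isometrySetoid : Setoid (HermSpace σ ε) where
  r F G := F.form.Isometric G.form
  iseqv :=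
    { refl := fun _ => ⟨LinearEquiv.refl _ _, fun _ _ => rfl⟩
      symm := fun ⟨φ, h⟩ => ⟨φ.symm, fun x y => by rw [← h]; simp⟩
      trans := fun ⟨φ, h⟩ ⟨ψ, k⟩ => ⟨φ.trans ψ, fun x y => by simp [k, h]⟩ }

/-- The isometry classes of unimodular `ε`-hermitian spaces over `(A, σ)`. -/
def IsometryClass := Quotient (isometrySetoid σ ε)

variable {σ ε}

/-- The orthogonal sum of unimodular `ε`-hermitian spaces. -/
def sum (F G : HermSpace σ ε) : HermSpace σ ε where
  carrier := F.carrier × G.carrier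
  form := F.form.prod G.form
  unimodular := F.unimodular.prod G.unimodular

variable (σ ε) in
/-- The zero space. -/
def zero : HermSpace σ ε where
  carrier := PUnit.{v + 1}
  form := HermForm.zero σ ε
  unimodular := HermForm.zero_unimodular

/-- Addition of isometry classes is given by orthogonal sum. -/
instance : Add (IsometryClass σ ε) where
  add := Quotient.map₂ sum fun _ _ ⟨φ, h⟩ _ _ ⟨ψ, k⟩ =>
    ⟨φ.prodCongr ψ, fun x y => congrArg₂ (· + ·) (h x.1 y.1) (k x.2 y.2)⟩

instance : Zero (IsometryClass σ ε) where
  zero := Quotient.mk (isometrySetoid σ ε) (zero σ ε)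

/-- Isometry classes form a commutative monoid under orthogonal sum. -/
instance : AddCommMonoid (IsometryClass σ ε) where
  add_assoc := by
    rintro ⟨F⟩ ⟨G⟩ ⟨H⟩
    exact Quotient.sound ⟨LinearEquiv.prodAssoc Aᵐᵒᵖ _ _ _, fun x y => (add_assoc _ _ _).symm⟩
  zero_add := by
    rintro ⟨F⟩
    exact Quotient.sound ⟨(LinearEquiv.uniqueProd : (PUnit.{v + 1} × F.carrier) ≃ₗ[Aᵐᵒᵖ] F.carrier),
      fun x y => (zero_add (F.form.toFun x.2 y.2)).symm⟩
  add_zero := by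
    rintro ⟨F⟩
    exact Quotient.sound ⟨(LinearEquiv.prodUnique : (F.carrier × PUnit.{v + 1}) ≃ₗ[Aᵐᵒᵖ] F.carrier),
      fun x y => (add_zero (F.form.toFun x.1 y.1)).symm⟩
  add_comm := by
    rintro ⟨F⟩ ⟨G⟩
    exact Quotient.sound ⟨LinearEquiv.prodComm Aᵐᵒᵖ _ _, fun x y => add_comm _ _⟩
  nsmul := nsmulRec

/-- The isometry class of a space, in the Grothendieck group of isometry classes. -/
noncomputable def grothendieckClass (F : HermSpace σ ε) :
    Algebra.GrothendieckAddGroup (IsometryClass σ ε) :=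
  Algebra.GrothendieckAddGroup.of (Quotient.mk (isometrySetoid σ ε) F)

variable (σ ε) in
/-- The subgroup of the Grothendieck group generated by the classes of hyperbolic spaces. -/
noncomputable def hyperbolicSubgroup :
    AddSubgroup (Algebra.GrothendieckAddGroup (IsometryClass σ ε)) :=
  AddSubgroup.closure {c | ∃ H : HermSpace σ ε, H.form.Hyperbolic ∧ c = H.grothendieckClass}

end HermSpace

/-- The Witt group `W_ε(A, σ)`. -/
abbrev WittGroup (σ : AlgInvolution R A) (ε : A) :=
  Algebra.GrothendieckAddGroup (HermSpace.IsometryClass σ ε) ⧸ HermSpace.hyperbolicSubgroup σ ε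

/-- The class of a unimodular `ε`-hermitian space in the Witt group. -/
noncomputable def HermSpace.wittClass {σ : AlgInvolution R A} {ε : A} (F : HermSpace σ ε) :
    WittGroup σ ε :=
  QuotientAddGroup.mk F.grothendieckClass

end Forms

end AzumayaWitt

namespace AzumayaWitt

/-! ### Separability elements and averaging -/

/-! Let `J` be the Jacobson radical of `R`. Separability enters through an element `∑ xᵢ ⊗ yᵢ` that
turns `R`-linear maps into `A`-linear ones by averaging. Hence `A` is finite over `R`, `A/JA` is
semisimple, and invertibility modulo `JA` lifts to `A` by Nakayama.

The heart is cancellation of one hyperbolic plane, `isometric_of_prod_hypPlane`. An isometry from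
`f' ⊥ ℍ` to `f ⊥ ℍ` carries the hyperbolic pair of the first plane to a pair `(v, w)` whose
orthogonal complement is a copy of `f'`. Up to isometry that complement is `v^⊥/vA`, so it depends
only on the isotropic vector `v` (`isometric_restrict_pairPerp`). It is therefore enough to find one
isotropic `z` that pairs to a unit both with `v` and with the standard vector `e₁`: the complements
of `(v, w)`, `(v, z)`, `(z, e₁)`, `(e₁, e₂)` are then isometric in turn, and the last is `f`. Such a
`z` comes from an Eichler transformation making a coordinate of `v` invertible modulo `JA`
(`exists_eichler_mul_eq_one`). This requires `f` to have enough values wherever the last coordinate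
of `v` is nonzero. By `exists_support` there is a central idempotent `t` with `A t` inside the
values of `f` and `P = P t`; on the part `1 - t` the vector `v` may simply be replaced by `e₁`.

Equality of Witt classes gives `f ⊥ ℍ(L) ≅ f' ⊥ ℍ(L')`, and one may enlarge `L'` to a free module
`Aⁿ`. The rank hypothesis then bounds `2 rk Aⁿ` by `rk L + rk L*`. Over a semilocal base ranks
decide which projective modules are direct summands (`exists_equiv_prod_of_centerRank_le`), but `rk
L` and `rk L*` may differ on parts of the spectrum of the centre exchanged by `σ`. Since `ℍ(V)` does
not change when a component of `V` is replaced by its dual, all the rank can be moved to one of two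
exchanged parts, and `ℍ(L)` splits as `ℍ(W) ⊥ ℍ(Aⁿ)` (`exists_hypForm_isometric_prod_free`).
Cancelling `n` planes leaves `f ⊥ ℍ(W) ≅ f'`, the first claim. The second is the case where `f` is
the zero space; in the third the ranks force the hyperbolic summand to vanish. -/

theorem exists_retraction {S M : Type*} [Ring S] [AddCommGroup M] [Module S M]
    [IsSemisimpleModule S M] (N : Submodule S M) : ∃ g : M →ₗ[S] N, ∀ n : N, g n = n := by
  obtain ⟨N', h⟩ := exists_isCompl N
  exact ⟨N.projectionOnto N' h, fun n => Submodule.projectionOnto_apply_left h n⟩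

section Separability

variable (R : Type u) (A : Type v) [CommRing R] [Ring A] [Algebra R A]

/-- A separability element `∑ xᵢ ⊗ yᵢ` of the `R`-algebra `A`. -/
structure SeparabilityElement where
  n : ℕ
  x : Fin n → A
  y : Fin n → A
  sum_mul : ∑ i, x i * y i = 1
  comm : ∀ a : A, ∑ i, (a * x i) ⊗ₜ[R] y i = ∑ i, x i ⊗ₜ[R] (y i * a)

variable {R A}

/-- Projectivity splits the multiplication map from the enveloping algebra to `A`. The image of `1`
under a splitting is the required element, since left and right multiplication agree on `1`. -/
theorem IsSeparableAlgebra.nonempty_separabilityElement (h : IsSeparableAlgebra R A) :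
    Nonempty (SeparabilityElement R A) := by
  let _ : Module (A ⊗[R] Aᵐᵒᵖ) A := TensorProduct.Algebra.module
  have hp : Module.Projective (A ⊗[R] Aᵐᵒᵖ) A := h
  have hsurj : Function.Surjective (LinearMap.toSpanSingleton (A ⊗[R] Aᵐᵒᵖ) A 1) := by
    intro a
    refine ⟨a ⊗ₜ 1, ?_⟩
    rw [LinearMap.toSpanSingleton_apply, TensorProduct.Algebra.smul_def]
    simp
  obtain ⟨s, hs⟩ := Module.projective_lifting_property _ LinearMap.id hsurj
  have hs1 : s 1 • (1 : A) = 1 := by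
    have := LinearMap.congr_fun hs 1
    simpa using this
  obtain ⟨n, x, y, hxy⟩ := TensorProduct.exists_sum_tmul_eq (s 1)
  have hcomm : ∀ a : A, (a ⊗ₜ[R] (1 : Aᵐᵒᵖ)) * s 1 = ((1 : A) ⊗ₜ[R] op a) * s 1 := by
    intro a
    rw [← smul_eq_mul, ← smul_eq_mul, ← map_smul, ← map_smul, TensorProduct.Algebra.smul_def,
      TensorProduct.Algebra.smul_def]
    simp
  refine ⟨⟨n, x, fun i => (y i).unop, ?_, fun a => ?_⟩⟩
  · rw [← hs1, hxy, Finset.sum_smul]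
    refine Finset.sum_congr rfl fun i _ => ?_
    rw [TensorProduct.Algebra.smul_def]
    change _ = x i * (1 * (y i).unop)
    rw [one_mul]
  · have h1 := hcomm a
    rw [hxy, Finset.mul_sum, Finset.mul_sum] at h1
    simp only [Algebra.TensorProduct.tmul_mul_tmul, one_mul] at h1
    have h2 := congrArg (TensorProduct.map (LinearMap.id : A →ₗ[R] A)
      (MulOpposite.opLinearEquiv R (M := A)).symm.toLinearMap) h1
    simpa using h2

namespace SeparabilityElement

variable (e : SeparabilityElement R A)

theorem sum_bilin {N : Type*} [AddCommGroup N] [Module R N] (β : A →ₗ[R] A →ₗ[R] N) (a : A) :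
    ∑ i, β (a * e.x i) (e.y i) = ∑ i, β (e.x i) (e.y i * a) := by
  have h := congrArg (TensorProduct.lift β) (e.comm a)
  simpa using h

section Average

variable {M N : Type*} [AddCommGroup M] [AddCommGroup N] [Module Aᵐᵒᵖ M] [Module Aᵐᵒᵖ N]
  [Module R M] [Module R N] [IsScalarTower R Aᵐᵒᵖ M] [IsScalarTower R Aᵐᵒᵖ N]

/-- The `A`-linear map obtained from an `R`-linear map by averaging. -/
def average (g : M →ₗ[R] N) : M →ₗ[Aᵐᵒᵖ] N where
  toFun m := ∑ i, op (e.y i) • g (op (e.x i) • m)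
  map_add' m m' := by simp only [smul_add, _root_.map_add, Finset.sum_add_distrib]
  map_smul' c m := by
    have h := e.sum_bilin (LinearMap.mk₂ R (fun x y => op y • g (op x • m))
      (fun x x' y => by simp only [op_add, add_smul, _root_.map_add, smul_add])
      (fun r x y => by
        rw [op_smul, smul_assoc, map_smul, smul_comm])
      (fun x y y' => by simp only [op_add, add_smul])
      (fun r x y => by rw [op_smul, smul_assoc])) c.unop
    simp only [LinearMap.mk₂_apply, op_mul, op_unop, mul_smul] at h
    rw [RingHom.id_apply, h, Finset.smul_sum]

theorem average_apply (g : M →ₗ[R] N) (m : M) :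
    e.average g m = ∑ i, op (e.y i) • g (op (e.x i) • m) := rfl

theorem average_comp (g : M →ₗ[R] N) (j : N →ₗ[Aᵐᵒᵖ] M) (h : ∀ n, g (j n) = n) (n : N) :
    e.average g (j n) = n := by
  rw [average_apply]
  simp only [← map_smul, h]
  simp only [← mul_smul, ← op_mul, ← Finset.sum_smul, ← Finset.op_sum, e.sum_mul, op_one,
    one_smul]

/-- Maschke's argument: an `R`-linear retraction onto an `A`-submodule stays a retraction after
averaging, and is then `A`-linear. -/
theorem isSemisimpleModule (e : SeparabilityElement R A) [IsSemisimpleModule R M] :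
    IsSemisimpleModule Aᵐᵒᵖ M where
  exists_isCompl N := by
    obtain ⟨g, hg⟩ := exists_retraction (N.restrictScalars R)
    have : IsScalarTower R Aᵐᵒᵖ N := ⟨fun r a n => Subtype.ext (smul_assoc r a (n : M))⟩
    exact ⟨LinearMap.ker (e.average (N := N) (show M →ₗ[R] N from g)),
      LinearMap.isCompl_of_proj (e.average_comp (N := N) (show M →ₗ[R] N from g) N.subtype hg)⟩

end Average

/-- Expand the finitely many `xᵢ` in a dual basis of the projective `R`-module `A`. Only finitely
many basis vectors `j` occur, and the products `j * yᵢ` span `A`. -/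
theorem module_finite (e : SeparabilityElement R A) [Module.Projective R A] :
    Module.Finite R A := by
  classical
  obtain ⟨s, hs⟩ := Module.projective_def.1 (inferInstance : Module.Projective R A)
  let F : Finset A := Finset.univ.biUnion fun i => (s (e.x i)).support
  let T : Finset A := Finset.image₂ (fun j i => j * e.y i) F Finset.univ
  refine ⟨⟨T, eq_top_iff.2 fun a _ => ?_⟩⟩
  have hx : ∀ i, ∑ j ∈ F, s (e.x i) j • j = e.x i := by
    intro i
    have h := hs (e.x i)
    rw [Finsupp.linearCombination_apply, Finsupp.sum] at h
    conv_rhs => rw [← h]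
    refine (Finset.sum_subset (Finset.subset_biUnion_of_mem _ (Finset.mem_univ i)) ?_).symm
    intro j _ hj
    rw [Finsupp.notMem_support_iff.1 hj, zero_smul]
  -- The relation of `e` moves `a` into the coordinate functionals, so the spanning vectors no
  -- longer depend on `a`.
  have ha : a = ∑ j ∈ F, ∑ i, s (a * e.x i) j • (j * e.y i) := by
    have h : ∀ j, ∑ i, s (a * e.x i) j • (j * e.y i) = ∑ i, s (e.x i) j • (j * (e.y i * a)) :=
      fun j => e.sum_bilin (LinearMap.mk₂ R (fun x y => s x j • (j * y))
          (fun x x' y => by simp only [_root_.map_add, Finsupp.add_apply, add_smul])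
          (fun r x y => by simp only [map_smul, Finsupp.smul_apply, smul_assoc])
          (fun x y y' => by simp only [mul_add, smul_add])
          (fun r x y => by rw [mul_smul_comm, smul_comm])) a
    simp only [h]
    rw [Finset.sum_comm]
    calc a = ∑ i, e.x i * (e.y i * a) := by
          simp only [← mul_assoc, ← Finset.sum_mul, e.sum_mul, one_mul]
      _ = _ := Finset.sum_congr rfl fun i _ => by
          conv_lhs => rw [← hx i, Finset.sum_mul]
          simp only [smul_mul_assoc]
  rw [ha]
  refine Submodule.sum_mem _ fun j hj => Submodule.sum_mem _ fun i _ =>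
    Submodule.smul_mem _ _ (Submodule.subset_span ?_)
  exact Finset.mem_coe.2 (Finset.mem_image₂_of_mem hj (Finset.mem_univ i))

/-- The projection of `A` on its centre. -/
def centerProj : A →ₗ[R] A where
  toFun a := ∑ i, e.x i * a * e.y i
  map_add' a b := by simp only [mul_add, add_mul, Finset.sum_add_distrib]
  map_smul' r a := by simp [Finset.smul_sum]

theorem centerProj_apply (a : A) : e.centerProj a = ∑ i, e.x i * a * e.y i := rfl

theorem centerProj_mem (a : A) : e.centerProj a ∈ Set.center A := by
  rw [Semigroup.mem_center_iff]
  intro c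
  rw [centerProj_apply, Finset.mul_sum, Finset.sum_mul]
  have h := e.sum_bilin (LinearMap.mk₂ R (fun x y => x * a * y)
    (fun x x' y => by simp only [add_mul]) (fun r x y => by simp)
    (fun x y y' => by simp only [mul_add]) (fun r x y => by simp)) c
  simpa [mul_assoc] using h

theorem centerProj_mul {z : A} (hz : z ∈ Set.center A) (a : A) :
    e.centerProj (z * a) = z * e.centerProj a := by
  rw [centerProj_apply, centerProj_apply, Finset.mul_sum]
  refine Finset.sum_congr rfl fun i _ => ?_
  rw [← mul_assoc (e.x i), Semigroup.mem_center_iff.1 hz (e.x i)]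
  simp only [mul_assoc]

theorem centerProj_one : e.centerProj 1 = 1 := by
  simp [centerProj_apply, e.sum_mul]

theorem centerProj_of_mem {z : A} (hz : z ∈ Set.center A) : e.centerProj z = z := by
  simpa [centerProj_one] using e.centerProj_mul hz 1

end SeparabilityElement

/-! ### Reduction modulo the Jacobson radical of the base -/

/-- By the Chinese remainder theorem the quotient is a finite product of fields. -/
theorem isSemisimpleRing_quotient_jacobson (R : Type*) [CommRing R] [Finite (MaximalSpectrum R)] :
    IsSemisimpleRing (R ⧸ (⊥ : Ideal R).jacobson) := by
  have hJ : (⊥ : Ideal R).jacobson = ⨅ m : MaximalSpectrum R, m.asIdeal := by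
    rw [Ideal.jacobson_bot, Ring.jacobson_eq_sInf_isMaximal, sInf_eq_iInf']
    exact le_antisymm (le_iInf fun m => iInf_le_of_le ⟨m.1, m.2⟩ le_rfl)
      (le_iInf fun m => iInf_le_of_le ⟨m.1, m.2⟩ le_rfl)
  let φ : (R ⧸ (⊥ : Ideal R).jacobson) ≃+* ∀ m : MaximalSpectrum R, R ⧸ m.asIdeal :=
    (Ideal.quotEquivOfEq hJ).trans
      (Ideal.quotientInfRingEquivPiQuotient _ fun _ _ h => Ideal.isCoprime_of_isMaximal
        fun h' => h (MaximalSpectrum.ext h'))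
  have (m : MaximalSpectrum R) : IsSemisimpleRing (R ⧸ m.asIdeal) :=
    let _ := Ideal.Quotient.field m.asIdeal
    inferInstance
  exact φ.symm.isSemisimpleRing

theorem isSemisimpleModule_of_jacobson_smul {R M : Type*} [CommRing R]
    [Finite (MaximalSpectrum R)] [AddCommGroup M] [Module R M]
    (h : ∀ r ∈ (⊥ : Ideal R).jacobson, ∀ m : M, r • m = 0) : IsSemisimpleModule R M := by
  have := isSemisimpleRing_quotient_jacobson R
  have ht : Module.IsTorsionBySet R M ((⊥ : Ideal R).jacobson : Set R) := fun m r => h r r.2 m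
  let _ := ht.module
  let l : M →ₛₗ[Ideal.Quotient.mk (⊥ : Ideal R).jacobson] M :=
    { toFun := id
      map_add' := fun _ _ => rfl
      map_smul' := fun _ _ => rfl }
  exact (l.isSemisimpleModule_iff_of_bijective Function.bijective_id).2 inferInstance

end Separability

section JacobsonIdeal

variable (R : Type u) (A : Type v) [CommRing R] [Ring A] [Algebra R A]

/-- The two-sided ideal of `A` generated by the Jacobson radical of `R`. -/
def jacIdeal : Ideal A where
  carrier := ((⊥ : Ideal R).jacobson • (⊤ : Submodule R A) : Submodule R A)
  add_mem' h h' := Submodule.add_mem _ h h'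
  zero_mem' := Submodule.zero_mem _
  smul_mem' a b hb := by
    have : ((⊥ : Ideal R).jacobson • (⊤ : Submodule R A)).map (LinearMap.mulLeft R a) ≤
        (⊥ : Ideal R).jacobson • (⊤ : Submodule R A) := by
      rw [Submodule.map_smul'']
      exact Submodule.smul_mono le_rfl le_top
    exact this (Submodule.mem_map_of_mem hb)

variable {R A}

theorem mem_jacIdeal {a : A} :
    a ∈ jacIdeal R A ↔ a ∈ (⊥ : Ideal R).jacobson • (⊤ : Submodule R A) := Iff.rfl

theorem map_mem_jacIdeal (g : A →ₗ[R] A) {a : A} (ha : a ∈ jacIdeal R A) :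
    g a ∈ jacIdeal R A := by
  have : ((⊥ : Ideal R).jacobson • (⊤ : Submodule R A)).map g ≤
      (⊥ : Ideal R).jacobson • (⊤ : Submodule R A) := by
    rw [Submodule.map_smul'']
    exact Submodule.smul_mono le_rfl le_top
  exact this (Submodule.mem_map_of_mem ha)

instance : (jacIdeal R A).IsTwoSided where
  mul_mem_of_left b h := map_mem_jacIdeal (LinearMap.mulRight R b) h

theorem algebraMap_mem_jacIdeal {r : R} (hr : r ∈ (⊥ : Ideal R).jacobson) :
    algebraMap R A r ∈ jacIdeal R A := by
  rw [mem_jacIdeal, Algebra.algebraMap_eq_smul_one]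
  exact Submodule.smul_mem_smul hr trivial

/-- Nakayama's lemma for right multiplications. -/
theorem exists_mul_eq_one_of_sub_mem_jacIdeal [Module.Finite R A] {a b : A}
    (h : a * b - 1 ∈ jacIdeal R A) : IsUnit a := by
  have hs : Function.Surjective (LinearMap.mulLeft R a) := by
    rw [← LinearMap.range_eq_top, eq_top_iff]
    refine Submodule.le_of_le_smul_of_le_jacobson_bot (Module.Finite.fg_top) le_rfl ?_
    intro c _
    have hc : c = a * (b * c) + (-(a * b - 1)) * c := by noncomm_ring
    rw [hc]
    exact Submodule.add_mem_sup ⟨b * c, rfl⟩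
      (map_mem_jacIdeal (LinearMap.mulRight R c) (neg_mem h))
  have hi := OrzechProperty.injective_of_surjective_endomorphism _ hs
  obtain ⟨c, hc⟩ := hs 1
  have hc' : a * c = 1 := hc
  have hc2 : c * a = 1 := hi (by simp [← mul_assoc, hc'])
  exact ⟨⟨a, c, hc', hc2⟩, rfl⟩

/-- The image of a separability element under a surjective homomorphism. -/
def SeparabilityElement.map (e : SeparabilityElement R A) {B : Type*} [Ring B] [Algebra R B]
    (ψ : A →ₐ[R] B) (hψ : Function.Surjective ψ) : SeparabilityElement R B where
  n := e.n
  x i := ψ (e.x i)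
  y i := ψ (e.y i)
  sum_mul := by simp only [← map_mul, ← map_sum, e.sum_mul, map_one]
  comm b := by
    obtain ⟨a, rfl⟩ := hψ b
    simpa using congrArg (TensorProduct.map ψ.toLinearMap ψ.toLinearMap) (e.comm a)

variable [Finite (MaximalSpectrum R)]

instance : IsSemisimpleModule R (A ⧸ jacIdeal R A) := by
  refine isSemisimpleModule_of_jacobson_smul fun r hr m => ?_
  obtain ⟨a, rfl⟩ := Ideal.Quotient.mk_surjective m
  change Ideal.Quotient.mk _ (r • a) = 0
  rw [Ideal.Quotient.eq_zero_iff_mem, mem_jacIdeal]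
  exact Submodule.smul_mem_smul hr trivial

/-- Modulo the Jacobson radical of `R`, two-sided ideals of `A` are generated by central
elements of `A`. -/
theorem SeparabilityElement.exists_center_generator (e : SeparabilityElement R A) (I : Ideal A)
    [I.IsTwoSided] :
    ∃ z ∈ Set.center A, z ∈ I ∧ ∀ i ∈ I, z * i - i ∈ jacIdeal R A := by
  let ψ : A →ₗ[R] A ⧸ jacIdeal R A := (Ideal.Quotient.mkₐ R (jacIdeal R A)).toLinearMap
  have hψ : Function.Surjective ψ := Ideal.Quotient.mk_surjective
  have hψm : ∀ a b, ψ (a * b) = ψ a * ψ b := fun a b => map_mul (Ideal.Quotient.mk _) a b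
  have hψ0 : ∀ a, ψ a = 0 ↔ a ∈ jacIdeal R A := fun a => Ideal.Quotient.eq_zero_iff_mem
  obtain ⟨g, hg⟩ := exists_retraction ((I.restrictScalars R).map ψ)
  -- Averaging the retraction `g` on both sides makes it a bimodule map. It still restricts to the
  -- quotient map on `I`, so `θ 1` is central and acts as the identity on the image of `I`.
  let θ : A → A ⧸ jacIdeal R A := fun c =>
    ∑ i, ∑ j, ψ (e.x i) * (g (ψ (e.y i * c * e.x j)) : A ⧸ jacIdeal R A) * ψ (e.y j)
  have hθl : ∀ a c, θ (a * c) = ψ a * θ c := by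
    intro a c
    have h := e.sum_bilin (LinearMap.mk₂ R (fun x y => ∑ j,
        ψ x * (g (ψ (y * c * e.x j)) : A ⧸ jacIdeal R A) * ψ (e.y j))
      (fun x x' y => by simp only [_root_.map_add, add_mul, Finset.sum_add_distrib])
      (fun r x y => by simp [Finset.smul_sum])
      (fun x y y' => by
        simp only [_root_.map_add, add_mul, mul_add, Submodule.coe_add, Finset.sum_add_distrib])
      (fun r x y => by simp [Finset.smul_sum])) a
    simp only [LinearMap.mk₂_apply] at h
    simp only [θ, Finset.mul_sum]
    simp only [mul_assoc, hψm] at h ⊢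
    exact h.symm
  have hθr : ∀ a c, θ (c * a) = θ c * ψ a := by
    intro a c
    have h := e.sum_bilin (LinearMap.mk₂ R (fun x y => ∑ i,
        ψ (e.x i) * (g (ψ (e.y i * c * x)) : A ⧸ jacIdeal R A) * ψ y)
      (fun x x' y => by
        simp only [_root_.map_add, add_mul, mul_add, Submodule.coe_add, Finset.sum_add_distrib])
      (fun r x y => by simp [Finset.smul_sum])
      (fun x y y' => by simp only [_root_.map_add, mul_add, Finset.sum_add_distrib])
      (fun r x y => by simp [Finset.smul_sum])) a
    simp only [LinearMap.mk₂_apply] at h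
    simp only [θ, Finset.sum_mul]
    refine (Finset.sum_comm.trans ?_).trans Finset.sum_comm
    simp only [mul_assoc, hψm] at h ⊢
    exact h
  have hθI : ∀ c ∈ I, θ c = ψ c := by
    intro c hc
    have hgc : ∀ i j, (g (ψ (e.y i * c * e.x j)) : A ⧸ jacIdeal R A) = ψ (e.y i * c * e.x j) :=
      fun i j => congrArg Subtype.val (hg ⟨_, Submodule.mem_map_of_mem (f := ψ)
        (show e.y i * c * e.x j ∈ I.restrictScalars R from
          I.mul_mem_right _ (I.mul_mem_left _ hc))⟩)
    simp only [θ, hgc, ← hψm]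
    simp only [← map_sum, mul_assoc, ← Finset.mul_sum, e.sum_mul, mul_one]
    simp only [← mul_assoc, ← Finset.sum_mul, e.sum_mul, one_mul]
  have hmem : ∃ e0 ∈ I, ψ e0 = θ 1 := by
    have : θ 1 ∈ (I.restrictScalars R).map ψ := by
      refine Submodule.sum_mem _ fun i _ => Submodule.sum_mem _ fun j _ => ?_
      obtain ⟨b, hb, hb'⟩ := (g (ψ (e.y i * 1 * e.x j))).2
      rw [← hb', ← hψm, ← hψm]
      exact Submodule.mem_map_of_mem (f := ψ) (show _ ∈ I.restrictScalars R from
        I.mul_mem_right _ (I.mul_mem_left _ hb))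
    obtain ⟨e0, h0, h1⟩ := this
    exact ⟨e0, h0, h1⟩
  obtain ⟨e0, he0, he1⟩ := hmem
  -- A lift `e0` of `θ 1` need not be central; projecting it to the centre does not change its
  -- class, because `θ 1` commutes with everything.
  have hz : ψ (e.centerProj e0) = θ 1 := by
    rw [e.centerProj_apply, map_sum]
    have h1 : ∀ a, ψ a * θ 1 = θ 1 * ψ a := fun a => by rw [← hθl, ← hθr, mul_one, one_mul]
    simp only [hψm, he1, h1]
    simp only [mul_assoc, ← hψm, ← Finset.mul_sum, ← map_sum, e.sum_mul]
    exact mul_one _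
  refine ⟨e.centerProj e0, e.centerProj_mem _, ?_, fun i hi => ?_⟩
  · rw [e.centerProj_apply]
    exact Ideal.sum_mem _ fun i _ => I.mul_mem_right _ (I.mul_mem_left _ he0)
  · rw [← hψ0, map_sub, hψm, hz, ← hθr, one_mul, hθI i hi, sub_self]

/-- Separability passes to the quotient, which is semisimple over `R`, so averaging applies to its
right regular module. -/
theorem SeparabilityElement.isSemisimpleModule_quotient_jacIdeal (e : SeparabilityElement R A) :
    IsSemisimpleModule (A ⧸ jacIdeal R A)ᵐᵒᵖ (A ⧸ jacIdeal R A) :=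
  (e.map (Ideal.Quotient.mkₐ R (jacIdeal R A)) Ideal.Quotient.mk_surjective).isSemisimpleModule

end JacobsonIdeal

/-! ### Calculus of involutions and hermitian forms -/

section Involution

variable {R : Type u} {A : Type v} [CommRing R] [Ring A] [Algebra R A] (σ : AlgInvolution R A)

theorem AlgInvolution.map_smul (r : R) (a : A) : σ (r • a) = r • σ a := σ.toLinearMap.map_smul r a

theorem AlgInvolution.map_neg (a : A) : σ (-a) = -σ a := σ.toLinearMap.map_neg a

theorem AlgInvolution.map_sub (a b : A) : σ (a - b) = σ a - σ b := σ.toLinearMap.map_sub a b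

theorem AlgInvolution.map_mul (a b : A) : σ (a * b) = σ b * σ a := σ.map_mul' a b

theorem AlgInvolution.apply_apply (a : A) : σ (σ a) = a := σ.involutive' a

variable {σ} {ε : A} {P : Type*} [AddCommGroup P] [Module Aᵐᵒᵖ P] (f : HermForm σ ε P)

namespace HermForm

theorem smul_right (x y : P) (a : A) : f.toFun x (op a • y) = f.toFun x y * a := by
  have h := f.smul_smul x y 1 a
  rwa [op_one, one_smul, σ.map_one, one_mul] at h

theorem smul_left (x y : P) (a : A) : f.toFun (op a • x) y = σ a * f.toFun x y := by
  have h := f.smul_smul x y a 1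
  rwa [op_one, one_smul, mul_one] at h

theorem neg_right (x y : P) : f.toFun x (-y) = -f.toFun x y := (f.toHom x).map_neg y

theorem sub_right (x y y' : P) : f.toFun x (y - y') = f.toFun x y - f.toFun x y' :=
  (f.toHom x).map_sub y y'

theorem neg_left (x y : P) : f.toFun (-x) y = -f.toFun x y := by
  rw [eq_neg_iff_add_eq_zero, ← f.add_left, neg_add_cancel, f.zero_left]

theorem sub_left (x x' y : P) : f.toFun (x - x') y = f.toFun x y - f.toFun x' y := by
  rw [sub_eq_add_neg, f.add_left, f.neg_left, ← sub_eq_add_neg]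

/-- The additive group generated by the values of a hermitian form. -/
def valueGroup : AddSubgroup A := AddSubgroup.closure {a | ∃ x y, a = f.toFun x y}

end HermForm

end Involution

/-! ### Annihilators in semisimple rings -/

section Regular

instance module_finite_op (B : Type*) [Ring B] : Module.Finite Bᵐᵒᵖ B :=
  ⟨⟨{1}, eq_top_iff.2 fun b _ => by
    rw [Finset.coe_singleton]
    exact Submodule.mem_span_singleton.2 ⟨op b, one_mul b⟩⟩⟩

variable {B : Type*} [Ring B] [IsSemisimpleModule Bᵐᵒᵖ B]

/-- Von Neumann regularity: a retraction onto the right ideal `αB` sends `1` to some `αw`, and it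
fixes `α`. -/
theorem exists_mul_mul_eq (α : B) : ∃ w, α * w * α = α := by
  obtain ⟨g, hg⟩ := exists_retraction (Submodule.span Bᵐᵒᵖ {α})
  obtain ⟨w, hw⟩ := Submodule.mem_span_singleton.1 (g 1).2
  refine ⟨w.unop, ?_⟩
  have h1 := congrArg Subtype.val (hg ⟨α, Submodule.mem_span_singleton_self α⟩)
  have h2 : g α = op α • g 1 := by rw [← map_smul, op_smul_eq_mul, one_mul]
  rw [h2, Submodule.coe_smul, ← hw, op_smul_eq_mul] at h1
  exact h1

/-- The right annihilator of an element, as a right ideal. -/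
def rightAnnihilator (α : B) : Submodule Bᵐᵒᵖ B where
  carrier := {t | α * t = 0}
  add_mem' h h' := by rw [Set.mem_ofPred_eq, mul_add, h, h', add_zero]
  zero_mem' := mul_zero α
  smul_mem' c t h := by
    change α * (t * c.unop) = 0
    rw [← mul_assoc, h, zero_mul]

/-- The elements `c` with `(1 - αw)Bc = 0` form a two-sided ideal on which left multiplication by
`α` is surjective, with preimage `wc`. By the Noetherian property it is injective there. As `tykt`
lies in this ideal and is killed by `α`, it vanishes for every `y`; regularity of `kt` concludes.
Later `α` is an entry whose annihilator is minimal, and this lemma removes the factor `1 - αw` from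
equations. -/
theorem mul_eq_zero_of_complement_mul_eq_zero {α w : B} {k t : B}
    (ht : α * t = 0) (h : ∀ y, (1 - α * w) * y * (k * t) = 0) : k * t = 0 := by
  let X : Submodule Bᵐᵒᵖ B :=
    { carrier := {c | ∀ y, (1 - α * w) * y * c = 0}
      add_mem' := fun h h' y => by rw [mul_add, h, h', add_zero]
      zero_mem' := fun y => mul_zero _
      smul_mem' := fun c x h y => by
        change _ * (x * c.unop) = 0
        rw [← mul_assoc, h, zero_mul] }
  have hX : ∀ b, ∀ c ∈ X, b * c ∈ X := fun b c hc y => by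
    rw [← mul_assoc, mul_assoc _ y b, hc]
  let g : X →ₗ[Bᵐᵒᵖ] X :=
    { toFun := fun c => ⟨α * c, hX α c c.2⟩
      map_add' := fun c d => Subtype.ext (mul_add _ _ _)
      map_smul' := fun c d => Subtype.ext (mul_assoc α (d : B) c.unop).symm }
  have hg : Function.Surjective g := by
    intro c
    refine ⟨⟨w * c, hX w c c.2⟩, Subtype.ext ?_⟩
    have h1 := c.2 1
    rw [mul_one, sub_mul, one_mul, sub_eq_zero] at h1
    exact ((mul_assoc _ _ _).symm.trans h1.symm)
  have hg' := IsNoetherian.injective_of_surjective_endomorphism g hg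
  have hX0 : ∀ c ∈ X, α * c = 0 → c = 0 := fun c hc h0 =>
    congrArg Subtype.val (@hg' ⟨c, hc⟩ 0 (Subtype.ext (h0.trans (mul_zero α).symm)))
  obtain ⟨y, hy⟩ := exists_mul_mul_eq (k * t)
  have h3 : t * y * (k * t) = 0 :=
    hX0 _ (hX _ _ h) (by rw [mul_assoc t, ← mul_assoc α, ht, zero_mul])
  rw [← hy, mul_assoc k t y, mul_assoc k, h3, mul_zero]

theorem mul_eq_one_of_rightAnnihilator_eq_bot {α : B} (h : ∀ t, α * t = 0 → t = 0) :
    ∃ w, α * w = 1 := by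
  let g : B →ₗ[Bᵐᵒᵖ] B :=
    { toFun := fun c => α * c
      map_add' := mul_add α
      map_smul' := fun c d => (mul_assoc α d c.unop).symm }
  have hg : Function.Injective g := (injective_iff_map_eq_zero g).2 h
  exact IsArtinian.surjective_of_injective_endomorphism g hg 1

end Regular

/-! ### Making a coordinate of an isotropic vector invertible -/

section UnitLemma

variable {R : Type u} {A : Type v} [CommRing R] [Ring A] [Algebra R A] {σ : AlgInvolution R A}
  {ε : A} {P : Type*} [AddCommGroup P] [Module Aᵐᵒᵖ P]

/-- If `(p, a, b)` is an isotropic unimodular vector in the sum of `f` and a hyperbolic plane,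
and `f` is sufficiently large where `b` does not vanish, then `a` can be made right invertible
modulo the radical by an Eichler transformation. -/
theorem HermForm.exists_eichler_mul_eq_one (f : HermForm σ ε P) (hε : ε ∈ Set.center A)
    (hεσ : σ ε * ε = 1) {κ : R} (hκ : κ + κ = 1) {B : Type*} [Ring B] [IsSemisimpleModule Bᵐᵒᵖ B]
    (ψ : A →+* B) (hψ : Function.Surjective ψ) {p : P} {a b τ : A}
    (hiso : f.toFun p p + ε * σ a * b + σ b * a = 0)
    (huni : ∃ y c d, f.toFun y p + c * a + d * b = 1)
    (hτ : ∀ r, r * τ ∈ f.valueGroup) (hb : τ * b = b) :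
    ∃ x s, s + ε * σ s = 0 ∧
      ∃ w, ψ (a + f.toFun x p + (s - κ • f.toFun x x) * b) * w = 1 := by
  have hc : ∀ c, ε * c = c * ε := fun c => (Set.mem_center_iff.1 hε).comm c
  have h1κ : ∀ c : A, κ • c + κ • c = c := fun c => by rw [← add_smul, hκ, one_smul]
  have hεf : ∀ x y, ε * σ (f.toFun x y) = f.toFun y x := fun x y => (f.symm y x).symm
  -- `E x s` is the first coordinate after the Eichler transformation with parameters `x` and `s`,
  -- where `s` is skew. The parameters are chosen to minimise its right annihilator modulo `ψ`; the
  -- rest shows that this annihilator is zero.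
  let E : P → A → A := fun x s => a + f.toFun x p + (s - κ • f.toFun x x) * b
  obtain ⟨N, ⟨x, s, hs, rfl⟩, hmin⟩ := IsArtinian.set_has_minimal
    {N : Submodule Bᵐᵒᵖ B | ∃ x s, s + ε * σ s = 0 ∧ N = rightAnnihilator (ψ (E x s))}
    ⟨_, 0, 0, by simp [σ.map_zero], rfl⟩
  refine ⟨x, s, hs, mul_eq_one_of_rightAnnihilator_eq_bot fun t ht => ?_⟩
  obtain ⟨a₁, hEdef⟩ : ∃ a₁, a₁ = a + f.toFun x p + (s - κ • f.toFun x x) * b := ⟨_, rfl⟩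
  obtain ⟨p₁, hp₁⟩ : ∃ p₁, p₁ = p - op b • x := ⟨_, rfl⟩
  have hmin' : ∀ x' s', s' + ε * σ s' = 0 →
      ¬ rightAnnihilator (ψ (E x' s')) < rightAnnihilator (ψ a₁) := fun x' s' h => by
    rw [hEdef]
    exact hmin _ ⟨x', s', h, rfl⟩
  rw [← hEdef] at ht
  -- The transformed vector `(p₁, a₁, b)` is again isotropic.
  have hiso₁ : f.toFun p₁ p₁ + ε * σ a₁ * b + σ b * a₁ = 0 := by
    have h1 : ε * σ a₁ = ε * σ a + f.toFun p x + σ b * (-s - κ • f.toFun x x) := by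
      have hb' : ε * σ b = σ b * ε := hc _
      rw [hEdef, σ.map_add, σ.map_add, σ.map_mul, σ.map_sub, σ.map_smul, mul_add, mul_add, hεf,
        ← mul_assoc, hb', mul_assoc, mul_sub, mul_smul_comm, hεf, eq_neg_of_add_eq_zero_right hs]
    rw [h1, hEdef]
    simp only [hp₁, f.sub_left, f.sub_right, f.smul_left, f.smul_right]
    have hk := h1κ (f.toFun x x)
    generalize κ • f.toFun x x = k at hk
    rw [← hk, ← hiso]
    noncomm_ring
  -- Composition law of Eichler transformations: a further one, with parameters scaled by `u`,
  -- changes `a₁` by a left multiple of `u`. The `κ`-term in the second parameter absorbs the cross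
  -- terms of `f` between `x` and the new vector.
  have hpert : ∀ (u : A) (x0 : P) (s0 : A),
      E (x + op (σ u) • x0) (s + u * s0 * σ u + κ • (f.toFun x (op (σ u) • x0) -
        f.toFun (op (σ u) • x0) x)) =
      a₁ + u * (f.toFun x0 p₁ + (s0 - κ • f.toFun x0 x0) * σ u * b) := by
    intro u x0 s0
    rw [hEdef]
    simp only [E, hp₁, f.add_left, f.add_right, f.sub_right, f.smul_left, f.smul_right,
      σ.apply_apply, smul_add, smul_sub, ← mul_smul_comm]
    have hk := h1κ (f.toFun x0 x)
    generalize κ • f.toFun x0 x = k at hk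
    rw [← hk]
    noncomm_ring
  have hpert' : ∀ (u : A) (x0 : P) (s0 : A), s0 + ε * σ s0 = 0 →
      (s + u * s0 * σ u + κ • (f.toFun x (op (σ u) • x0) - f.toFun (op (σ u) • x0) x)) + ε *
      σ (s + u * s0 * σ u + κ • (f.toFun x (op (σ u) • x0) - f.toFun (op (σ u) • x0) x)) = 0 := by
    intro u x0 s0 hs0
    have h1 : ε * σ (u * s0 * σ u) = u * (ε * σ s0) * σ u := by
      rw [σ.map_mul, σ.map_mul, σ.apply_apply, ← mul_assoc ε, hc u, mul_assoc u, mul_assoc u,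
        mul_assoc ε]
    rw [σ.map_add, σ.map_add, σ.map_smul, σ.map_sub, mul_add, mul_add, h1, mul_smul_comm, mul_sub,
      hεf, hεf, eq_neg_of_add_eq_zero_right hs, eq_neg_of_add_eq_zero_right hs0,
      ← neg_sub (f.toFun x _), smul_neg]
    noncomm_ring
  obtain ⟨w, hw⟩ := exists_mul_mul_eq (ψ a₁)
  obtain ⟨w, rfl⟩ := hψ w
  -- Modulo `ψ`, the element `1 - a₁ * w` is an idempotent that kills `a₁` from the left.
  have hh : ψ (1 - a₁ * w) * ψ a₁ = 0 := by
    rw [_root_.map_sub, _root_.map_one, _root_.map_mul, sub_mul, one_mul, hw, sub_self]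
  have hh' : ψ (1 - a₁ * w) * ψ (1 - a₁ * w) = ψ (1 - a₁ * w) := by
    conv_lhs => rw [← _root_.map_mul, mul_sub, mul_one, ← mul_assoc, _root_.map_sub,
      _root_.map_mul ψ _ w, _root_.map_mul, hh, zero_mul, sub_zero]
  -- Multiplying by that idempotent shows that a perturbation in its left multiples can only shrink
  -- the right annihilator of `a₁`. By minimality it does not, so the perturbing term kills the
  -- whole annihilator.
  have hmain : ∀ (y : A) (x0 : P) (s0 : A), s0 + ε * σ s0 = 0 → ∀ t, ψ a₁ * t = 0 →
      ψ ((1 - a₁ * w) * y * (f.toFun x0 p₁ +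
        (s0 - κ • f.toFun x0 x0) * σ ((1 - a₁ * w) * y) * b)) * t = 0 := by
    intro y x0 s0 hs0 t ht
    have h1 := hpert ((1 - a₁ * w) * y) x0 s0
    set c := f.toFun x0 p₁ + (s0 - κ • f.toFun x0 x0) * σ ((1 - a₁ * w) * y) * b
    have hle : rightAnnihilator (ψ (a₁ + (1 - a₁ * w) * y * c)) ≤ rightAnnihilator (ψ a₁) := by
      intro r hr
      have hr' : ψ (a₁ + (1 - a₁ * w) * y * c) * r = 0 := hr
      rw [_root_.map_add, add_mul] at hr'
      have h2 := congrArg (ψ (1 - a₁ * w) * ·) hr'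
      simp only [mul_add, mul_zero, ← mul_assoc, hh, zero_mul, zero_add] at h2
      rw [mul_assoc _ y, _root_.map_mul, ← mul_assoc (ψ (1 - a₁ * w)), hh', ← _root_.map_mul,
        ← mul_assoc] at h2
      rw [h2, add_zero] at hr'
      exact hr'
    have hge : ψ (a₁ + (1 - a₁ * w) * y * c) * t = 0 := by
      have h3 := hmin' (x + op (σ ((1 - a₁ * w) * y)) • x0) _ (hpert' ((1 - a₁ * w) * y) x0 s0 hs0)
      rw [h1] at h3
      have h4 := eq_of_le_of_not_lt hle h3
      have : t ∈ rightAnnihilator (ψ a₁) := ht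
      rw [← h4] at this
      exact this
    rwa [_root_.map_add, add_mul, ht, zero_add] at hge
  -- Comparing `x0` with `-x0` cancels the quadratic term and leaves twice the linear one.
  have hfp : ∀ x0, ψ (f.toFun x0 p₁) * t = 0 := by
    intro x0
    refine mul_eq_zero_of_complement_mul_eq_zero (α := ψ a₁) (w := ψ w) ht fun y => ?_
    obtain ⟨y, rfl⟩ := hψ y
    have h1 := hmain y x0 0 (by simp [σ.map_zero]) t ht
    have h2 := hmain y (-x0) 0 (by simp [σ.map_zero]) t ht
    simp only [f.neg_left, f.neg_right, neg_neg] at h2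
    have h3 : ψ ((1 - a₁ * w) * y * (f.toFun x0 p₁)) * t +
        ψ ((1 - a₁ * w) * y * (f.toFun x0 p₁)) * t = 0 := by
      rw [← sub_zero 0]
      nth_rewrite 1 [← h1]
      rw [← h2, ← sub_mul, ← add_mul, ← _root_.map_sub, ← _root_.map_add]
      congr 2
      noncomm_ring
    rw [← add_mul, ← _root_.map_add, ← mul_add] at h3
    have h4 := congrArg (ψ (algebraMap R A κ) * ·) h3
    simp only [mul_zero, ← mul_assoc, ← _root_.map_mul] at h4
    rw [mul_assoc, mul_assoc, ← mul_assoc (1 - a₁ * w), ← Algebra.smul_def, ← mul_smul_comm,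
      smul_add, h1κ] at h4
    simpa only [_root_.map_mul, _root_.map_sub, _root_.map_one, mul_assoc] using h4
  -- Applying the isotropy relation to `t` gives `σ(a₁) b t = 0`, so the factor `σ u` in the
  -- perturbation formula acts trivially on `b t`.
  have hσb : ψ (σ (1 - a₁ * w)) * (ψ b * t) = ψ b * t := by
    have h1 := congrArg (fun c => ψ c * t) hiso₁
    simp only [_root_.map_add, _root_.map_mul, add_mul, hfp, mul_assoc, zero_add,
      _root_.map_zero, zero_mul] at h1
    rw [ht, mul_zero, add_zero] at h1
    have h2 : ψ (σ a₁) * (ψ b * t) = 0 := by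
      rw [← one_mul (ψ (σ a₁)), ← _root_.map_one ψ, ← hεσ, _root_.map_mul, mul_assoc, mul_assoc, h1,
        mul_zero]
    rw [σ.map_sub, σ.map_one, σ.map_mul, _root_.map_sub, _root_.map_one, _root_.map_mul, sub_mul,
      one_mul, mul_assoc, h2, mul_zero, sub_zero]
  have hval : ∀ x0 s0, s0 + ε * σ s0 = 0 →
      ψ (1 - a₁ * w) * (ψ (s0 - κ • f.toFun x0 x0) * (ψ b * t)) = 0 := by
    intro x0 s0 hs0
    have h1 := hmain 1 x0 s0 hs0 t ht
    simpa only [mul_one, _root_.map_mul, _root_.map_add, mul_add, add_mul, mul_assoc, hfp, hσb,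
      mul_zero, zero_add] using h1
  have hskew : ∀ s0, s0 + ε * σ s0 = 0 → ψ (1 - a₁ * w) * (ψ s0 * (ψ b * t)) = 0 := by
    intro s0 hs0
    simpa [f.zero_left] using hval 0 s0 hs0
  have hsq : ∀ x0, ψ (1 - a₁ * w) * (ψ (κ • f.toFun x0 x0) * (ψ b * t)) = 0 := by
    intro x0
    simpa [σ.map_zero] using hval x0 0 (by simp [σ.map_zero])
  have hvals : ∀ c ∈ f.valueGroup, ψ (1 - a₁ * w) * (ψ c * (ψ b * t)) = 0 := by
    intro c hcm
    generalize ψ (1 - a₁ * w) = H at hskew hsq ⊢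
    induction hcm using AddSubgroup.closure_induction with
    | mem c h =>
      obtain ⟨x0, y0, rfl⟩ := h
      have h1 := hsq (x0 + y0)
      have h2 := hskew (κ • (f.toFun x0 y0 - f.toFun y0 x0)) (by
        rw [σ.map_smul, σ.map_sub, mul_smul_comm, mul_sub, hεf, hεf, ← smul_add, sub_add_sub_cancel,
          sub_self, smul_zero])
      -- Polarisation: every value of `f` is a combination of halved squares and a skew element.
      have h3 : f.toFun x0 y0 = κ • f.toFun (x0 + y0) (x0 + y0) - κ • f.toFun x0 x0 -
          κ • f.toFun y0 y0 + κ • (f.toFun x0 y0 - f.toFun y0 x0) := by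
        conv_lhs => rw [← h1κ (f.toFun x0 y0)]
        simp only [f.add_left, f.add_right, smul_add, smul_sub]
        abel
      rw [h3, _root_.map_add, _root_.map_sub, _root_.map_sub, add_mul, sub_mul, sub_mul, mul_add,
        mul_sub, mul_sub, h1, h2, hsq, hsq]
      simp
    | zero => simp
    | add c d _ _ h1 h2 => rw [_root_.map_add, add_mul, mul_add, h1, h2, add_zero]
    | neg c _ h1 => rw [_root_.map_neg, neg_mul, mul_neg, h1, neg_zero]
  -- Here the size of `f` is used: every `y * τ` is a sum of values, up to sign, and `τ * b = b`.
  have hbt : ψ b * t = 0 := by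
    refine mul_eq_zero_of_complement_mul_eq_zero (α := ψ a₁) (w := ψ w) ht fun y => ?_
    obtain ⟨y, rfl⟩ := hψ y
    have h1 := hvals _ (hτ y)
    rw [_root_.map_mul, mul_assoc, ← mul_assoc (ψ τ), ← _root_.map_mul ψ τ, hb] at h1
    simpa only [_root_.map_mul, _root_.map_sub, _root_.map_one, mul_assoc] using h1
  have hfp' : ∀ y, ψ (f.toFun y p) * t = 0 := by
    intro y
    have h1 : f.toFun y p = f.toFun y p₁ + f.toFun y x * b := by
      simp only [hp₁, f.sub_right, f.smul_right, sub_add_cancel]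
    rw [h1, _root_.map_add, add_mul, hfp, _root_.map_mul, mul_assoc, hbt, mul_zero, add_zero]
  have hat : ψ a * t = 0 := by
    have h1 : a = a₁ - f.toFun x p - (s - κ • f.toFun x x) * b := by rw [hEdef]; abel
    rw [h1, _root_.map_sub, _root_.map_sub, sub_mul, sub_mul, ht, hfp', _root_.map_mul, mul_assoc,
      hbt, mul_zero, sub_zero, sub_zero]
  -- All entries of the original unimodular vector kill `t`, hence so does `1`.
  obtain ⟨y, c, d, h⟩ := huni
  rw [← one_mul t, ← _root_.map_one ψ, ← h]
  simp only [_root_.map_add, _root_.map_mul, add_mul, mul_assoc, hfp', hat, hbt, mul_zero, add_zero]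

end UnitLemma

/-! ### Central multiplication, dual bases and the ideal of values -/

section Basic

variable {R : Type u} {A : Type v} [CommRing R] [Ring A] [Algebra R A] {σ : AlgInvolution R A}
  {ε : A} {P Q P' : Type*} [AddCommGroup P] [Module Aᵐᵒᵖ P] [AddCommGroup Q] [Module Aᵐᵒᵖ Q]
  [AddCommGroup P'] [Module Aᵐᵒᵖ P']

/-- Multiplication by a central element on a right module. -/
def centerMul (P : Type*) [AddCommGroup P] [Module Aᵐᵒᵖ P] {z : A} (hz : z ∈ Set.center A) :
    P →ₗ[Aᵐᵒᵖ] P where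
  toFun x := op z • x
  map_add' := smul_add _
  map_smul' a x := by
    rw [RingHom.id_apply, ← mul_smul, ← mul_smul]
    congr 1
    exact unop_injective (Semigroup.mem_center_iff.1 hz a.unop)

theorem exists_dual_basis (P : Type*) [AddCommGroup P] [Module Aᵐᵒᵖ P] [Module.Finite Aᵐᵒᵖ P]
    [Module.Projective Aᵐᵒᵖ P] : ∃ (n : ℕ) (v : Fin n → P) (φ : Fin n → P →ₗ[Aᵐᵒᵖ] A),
      ∀ x, ∑ i, op (φ i x) • v i = x := by
  obtain ⟨n, g, hg⟩ := Module.Finite.exists_fin' Aᵐᵒᵖ P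
  obtain ⟨s, hs⟩ := Module.projective_lifting_property g LinearMap.id hg
  let un : Aᵐᵒᵖ →ₗ[Aᵐᵒᵖ] A :=
    { toFun := unop
      map_add' := fun _ _ => rfl
      map_smul' := fun _ _ => rfl }
  refine ⟨n, fun i => g (Pi.single i 1), fun i => un ∘ₗ LinearMap.proj i ∘ₗ s, fun x => ?_⟩
  have h := LinearMap.congr_fun hs x
  rw [LinearMap.comp_apply, LinearMap.pi_apply_eq_sum_univ g] at h
  refine (Finset.sum_congr rfl fun i _ =>
    congrArg (fun y => s x i • g y) (funext fun j => ?_)).trans h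
  rw [Pi.single_apply]
  exact if_congr eq_comm rfl rfl

theorem AlgInvolution.mem_center (σ : AlgInvolution R A) {z : A} (hz : z ∈ Set.center A) :
    σ z ∈ Set.center A := by
  rw [Semigroup.mem_center_iff] at hz ⊢
  intro a
  have h := congrArg σ.toFun (hz (σ a))
  rw [σ.map_mul, σ.map_mul, σ.apply_apply] at h
  exact h.symm

theorem AlgInvolution.mem_jacIdeal (σ : AlgInvolution R A) {a : A} (ha : a ∈ jacIdeal R A) :
    σ a ∈ jacIdeal R A := map_mem_jacIdeal σ.toLinearMap ha

theorem AlgInvolution.isUnit (σ : AlgInvolution R A) {a : A} (ha : IsUnit a) : IsUnit (σ a) := by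
  obtain ⟨b, h1, h2⟩ := isUnit_iff_exists.1 ha
  exact isUnit_iff_exists.2 ⟨σ b, by rw [← σ.map_mul, h2, σ.map_one],
    by rw [← σ.map_mul, h1, σ.map_one]⟩

namespace HermForm

/-- The two-sided ideal generated by the values of a hermitian form. -/
def valueIdeal (f : HermForm σ ε P) : Ideal A where
  __ := f.valueGroup
  smul_mem' a b hb := by
    refine AddSubgroup.closure_induction (p := fun b _ => a * b ∈ f.valueGroup) ?_ ?_ ?_ ?_ hb
    · rintro _ ⟨x, y, rfl⟩
      refine AddSubgroup.subset_closure ⟨op (σ a) • x, y, ?_⟩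
      rw [f.smul_left, σ.apply_apply]
    · rw [mul_zero]
      exact zero_mem _
    · intro b c _ _ h h'
      rw [mul_add]
      exact add_mem h h'
    · intro b _ h
      rw [mul_neg]
      exact neg_mem h

theorem apply_mem_valueIdeal (f : HermForm σ ε P) (x y : P) : f.toFun x y ∈ f.valueIdeal :=
  AddSubgroup.subset_closure ⟨x, y, rfl⟩

theorem valueIdeal_induction {f : HermForm σ ε P} {p : A → Prop}
    (h : ∀ x y, p (f.toFun x y)) (h0 : p 0) (hadd : ∀ a b, p a → p b → p (a + b))
    (hneg : ∀ a, p a → p (-a)) {a : A} (ha : a ∈ f.valueIdeal) : p a :=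
  AddSubgroup.closure_induction (p := fun b _ => p b) (by rintro _ ⟨x, y, rfl⟩; exact h x y) h0
    (fun a b _ _ => hadd a b) (fun a _ => hneg a) ha

instance (f : HermForm σ ε P) : f.valueIdeal.IsTwoSided where
  mul_mem_of_left b ha := by
    refine valueIdeal_induction (p := fun a => a * b ∈ f.valueIdeal) ?_ ?_ ?_ ?_ ha
    · intro x y
      rw [← f.smul_right]
      exact f.apply_mem_valueIdeal _ _
    · rw [zero_mul]
      exact zero_mem _
    · intro a c h h'
      rw [add_mul]
      exact add_mem h h'
    · intro a h
      rw [neg_mul]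
      exact neg_mem h

theorem map_mem_valueIdeal (f : HermForm σ ε P) (hεσ : σ ε * ε = 1) {a : A}
    (ha : a ∈ f.valueIdeal) : σ a ∈ f.valueIdeal := by
  refine valueIdeal_induction (p := fun a => σ a ∈ f.valueIdeal) ?_ ?_ ?_ ?_ ha
  · intro x y
    have h := f.symm y x
    rw [← one_mul (σ _), ← hεσ, mul_assoc, ← h]
    exact Ideal.mul_mem_left _ _ (f.apply_mem_valueIdeal _ _)
  · rw [σ.map_zero]
    exact zero_mem _
  · intro a c h h'
    rw [σ.map_add]
    exact add_mem h h'
  · intro a h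
    rw [σ.map_neg]
    exact neg_mem h

end HermForm

end Basic

/-! ### The support of a unimodular form -/

section Support

variable {R : Type u} {A : Type v} [CommRing R] [Ring A] [Algebra R A] {σ : AlgInvolution R A}
  {ε : A} {P : Type*} [AddCommGroup P] [Module Aᵐᵒᵖ P]

theorem smul_top_mul_mem (K : Ideal R) (g : A →ₗ[R] A) {a : A}
    (ha : a ∈ K • (⊤ : Submodule R A)) : g a ∈ K • (⊤ : Submodule R A) := by
  have : (K • (⊤ : Submodule R A)).map g ≤ K • (⊤ : Submodule R A) := by
    rw [Submodule.map_smul'']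
    exact Submodule.smul_mono le_rfl le_top
  exact this (Submodule.mem_map_of_mem ha)

variable [Finite (MaximalSpectrum R)]

/-- If the values of a unimodular form generate a proper ideal modulo `m`, then they lie in
`m A`. -/
theorem HermForm.valueIdeal_le_smul_top (f : HermForm σ ε P) (hA : IsAzumayaWithInvolution σ)
    (e : SeparabilityElement R A) (hεσ : σ ε * ε = 1) {κ : R} (hκ : κ + κ = 1)
    (m : Ideal R) [hm : m.IsMaximal]
    (h : f.valueIdeal.restrictScalars R ⊔ m • (⊤ : Submodule R A) ≠ ⊤) :
    f.valueIdeal.restrictScalars R ≤ m • (⊤ : Submodule R A) := by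
  have hJm : ∀ a ∈ jacIdeal R A, a ∈ m • (⊤ : Submodule R A) := fun a ha =>
    Submodule.smul_mono (show (⊥ : Ideal R).jacobson ≤ m from sInf_le ⟨bot_le, hm⟩) le_rfl ha
  let I : Ideal A :=
    { carrier := (f.valueIdeal.restrictScalars R ⊔ m • (⊤ : Submodule R A) : Submodule R A)
      add_mem' := fun h h' => Submodule.add_mem _ h h'
      zero_mem' := Submodule.zero_mem _
      smul_mem' := fun a b hb => by
        obtain ⟨c, hc, d, hd, rfl⟩ := Submodule.mem_sup.1 hb
        rw [smul_eq_mul, mul_add]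
        exact Submodule.add_mem_sup (f.valueIdeal.mul_mem_left a hc)
          (smul_top_mul_mem m (LinearMap.mulLeft R a) hd) }
  have hIt : I.IsTwoSided :=
    { mul_mem_of_left := fun a hb => by
        obtain ⟨c, hc, d, hd, rfl⟩ := Submodule.mem_sup.1 hb
        rw [add_mul]
        exact Submodule.add_mem_sup (f.valueIdeal.mul_mem_right a hc)
          (smul_top_mul_mem m (LinearMap.mulRight R a) hd) }
  have hIσ : ∀ a ∈ I, σ a ∈ I := fun a ha => by
    obtain ⟨c, hc, d, hd, rfl⟩ := Submodule.mem_sup.1 ha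
    rw [σ.map_add]
    exact Submodule.add_mem_sup (f.map_mem_valueIdeal hεσ hc)
      (smul_top_mul_mem m σ.toLinearMap hd)
  have hmI : ∀ a ∈ m • (⊤ : Submodule R A), a ∈ I := fun a ha => Submodule.mem_sup_right ha
  -- The ideal `I` is stable under `σ`, so its central generator agrees with its conjugate modulo
  -- `J`. It is therefore congruent to the symmetric element `κ • (z + σ z)`, which comes from some
  -- `r` in `R`.
  obtain ⟨z, hz, hzI, hzi⟩ := e.exists_center_generator I
  have h1 := hzi _ (hIσ z hzI)
  have h2 : z * σ z - z ∈ jacIdeal R A := by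
    have := σ.mem_jacIdeal h1
    rwa [σ.map_sub, σ.map_mul, σ.apply_apply] at this
  have h3 : z - σ z ∈ jacIdeal R A := by
    have := sub_mem h1 h2
    rwa [sub_sub_sub_cancel_left] at this
  have hr : κ • (z + σ z) ∈ Set.range (algebraMap R A) := by
    rw [hA.range_eq]
    refine ⟨?_, ?_⟩
    · rw [Algebra.smul_def]
      exact Set.mul_mem_center (Set.algebraMap_mem_center κ) (Set.add_mem_center hz
        (σ.mem_center hz))
    · rw [σ.map_smul, σ.map_add, σ.apply_apply, add_comm]
  obtain ⟨r, hr⟩ := hr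
  have h4 : z - algebraMap R A r ∈ jacIdeal R A := by
    have h5 : z - algebraMap R A r = κ • (z - σ z) := by
      rw [hr, smul_add, smul_sub]
      nth_rewrite 1 [← one_smul R z]
      rw [← hκ, add_smul]
      abel
    rw [h5, Algebra.smul_def]
    exact Ideal.mul_mem_left _ _ h3
  have hrI : algebraMap R A r ∈ I := by
    have := I.sub_mem hzI (hmI _ (hJm _ h4))
    rwa [sub_sub_cancel] at this
  -- Otherwise `r` is invertible modulo `m` and `I` contains `1`, against properness.
  have hrm : r ∈ m := by
    by_contra hrm
    obtain ⟨s, i, hi, hsi⟩ := hm.exists_inv hrm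
    apply h
    rw [eq_top_iff]
    intro a _
    have h1I : (1 : A) ∈ I := by
      rw [← _root_.map_one (algebraMap R A), ← hsi, _root_.map_add, _root_.map_mul]
      refine I.add_mem (I.mul_mem_left _ hrI) (hmI _ ?_)
      rw [Algebra.algebraMap_eq_smul_one]
      exact Submodule.smul_mem_smul hi trivial
    have := I.mul_mem_left a h1I
    rwa [mul_one] at this
  have hzm : z ∈ m • (⊤ : Submodule R A) := by
    have := Submodule.add_mem _ (hJm _ h4) (show algebraMap R A r ∈ m • (⊤ : Submodule R A) by
      rw [Algebra.algebraMap_eq_smul_one]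
      exact Submodule.smul_mem_smul hrm trivial)
    rwa [sub_add_cancel] at this
  intro t ht
  have h6 := hzi t (Submodule.mem_sup_left ht)
  have := Submodule.sub_mem _ (smul_top_mul_mem m (LinearMap.mulRight R t) hzm) (hJm _ h6)
  rwa [LinearMap.mulRight_apply, sub_sub_cancel] at this

/-- A unimodular form is full over the part of the base where its underlying module does not
vanish. -/
theorem HermForm.exists_support (f : HermForm σ ε P) (hA : IsAzumayaWithInvolution σ)
    (e : SeparabilityElement R A) [Module.Finite R A] [Module.Finite Aᵐᵒᵖ P]
    [Module.Projective Aᵐᵒᵖ P] (hf : f.Unimodular) (hεσ : σ ε * ε = 1) {κ : R} (hκ : κ + κ = 1) :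
    ∃ t ∈ Set.center A, σ t = t ∧ t * t = t ∧ (∀ c, c * t ∈ f.valueIdeal) ∧
      ∀ x : P, op t • x = x := by
  let _ : Module R P := Module.compHom P (algebraMap R Aᵐᵒᵖ)
  have : IsScalarTower R Aᵐᵒᵖ P := ⟨fun r a x => by
    change (r • a) • x = algebraMap R Aᵐᵒᵖ r • a • x
    rw [Algebra.smul_def, mul_smul]⟩
  have : Module.Finite R Aᵐᵒᵖ := Module.Finite.equiv (opLinearEquiv R)
  have : Module.Finite R P := Module.Finite.trans Aᵐᵒᵖ P
  let K : Ideal R := Module.annihilator R P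
  have hK : ∀ a ∈ K • (⊤ : Submodule R A), ∀ x : P, op a • x = 0 := by
    intro a ha x
    refine Submodule.smul_induction_on ha (fun r hr b _ => ?_) (fun a b h h' => ?_)
    · rw [op_smul, smul_assoc]
      exact Module.mem_annihilator.1 hr _
    · rw [op_add, add_smul, h, h', add_zero]
  have hTK : ∀ t ∈ f.valueIdeal, ∀ a ∈ K • (⊤ : Submodule R A), t * a = 0 := by
    intro t ht a ha
    refine valueIdeal_induction (p := fun t => t * a = 0) ?_ (zero_mul a) ?_ ?_ ht
    · intro x y
      rw [← f.smul_right, hK a ha, f.zero_right]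
    · intro b c hb hc
      rw [add_mul, hb, hc, add_zero]
    · intro b hb
      rw [neg_mul, hb, neg_zero]
  have hKT : ∀ t ∈ f.valueIdeal, ∀ a ∈ K • (⊤ : Submodule R A), a * t = 0 := by
    intro t ht a ha
    have := hTK _ (f.map_mem_valueIdeal hεσ ht) _ (smul_top_mul_mem K σ.toLinearMap ha)
    have h1 := congrArg σ.toFun this
    change σ (σ t * σ a) = σ 0 at h1
    rwa [σ.map_mul, σ.apply_apply, σ.apply_apply, σ.map_zero] at h1
  -- Suppose the sum lies over a proper ideal of `R`, contained in the maximal ideal `m`. If the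
  -- values fill `A` modulo `m`, Nakayama puts an element congruent to `1` into that ideal.
  -- Otherwise they lie in `mA`; by unimodularity all functionals on `P` then take values in `mA`,
  -- so `P = mP`, and Nakayama gives an element of `K` congruent to `1`. Both contradict the choice
  -- of `m`.
  have htop : f.valueIdeal.restrictScalars R ⊔ K • (⊤ : Submodule R A) = ⊤ := by
    by_contra hne
    set N := f.valueIdeal.restrictScalars R ⊔ K • (⊤ : Submodule R A) with hN
    have hc : N.comap (Algebra.linearMap R A) ≠ ⊤ := by
      intro htop
      apply hne
      have h1 : (1 : A) ∈ N := by
        have : (1 : R) ∈ N.comap (Algebra.linearMap R A) := htop ▸ trivial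
        simpa using this
      rw [eq_top_iff]
      intro a _
      obtain ⟨c, hc, d, hd, h⟩ := Submodule.mem_sup.1 h1
      rw [← mul_one a, ← h, mul_add]
      exact Submodule.add_mem_sup (f.valueIdeal.mul_mem_left a hc)
        (smul_top_mul_mem K (LinearMap.mulLeft R a) hd)
    obtain ⟨m, hm, hcm⟩ := Ideal.exists_le_maximal _ hc
    have hTm : f.valueIdeal.restrictScalars R ≤ m • (⊤ : Submodule R A) := by
      refine f.valueIdeal_le_smul_top hA e hεσ hκ m fun h => ?_
      obtain ⟨r, hr, hrN⟩ := Submodule.exists_sub_one_mem_and_smul_le_of_fg_of_le_sup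
        (I := m) (N := N) (N' := ⊤) Module.Finite.fg_top le_top
          (by rw [hN, sup_right_comm, h, top_sup_eq])
      have hr1 : r ∈ m := hcm (by
        rw [Submodule.mem_comap, Algebra.linearMap_apply, Algebra.algebraMap_eq_smul_one]
        exact hrN (Submodule.smul_mem_pointwise_smul _ _ _ trivial))
      exact hm.ne_top ((Ideal.eq_top_iff_one _).2 (by simpa using m.sub_mem hr1 hr))
    have hP : (⊤ : Submodule R P) ≤ m • (⊤ : Submodule R P) := by
      intro x _
      obtain ⟨n, v, φ, hv⟩ := exists_dual_basis (A := A) P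
      rw [← hv x]
      refine Submodule.sum_mem _ fun i _ => ?_
      obtain ⟨y, hy⟩ := hf.2 (φ i)
      have hm1 : φ i x ∈ m • (⊤ : Submodule R A) := hTm (by
        rw [← hy]
        exact f.apply_mem_valueIdeal y x)
      refine Submodule.smul_induction_on hm1 (fun r hr b _ => ?_) (fun a b h h' => ?_)
      · rw [op_smul, smul_assoc]
        exact Submodule.smul_mem_smul hr trivial
      · rw [op_add, add_smul]
        exact Submodule.add_mem _ h h'
    obtain ⟨r, hr, hrP⟩ := Submodule.exists_sub_one_mem_and_smul_eq_zero_of_fg_of_le_smul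
      m ⊤ Module.Finite.fg_top hP
    have hr1 : r ∈ m := hcm (by
      rw [Submodule.mem_comap, Algebra.linearMap_apply, Algebra.algebraMap_eq_smul_one]
      exact Submodule.mem_sup_right (Submodule.smul_mem_smul
        (Module.mem_annihilator.2 fun x => hrP x trivial) trivial))
    exact hm.ne_top ((Ideal.eq_top_iff_one _).2 (by simpa using m.sub_mem hr1 hr))
  -- The ideal of values and `K A` annihilate each other, so the component of `1` in the former is
  -- an identity element for it, hence a central idempotent.
  obtain ⟨t, ht, k, hk, htk⟩ := Submodule.mem_sup.1 (show (1 : A) ∈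
    f.valueIdeal.restrictScalars R ⊔ K • (⊤ : Submodule R A) by rw [htop]; trivial)
  have ht' : t ∈ f.valueIdeal := ht
  have hl : ∀ a ∈ f.valueIdeal, t * a = a := fun a ha => by
    nth_rewrite 2 [← one_mul a]
    rw [← htk, add_mul, hKT a ha k hk, add_zero]
  have hr : ∀ a ∈ f.valueIdeal, a * t = a := fun a ha => by
    nth_rewrite 2 [← mul_one a]
    rw [← htk, mul_add, hTK a ha k hk, add_zero]
  refine ⟨t, ?_, ?_, hl t ht', fun c => Ideal.mul_mem_left _ c ht', fun x => ?_⟩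
  · rw [Semigroup.mem_center_iff]
    intro a
    rw [← hl (a * t) (Ideal.mul_mem_left _ _ ht'), ← mul_assoc,
      hr _ (Ideal.mul_mem_right _ _ ht')]
  · have h1 := f.map_mem_valueIdeal hεσ ht'
    rw [← hr _ h1]
    have h2 := congrArg σ.toFun (hr _ h1)
    change σ (σ t * t) = σ (σ t) at h2
    rwa [σ.map_mul, σ.apply_apply] at h2
  · have h1 : op (t + k) • x = x := by rw [htk, op_one, one_smul]
    rwa [op_add, add_smul, hK k hk, add_zero] at h1

end Support

/-! ### Complements of hyperbolic pairs and cancellation of a plane -/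

section Isometry

variable {R : Type u} {A : Type v} [CommRing R] [Ring A] [Algebra R A] {σ : AlgInvolution R A}
  {ε : A} {P Q P' Q' : Type*} [AddCommGroup P] [Module Aᵐᵒᵖ P] [AddCommGroup Q] [Module Aᵐᵒᵖ Q]
  [AddCommGroup P'] [Module Aᵐᵒᵖ P'] [AddCommGroup Q'] [Module Aᵐᵒᵖ Q']

namespace HermForm

theorem Isometric.refl (f : HermForm σ ε P) : f.Isometric f :=
  ⟨LinearEquiv.refl _ _, fun _ _ => rfl⟩

theorem Isometric.symm {f : HermForm σ ε P} {g : HermForm σ ε Q} (h : f.Isometric g) :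
    g.Isometric f := by
  obtain ⟨φ, h⟩ := h
  exact ⟨φ.symm, fun x y => by rw [← h]; simp⟩

theorem Isometric.trans {f : HermForm σ ε P} {g : HermForm σ ε Q} {k : HermForm σ ε P'}
    (h : f.Isometric g) (h' : g.Isometric k) : f.Isometric k := by
  obtain ⟨φ, h⟩ := h
  obtain ⟨ψ, h'⟩ := h'
  exact ⟨φ.trans ψ, fun x y => by simp [h, h']⟩

theorem Isometric.prod {f : HermForm σ ε P} {g : HermForm σ ε Q} {f' : HermForm σ ε P'}
    {g' : HermForm σ ε Q'} (h : f.Isometric f') (h' : g.Isometric g') :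
    (f.prod g).Isometric (f'.prod g') := by
  obtain ⟨φ, h⟩ := h
  obtain ⟨ψ, h'⟩ := h'
  exact ⟨φ.prodCongr ψ, fun x y => congrArg₂ (· + ·) (h x.1 y.1) (h' x.2 y.2)⟩

theorem isometric_prod_assoc (f : HermForm σ ε P) (g : HermForm σ ε Q) (k : HermForm σ ε P') :
    ((f.prod g).prod k).Isometric (f.prod (g.prod k)) :=
  ⟨LinearEquiv.prodAssoc Aᵐᵒᵖ _ _ _, fun _ _ => (add_assoc _ _ _).symm⟩

theorem isometric_prod_comm (f : HermForm σ ε P) (g : HermForm σ ε Q) :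
    (f.prod g).Isometric (g.prod f) :=
  ⟨LinearEquiv.prodComm Aᵐᵒᵖ _ _, fun _ _ => add_comm _ _⟩

/-- The orthogonal complement of two vectors. -/
def pairPerp (h : HermForm σ ε P) (u v : P) : Submodule Aᵐᵒᵖ P :=
  LinearMap.ker (h.toHom u) ⊓ LinearMap.ker (h.toHom v)

theorem mem_pairPerp {h : HermForm σ ε P} {u v y : P} :
    y ∈ h.pairPerp u v ↔ h.toFun u y = 0 ∧ h.toFun v y = 0 := Iff.rfl

theorem pairPerp_comm (h : HermForm σ ε P) (u v : P) : h.pairPerp u v = h.pairPerp v u :=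
  inf_comm _ _

/-- The restriction of a hermitian form to a submodule. -/
def restrict (h : HermForm σ ε P) (N : Submodule Aᵐᵒᵖ P) : HermForm σ ε N where
  toFun x y := h.toFun x y
  add_left _ _ _ := h.add_left _ _ _
  add_right _ _ _ := h.add_right _ _ _
  smul_smul _ _ _ _ := h.smul_smul _ _ _ _
  symm _ _ := h.symm _ _

theorem isUnit_comm (h : HermForm σ ε P) (hε : ε ∈ Set.center A) (hεσ : σ ε * ε = 1) {u v : P}
    (huv : IsUnit (h.toFun u v)) : IsUnit (h.toFun v u) := by
  rw [h.symm]
  refine IsUnit.mul (isUnit_iff_exists.2 ⟨σ ε, ?_, hεσ⟩) (σ.isUnit huv)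
  rw [(Set.mem_center_iff.1 hε).comm, hεσ]

/-- The reduced spaces of an isotropic vector `z` computed with two vectors dual to `z`. -/
theorem isometric_restrict_pairPerp (h : HermForm σ ε P) (hε : ε ∈ Set.center A)
    (hεσ : σ ε * ε = 1) {u v z : P} (hz : h.toFun z z = 0) (hu : IsUnit (h.toFun z u))
    (hv : IsUnit (h.toFun z v)) :
    (h.restrict (h.pairPerp z u)).Isometric (h.restrict (h.pairPerp z v)) := by
  -- The functional `g` measures the coordinate along `z`: it is `h(u, -)` normalised to take the
  -- value `1` at `z`.
  have key : ∀ u : P, IsUnit (h.toFun z u) → ∃ g : P →ₗ[Aᵐᵒᵖ] A, ∀ y,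
      h.toFun u y = h.toFun u z * g y := by
    intro u hu
    obtain ⟨b, hb, -⟩ := isUnit_iff_exists.1 (h.isUnit_comm hε hεσ hu)
    exact ⟨⟨⟨fun y => b * h.toFun u y, fun y y' => by rw [h.add_right, mul_add]⟩,
      fun c y => (congrArg (b * ·) ((h.toHom u).map_smul c y)).trans (mul_assoc b _ _).symm⟩,
      fun y => by
        change _ = _ * (b * _)
        rw [← mul_assoc, hb, one_mul]⟩
  have inj : ∀ u : P, IsUnit (h.toFun z u) → ∀ a, h.toFun u z * a = 0 → a = 0 := by
    intro u hu a ha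
    exact ((h.isUnit_comm hε hεσ hu).mul_right_eq_zero).1 ha
  obtain ⟨g, hg⟩ := key u hu
  obtain ⟨k, hk⟩ := key v hv
  have hgz : ∀ a, g (op a • z) = a := by
    intro a
    have h1 := hg (op a • z)
    rw [h.smul_right] at h1
    rw [← sub_eq_zero]
    exact inj u hu _ (by rw [mul_sub, ← h1, sub_self])
  have hkz : ∀ a, k (op a • z) = a := by
    intro a
    have h1 := hk (op a • z)
    rw [h.smul_right] at h1
    rw [← sub_eq_zero]
    exact inj v hv _ (by rw [mul_sub, ← h1, sub_self])
  have mk : ∀ (u : P) (g : P →ₗ[Aᵐᵒᵖ] A) (_ : ∀ y, h.toFun u y = h.toFun u z * g y)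
      (_ : ∀ a, g (op a • z) = a) (y : P), h.toFun z y = 0 → y - op (g y) • z ∈ h.pairPerp z u := by
    intro u g hg hgz y hy
    refine mem_pairPerp.2 ⟨?_, ?_⟩
    · rw [h.sub_right, h.smul_right, hz, hy, zero_mul, sub_zero]
    · rw [hg, _root_.map_sub, hgz, sub_self, mul_zero]
  -- Both complements represent `z^⊥/zA`. Passing from one to the other subtracts a multiple of `z`,
  -- which the form does not see on `z^⊥`.
  let tr : ∀ g : P →ₗ[Aᵐᵒᵖ] A, P →ₗ[Aᵐᵒᵖ] P := fun g =>
    { toFun := fun y => y - op (g y) • z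
      map_add' := fun y y' => by rw [_root_.map_add, op_add, add_smul]; abel
      map_smul' := fun c y => by
        rw [map_smul, RingHom.id_apply, smul_sub, ← mul_smul]
        rfl }
  have hu0 : ∀ y ∈ h.pairPerp z u, g y = 0 := fun y hy =>
    inj u hu _ (by rw [← hg]; exact hy.2)
  have hv0 : ∀ y ∈ h.pairPerp z v, k y = 0 := fun y hy =>
    inj v hv _ (by rw [← hk]; exact hy.2)
  refine ⟨LinearEquiv.ofLinearMap
    ((tr k).restrict fun y hy => mk v k hk hkz y hy.1)
    ((tr g).restrict fun y hy => mk u g hg hgz y hy.1) ?_ ?_, fun x y => ?_⟩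
  · ext ⟨y, hy⟩
    change (y - op (g y) • z) - op (k (y - op (g y) • z)) • z = y
    rw [_root_.map_sub, hkz, hv0 y hy, zero_sub, op_neg, neg_smul]
    abel
  · ext ⟨y, hy⟩
    change (y - op (k y) • z) - op (g (y - op (k y) • z)) • z = y
    rw [_root_.map_sub, hgz, hu0 y hy, zero_sub, op_neg, neg_smul]
    abel
  · change h.toFun ((x : P) - op (k x) • z) ((y : P) - op (k y) • z) = h.toFun x y
    have hx0 : h.toFun x z = 0 := by
      rw [h.symm, show h.toFun z x = 0 from x.2.1, σ.map_zero, mul_zero]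
    rw [h.sub_left, h.sub_right, h.sub_right, h.smul_right, hx0, h.smul_left,
      show h.toFun z y = 0 from y.2.1, h.smul_left, h.smul_right, hz]
    simp

theorem isometric_restrict_map {h : HermForm σ ε P} {k : HermForm σ ε Q} (Φ : P ≃ₗ[Aᵐᵒᵖ] Q)
    (hΦ : ∀ x y, k.toFun (Φ x) (Φ y) = h.toFun x y) (u v : P) :
    (h.restrict (h.pairPerp u v)).Isometric (k.restrict (k.pairPerp (Φ u) (Φ v))) := by
  refine ⟨Φ.ofSubmodules _ _ ?_, fun x y => hΦ x y⟩
  ext y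
  rw [Submodule.mem_map]
  constructor
  · rintro ⟨x, hx, rfl⟩
    exact mem_pairPerp.2 ⟨(hΦ u x).trans hx.1, (hΦ v x).trans hx.2⟩
  · intro hy
    refine ⟨Φ.symm y, mem_pairPerp.2 ⟨?_, ?_⟩, Φ.apply_symm_apply y⟩
    · rw [← hΦ, Φ.apply_symm_apply]
      exact hy.1
    · rw [← hΦ, Φ.apply_symm_apply]
      exact hy.2

/-- The hyperbolic plane, in coordinates. -/
def hypPlane (σ : AlgInvolution R A) (ε : A) (hε : ε ∈ Set.center A) (hεσ : σ ε * ε = 1) :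
    HermForm σ ε (A × A) where
  toFun x y := σ x.1 * y.2 + ε * σ x.2 * y.1
  add_left x x' y := by
    simp only [Prod.fst_add, Prod.snd_add, σ.map_add, add_mul, mul_add]
    abel
  add_right x y y' := by
    simp only [Prod.fst_add, Prod.snd_add, mul_add]
    abel
  smul_smul x y a b := by
    have hc : ∀ c, ε * c = c * ε := fun c => (Set.mem_center_iff.1 hε).comm c
    simp only [Prod.smul_fst, Prod.smul_snd, op_smul_eq_mul, σ.map_mul]
    rw [← mul_assoc ε (σ a), hc (σ a)]
    noncomm_ring
  symm x y := by
    have hc : ∀ c, ε * c = c * ε := fun c => (Set.mem_center_iff.1 hε).comm c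
    have h1 : ∀ c, ε * (c * σ ε) = c := fun c => by rw [hc, mul_assoc, hεσ, mul_one]
    rw [σ.map_add, σ.map_mul, σ.map_mul, σ.map_mul, σ.apply_apply, σ.apply_apply, mul_add,
      ← mul_assoc (σ x.1), h1, mul_assoc]
    abel

/-- The identification of `A` with its dual that makes the hyperbolic plane standard. -/
def selfDualEquiv (σ : AlgInvolution R A) (ε : A) (hε : ε ∈ Set.center A) (hεσ : σ ε * ε = 1) :
    A ≃ₗ[Aᵐᵒᵖ] StarDual σ A where
  toFun d := show A →ₗ[Aᵐᵒᵖ] A from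
    { toFun := fun y => ε * σ d * y
      map_add' := mul_add _
      map_smul' := fun c y => (mul_assoc _ y c.unop).symm }
  map_add' d d' := LinearMap.ext fun y => by
    change ε * σ (d + d') * y = ε * σ d * y + ε * σ d' * y
    rw [σ.map_add, mul_add, add_mul]
  map_smul' a d := LinearMap.ext fun y => by
    change ε * σ (d * a.unop) * y = σ a.unop * (ε * σ d * y)
    rw [σ.map_mul, ← mul_assoc, (Set.mem_center_iff.1 hε).comm]
    simp only [mul_assoc]
  invFun φ := σ (φ 1) * ε
  left_inv d := by
    change σ (ε * σ d * 1) * ε = d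
    rw [mul_one, σ.map_mul, σ.apply_apply, mul_assoc, hεσ, mul_one]
  right_inv φ := LinearMap.ext fun y => by
    change ε * σ (σ (φ 1) * ε) * y = φ y
    rw [σ.map_mul, σ.apply_apply, ← mul_assoc, (Set.mem_center_iff.1 hε).comm, hεσ, one_mul,
      ← StarDual.apply_smul, op_smul_eq_mul, one_mul]

theorem hypPlane_isometric (hε : ε ∈ Set.center A) (hεσ : σ ε * ε = 1) :
    (hypPlane σ ε hε hεσ).Isometric (hypForm σ ε hε hεσ A) := by
  refine ⟨(LinearEquiv.refl Aᵐᵒᵖ A).prodCongr (selfDualEquiv σ ε hε hεσ), fun x y => ?_⟩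
  change selfDualEquiv σ ε hε hεσ x.2 y.1 + ε * σ (selfDualEquiv σ ε hε hεσ y.2 x.1) =
    σ x.1 * y.2 + ε * σ x.2 * y.1
  have ha : ∀ d y, selfDualEquiv σ ε hε hεσ d y = ε * σ d * y := fun _ _ => rfl
  rw [ha, ha]
  have hc : ∀ c, ε * (c * σ ε) = c := fun c => by
    rw [(Set.mem_center_iff.1 hε).comm, mul_assoc, hεσ, mul_one]
  rw [σ.map_mul, σ.map_mul, σ.apply_apply, ← mul_assoc (σ x.1), hc, add_comm]

/-- This turns a space into the complement of an explicit pair, so that cancellation becomes a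
comparison of two pairs in one space. -/
theorem isometric_prod_restrict (f : HermForm σ ε P) (hε : ε ∈ Set.center A)
    (hεσ : σ ε * ε = 1) :
    f.Isometric ((f.prod (hypPlane σ ε hε hεσ)).restrict
      ((f.prod (hypPlane σ ε hε hεσ)).pairPerp (0, (1, 0)) (0, (0, 1)))) := by
  have hmem : ∀ x : P × A × A, x ∈ (f.prod (hypPlane σ ε hε hεσ)).pairPerp (0, (1, 0)) (0, (0, 1)) ↔
      x.2 = 0 := by
    intro x
    rw [mem_pairPerp]
    change f.toFun 0 x.1 + (σ 1 * x.2.2 + ε * σ 0 * x.2.1) = 0 ∧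
      f.toFun 0 x.1 + (σ 0 * x.2.2 + ε * σ 1 * x.2.1) = 0 ↔ _
    rw [f.zero_left, σ.map_zero, σ.map_one, zero_mul, mul_zero, zero_mul, one_mul, mul_one,
      zero_add, zero_add, zero_add, add_zero, Prod.ext_iff, and_comm]
    refine and_congr ⟨fun h => ?_, fun h => by rw [h]; exact mul_zero _⟩ Iff.rfl
    rw [← one_mul x.2.1, ← hεσ, mul_assoc, h, mul_zero]
    rfl
  refine ⟨LinearEquiv.ofLinearMap
    ((LinearMap.inl Aᵐᵒᵖ P (A × A)).codRestrict _ fun x => (hmem _).2 rfl)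
    ((LinearMap.fst Aᵐᵒᵖ P (A × A)).comp (Submodule.subtype _)) ?_ ?_, fun x y => ?_⟩
  · ext ⟨x, hx⟩
    · rfl
    · exact congrArg Prod.fst ((hmem x).1 hx).symm
    · exact congrArg Prod.snd ((hmem x).1 hx).symm
  · ext x
    rfl
  · change f.toFun x y + (σ 0 * 0 + ε * σ 0 * 0) = f.toFun x y
    rw [mul_zero, mul_zero, add_zero, add_zero]

/-- Cancellation of a hyperbolic plane. -/
theorem isometric_of_prod_hypPlane [Finite (MaximalSpectrum R)] (hA : IsAzumayaWithInvolution σ)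
    (e : SeparabilityElement R A) [Module.Finite R A] {κ : R} (hκ : κ + κ = 1)
    (hε : ε ∈ Set.center A) (hεσ : σ ε * ε = 1) [Module.Finite Aᵐᵒᵖ P] [Module.Projective Aᵐᵒᵖ P]
    {f : HermForm σ ε P} (hf : f.Unimodular) {f' : HermForm σ ε P'}
    (h : (f'.prod (hypPlane σ ε hε hεσ)).Isometric (f.prod (hypPlane σ ε hε hεσ))) :
    f'.Isometric f := by
  obtain ⟨Φ, hΦ⟩ := h
  obtain ⟨t, htc, hσt, htt, htf, htP⟩ := f.exists_support hA e hf hεσ hκ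
  set H := f.prod (hypPlane σ ε hε hεσ) with hH
  have hHdef : ∀ (x y : P) (a b c d : A), H.toFun (x, (a, b)) (y, (c, d)) =
    f.toFun x y + (σ a * d + ε * σ b * c) := fun _ _ _ _ _ _ => rfl
  have hc : ∀ c, ε * c = c * ε := (Set.mem_center_iff.1 hε).comm
  have hcc : ∀ c, ε * (c * σ ε) = c := fun c => by rw [hc, mul_assoc, hεσ, mul_one]
  have htc' : ∀ c, t * c = c * t := (Set.mem_center_iff.1 htc).comm
  have hsc : 1 - t ∈ Set.center A := by
    rw [sub_eq_add_neg]
    exact Set.add_mem_center Set.one_mem_center (Set.neg_mem_center htc)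
  have hscomm : ∀ c, (1 - t) * c = c * (1 - t) := (Set.mem_center_iff.1 hsc).comm
  have hst : (1 - t) * t = 0 := by rw [sub_mul, one_mul, htt, sub_self]
  have hts : t * (1 - t) = 0 := by rw [mul_sub, mul_one, htt, sub_self]
  have hss : (1 - t) * (1 - t) = 1 - t := by rw [mul_sub, mul_one, hst, sub_zero]
  have hσs : σ (1 - t) = 1 - t := by rw [σ.map_sub, σ.map_one, hσt]
  set v := Φ (0, (1, 0)) with hv
  set w := Φ (0, (0, 1)) with hw
  set e₁ : P × A × A := (0, (1, 0)) with he₁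
  set e₂ : P × A × A := (0, (0, 1)) with he₂
  have hvv : H.toFun v v = 0 := by
    rw [hΦ]
    change f'.toFun 0 0 + (σ 1 * 0 + ε * σ 0 * 1) = 0
    rw [f'.zero_left, σ.map_zero]
    simp
  have hvw : H.toFun v w = 1 := by
    rw [hΦ]
    change f'.toFun 0 0 + (σ 1 * 1 + ε * σ 0 * 0) = 1
    rw [f'.zero_left, σ.map_one]
    simp
  have hwv : H.toFun w v = ε := by rw [H.symm, hvw, σ.map_one, mul_one]
  have he11 : H.toFun e₁ e₁ = 0 := by
    rw [he₁, hHdef, f.zero_left, σ.map_zero]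
    simp
  have he21 : H.toFun e₂ e₁ = ε := by
    rw [he₁, he₂, hHdef, f.zero_left, σ.map_one]
    simp
  have hP : ∀ x : P, op (1 - t) • x = 0 := fun x => by
    rw [op_sub, op_one, sub_smul, one_smul, htP, sub_self]
  -- Where `P` vanishes, `Φ` identifies `P' × A × A` with `A × A`. The second projection then gives
  -- a surjective endomorphism of the finite `R`-module `A × A`, which is injective, so `P'`
  -- vanishes there too.
  have hP' : ∀ x' : P', op (1 - t) • x' = 0 := by
    let g : A × A →ₗ[Aᵐᵒᵖ] A × A :=
      centerMul (A × A) hsc ∘ₗ LinearMap.snd Aᵐᵒᵖ P' (A × A) ∘ₗ Φ.symm.toLinearMap ∘ₗ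
        LinearMap.inr Aᵐᵒᵖ P (A × A) + centerMul (A × A) htc
    have hg : ∀ y, g y = op (1 - t) • (Φ.symm (0, y)).2 + op t • y := fun _ => rfl
    have hsurj : Function.Surjective (g.restrictScalars R) := by
      intro y
      have h1 : Φ.symm (0, op (1 - t) • (Φ (0, y)).2) = (0, op (1 - t) • y) := by
        rw [LinearEquiv.symm_apply_eq]
        have h2 : ((0, op (1 - t) • y) : P' × A × A) = op (1 - t) • (0, y) :=
          Prod.ext (smul_zero _).symm rfl
        rw [h2, map_smul]
        exact Prod.ext (hP _).symm rfl
      have h3 : Φ.symm (0, op t • y) = op t • Φ.symm (0, y) := by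
        rw [← map_smul]
        exact congrArg Φ.symm (Prod.ext (smul_zero _).symm rfl)
      refine ⟨op (1 - t) • (Φ (0, y)).2 + op t • y, ?_⟩
      change g _ = _
      have h4 : ((0, op (1 - t) • (Φ (0, y)).2 + op t • y) : P × A × A) =
          (0, op (1 - t) • (Φ (0, y)).2) + (0, op t • y) := by simp
      rw [hg, h4, _root_.map_add, h1, h3, Prod.snd_add, Prod.smul_snd, smul_add, smul_add,
        ← mul_smul, ← mul_smul, ← mul_smul, ← mul_smul, ← op_mul, ← op_mul, ← op_mul, ← op_mul,
        hss, hts, hst, htt, op_zero, zero_smul, zero_smul, zero_add, add_zero, ← add_smul, ← op_add,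
        sub_add_cancel, op_one, one_smul]
    have hinj := OrzechProperty.injective_of_surjective_endomorphism _ hsurj
    intro x'
    have h1 : Φ (op (1 - t) • x', 0) = (0, op (1 - t) • (Φ (x', 0)).2) := by
      have h2 : ((op (1 - t) • x', 0) : P' × A × A) = op (1 - t) • (x', 0) :=
        Prod.ext rfl (smul_zero _).symm
      rw [h2, map_smul]
      exact Prod.ext (hP _) rfl
    have h2 : op (1 - t) • (Φ (x', 0)).2 = 0 := by
      apply hinj
      rw [_root_.map_zero]
      change g _ = 0
      rw [hg, ← h1, Φ.symm_apply_apply, smul_zero, zero_add, ← mul_smul, ← op_mul, hst, op_zero,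
        zero_smul]
    rw [h2] at h1
    exact congrArg Prod.fst (Φ.injective (h1.trans (_root_.map_zero Φ).symm))
  -- The given pair is kept on the support of `f` and replaced by the standard one elsewhere. This
  -- makes `t` act as the identity on the last coordinate of `v'`.
  set v' := op t • v + op (1 - t) • e₁ with hv'
  set w' := op t • w + op (1 - t) • e₂ with hw'
  have hv'y : ∀ y, H.toFun v' y = t * H.toFun v y + (1 - t) * H.toFun e₁ y := fun y => by
    rw [hv', H.add_left, H.smul_left, H.smul_left, hσt, hσs]
  have hw'y : ∀ y, H.toFun w' y = t * H.toFun w y + (1 - t) * H.toFun e₂ y := fun y => by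
    rw [hw', H.add_left, H.smul_left, H.smul_left, hσt, hσs]
  have hQ : ∀ y : P' × A × A, op (1 - t) • y.2 = 0 → op (1 - t) • Φ y = 0 := fun y hy => by
    rw [← map_smul, show op (1 - t) • y = 0 from Prod.ext (hP' _) hy, _root_.map_zero]
  have hinv : ∀ c, (1 - t) * (ε * c) = 0 → (1 - t) * c = 0 := fun c h => by
    have h1 := congrArg (σ ε * ·) h
    simp only [mul_zero] at h1
    rwa [← mul_assoc (1 - t), ← hc (1 - t), mul_assoc ε, ← mul_assoc (σ ε), hεσ, one_mul] at h1
  have hkill : ∀ y : P × A × A, (1 - t) * H.toFun v y = 0 → (1 - t) * H.toFun w y = 0 →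
      op (1 - t) • y = 0 := by
    intro y h1 h2
    obtain ⟨⟨x', c, d⟩, rfl⟩ := Φ.surjective y
    apply hQ
    rw [hv, hΦ] at h1
    rw [hw, hΦ] at h2
    change (1 - t) * (f'.toFun 0 x' + (σ 1 * d + ε * σ 0 * c)) = 0 at h1
    change (1 - t) * (f'.toFun 0 x' + (σ 0 * d + ε * σ 1 * c)) = 0 at h2
    rw [f'.zero_left, σ.map_zero, σ.map_one, mul_zero, zero_mul, add_zero, one_mul, zero_add] at h1
    rw [f'.zero_left, σ.map_zero, σ.map_one, mul_one, zero_mul, zero_add, zero_add] at h2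
    refine Prod.ext ?_ ?_
    · change c * (1 - t) = 0
      rw [← hscomm, hinv c h2]
    · change d * (1 - t) = 0
      rw [← hscomm, h1]
  have hkill' : ∀ y : P × A × A, (1 - t) * H.toFun e₁ y = 0 → (1 - t) * H.toFun e₂ y = 0 →
      op (1 - t) • y = 0 := by
    rintro ⟨p, c, d⟩ h1 h2
    rw [he₁, hHdef, f.zero_left, σ.map_zero, σ.map_one, mul_zero, zero_mul, add_zero, one_mul,
      zero_add] at h1
    rw [he₂, hHdef, f.zero_left, σ.map_zero, σ.map_one, mul_one, zero_mul, zero_add, zero_add] at h2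
    refine Prod.ext (hP p) (Prod.ext ?_ ?_)
    · change c * (1 - t) = 0
      rw [← hscomm, hinv c h2]
    · change d * (1 - t) = 0
      rw [← hscomm, h1]
  have hsH : ∀ x y : P × A × A, (1 - t) * H.toFun x y = H.toFun x (op (1 - t) • y) := fun x y => by
    rw [H.smul_right, hscomm]
  have hsplit : ∀ c d : A, t * c + (1 - t) * d = 0 → t * c = 0 ∧ (1 - t) * d = 0 := by
    intro c d hcd
    constructor
    · have h1 := congrArg (t * ·) hcd
      simpa only [mul_add, ← mul_assoc, htt, hts, zero_mul, add_zero, mul_zero] using h1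
    · have h1 := congrArg ((1 - t) * ·) hcd
      simpa only [mul_add, ← mul_assoc, hss, hst, zero_mul, zero_add, mul_zero] using h1
  have hparts : ∀ c : A, t * c + (1 - t) * c = c := fun c => by
    rw [← add_mul, add_sub_cancel, one_mul]
  -- On the part `1 - t` either pair spans the whole space, so both complements are zero there.
  have hperp : H.pairPerp v w = H.pairPerp v' w' := by
    ext y
    rw [mem_pairPerp, mem_pairPerp, hv'y, hw'y]
    constructor
    · rintro ⟨h1, h2⟩
      have h3 := hkill y (by rw [h1, mul_zero]) (by rw [h2, mul_zero])
      rw [h1, h2, hsH, hsH, h3, H.zero_right, H.zero_right, mul_zero, add_zero]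
      exact ⟨rfl, rfl⟩
    · rintro ⟨h1, h2⟩
      obtain ⟨h1, h1'⟩ := hsplit _ _ h1
      obtain ⟨h2, h2'⟩ := hsplit _ _ h2
      have h3 := hkill' y h1' h2'
      rw [← hparts (H.toFun v y), ← hparts (H.toFun w y), h1, h2, hsH, hsH, h3, H.zero_right,
        H.zero_right, add_zero]
      exact ⟨rfl, rfl⟩
  have hv'r : ∀ y, H.toFun y v' = H.toFun y v * t + H.toFun y e₁ * (1 - t) := fun y => by
    rw [hv', H.add_right, H.smul_right, H.smul_right]
  have hv'v' : H.toFun v' v' = 0 := by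
    rw [hv'y, hv'r, hv'r, hvv, he11, zero_mul, zero_mul, zero_add, add_zero, ← hscomm, ← htc',
      ← mul_assoc, ← mul_assoc, hts, hst, zero_mul, zero_mul, add_zero]
  have hw'v' : H.toFun w' v' = ε := by
    rw [hw'y, hv'r, hv'r, hwv, he21, mul_add, mul_add, ← hscomm, ← hscomm, ← htc', ← htc',
      ← mul_assoc, ← mul_assoc, ← mul_assoc, ← mul_assoc, hts, hst, htt, hss, zero_mul, zero_mul,
      add_zero, zero_add, hparts]
  have htb : t * v'.2.2 = v'.2.2 := by
    change t * (v.2.2 * t + 0 * (1 - t)) = v.2.2 * t + 0 * (1 - t)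
    rw [zero_mul, add_zero, htc', mul_assoc, htt]
  obtain ⟨⟨p, a, b⟩, hpab⟩ : ∃ y : P × A × A, y = v' := ⟨_, rfl⟩
  obtain ⟨⟨q, a₂, b₂⟩, hqab⟩ : ∃ y : P × A × A, y = w' := ⟨_, rfl⟩
  rw [← hpab] at htb
  rw [← hpab, hHdef] at hv'v'
  rw [← hpab, ← hqab, hHdef] at hw'v'
  have := e.isSemisimpleModule_quotient_jacIdeal
  -- Scaling the first coordinate by `ε` converts the coordinates of `hypPlane` to the convention of
  -- `exists_eichler_mul_eq_one`.
  have hiso : f.toFun p p + ε * σ (ε * a) * b + σ b * (ε * a) = 0 := by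
    rw [σ.map_mul, hcc, ← mul_assoc, ← hc (σ b), add_assoc]
    exact hv'v'
  obtain ⟨x, s, hs, u, hu⟩ := f.exists_eichler_mul_eq_one hε hεσ hκ
    (Ideal.Quotient.mk (jacIdeal R A)) Ideal.Quotient.mk_surjective hiso
    ⟨op ε • q, σ ε * σ b₂, σ ε * σ a₂, by
      rw [f.smul_left, mul_assoc (σ ε), ← mul_assoc (σ b₂), ← hc, mul_assoc (σ ε), ← mul_add,
        ← mul_add, add_assoc, add_comm (ε * σ b₂ * a), hw'v', hεσ]⟩ htf htb
  obtain ⟨u, rfl⟩ := Ideal.Quotient.mk_surjective u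
  rw [← _root_.map_mul, ← _root_.map_one (Ideal.Quotient.mk (jacIdeal R A)), Ideal.Quotient.eq] at hu
  have hunit := exists_mul_eq_one_of_sub_mem_jacIdeal hu
  -- The coordinates are chosen so that `H(z, v')` is the entry just made invertible, while `H(z,
  -- e₁) = ε`. The skewness of `s` and the term with `κ` make `z` isotropic.
  set z : P × A × A := (x, (σ (s - κ • f.toFun x x), 1)) with hz
  have hzz : H.toFun z z = 0 := by
    rw [hz, hHdef, σ.map_one, σ.apply_apply, mul_one, mul_one, σ.map_sub, σ.map_smul, mul_sub,
      eq_neg_of_add_eq_zero_right hs, mul_smul_comm, ← f.symm]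
    have h1 : f.toFun x x = κ • f.toFun x x + κ • f.toFun x x := by rw [← add_smul, hκ, one_smul]
    nth_rw 1 [h1]
    abel
  have hzv : IsUnit (H.toFun z v') := by
    rw [← hpab, hz, hHdef, σ.map_one, σ.apply_apply, mul_one]
    convert hunit using 1
    abel
  have hεu : IsUnit ε := isUnit_iff_exists.2 ⟨σ ε, by rw [hc, hεσ], hεσ⟩
  have hze : H.toFun z e₁ = ε := by
    rw [hz, he₁, hHdef, f.zero_right, σ.map_one, mul_zero, mul_one, mul_one, zero_add, zero_add]
  have hvw' : IsUnit (H.toFun v' w') := H.isUnit_comm hε hεσ (by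
    rw [← hpab, ← hqab, hHdef, hw'v']
    exact hεu)
  have hvv' : H.toFun v' v' = 0 := by
    rw [← hpab, hHdef, hv'v']
  have he12 : IsUnit (H.toFun e₁ e₂) := H.isUnit_comm hε hεσ (by rw [he21]; exact hεu)
  have hez : IsUnit (H.toFun z e₁) := by rw [hze]; exact hεu
  -- The chain of complements: of `(v', w')`, then `(v', z)`, then `(z, e₁)`, then `(e₁, e₂)`.
  -- Consecutive pairs share an isotropic vector.
  have c1 := (f'.isometric_prod_restrict hε hεσ).trans (isometric_restrict_map Φ hΦ _ _)
  have c2 := H.isometric_restrict_pairPerp hε hεσ hvv' hvw' (H.isUnit_comm hε hεσ hzv)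
  have c3 := H.isometric_restrict_pairPerp hε hεσ hzz hzv hez
  have c4 := H.isometric_restrict_pairPerp hε hεσ he11 (H.isUnit_comm hε hεσ hez) he12
  rw [← hv, ← hw, hperp] at c1
  rw [pairPerp_comm _ v' z] at c2
  rw [pairPerp_comm _ z e₁] at c3
  exact (((c1.trans c2).trans c3).trans c4).trans (f.isometric_prod_restrict hε hεσ).symm

end HermForm

end Isometry

/-! ### Duality and standard hyperbolic spaces -/

section Duals

variable {R : Type u} {A : Type v} [CommRing R] [Ring A] [Algebra R A] {σ : AlgInvolution R A}
  {ε : A} {P Q V W : Type*} [AddCommGroup P] [Module Aᵐᵒᵖ P] [AddCommGroup Q] [Module Aᵐᵒᵖ Q]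
  [AddCommGroup V] [Module Aᵐᵒᵖ V] [AddCommGroup W] [Module Aᵐᵒᵖ W]

instance free_op : Module.Free Aᵐᵒᵖ A :=
  Module.Free.of_equiv
    { opAddEquiv.symm with
      map_smul' := fun _ _ => rfl : Aᵐᵒᵖ ≃ₗ[Aᵐᵒᵖ] A }


namespace StarDual

@[ext]
theorem ext {φ ψ : StarDual σ P} (h : ∀ x, φ x = ψ x) : φ = ψ := LinearMap.ext h

theorem zero_apply (x : P) : (0 : StarDual σ P) x = 0 := rfl

theorem apply_zero (φ : StarDual σ P) : φ 0 = 0 := LinearMap.map_zero (σ := RingHom.id Aᵐᵒᵖ) φ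

theorem sum_apply {ι : Type*} (s : Finset ι) (φ : ι → StarDual σ P) (x : P) :
    (∑ i ∈ s, φ i) x = ∑ i ∈ s, φ i x :=
  LinearMap.sum_apply (σ₁₂ := RingHom.id Aᵐᵒᵖ) s φ x

theorem apply_sum {ι : Type*} (s : Finset ι) (φ : StarDual σ P) (x : ι → P) :
    φ (∑ i ∈ s, x i) = ∑ i ∈ s, φ (x i) :=
  _root_.map_sum (show P →ₗ[Aᵐᵒᵖ] A from φ) x s

theorem smul_apply' (φ : StarDual σ P) (a : Aᵐᵒᵖ) (x : P) : (a • φ) x = σ a.unop * φ x := rfl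

/-- The transpose of a linear map. -/
def transpose (σ : AlgInvolution R A) (g : P →ₗ[Aᵐᵒᵖ] Q) : StarDual σ Q →ₗ[Aᵐᵒᵖ] StarDual σ P where
  toFun φ := show P →ₗ[Aᵐᵒᵖ] A from LinearMap.comp (show Q →ₗ[Aᵐᵒᵖ] A from φ) g
  map_add' _ _ := rfl
  map_smul' _ _ := rfl

/-- Isomorphic modules have isomorphic duals. -/
def congr (σ : AlgInvolution R A) (g : P ≃ₗ[Aᵐᵒᵖ] Q) : StarDual σ P ≃ₗ[Aᵐᵒᵖ] StarDual σ Q where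
  __ := transpose σ g.symm.toLinearMap
  invFun := transpose σ g.toLinearMap
  left_inv φ := ext fun x => congrArg φ (g.symm_apply_apply x)
  right_inv φ := ext fun x => congrArg φ (g.apply_symm_apply x)

/-- The dual of a direct sum. -/
def prodEquiv (σ : AlgInvolution R A) (P Q : Type*) [AddCommGroup P] [Module Aᵐᵒᵖ P]
    [AddCommGroup Q] [Module Aᵐᵒᵖ Q] :
    StarDual σ (P × Q) ≃ₗ[Aᵐᵒᵖ] StarDual σ P × StarDual σ Q :=
  LinearEquiv.ofLinearMap
    ((transpose σ (LinearMap.inl Aᵐᵒᵖ P Q)).prod (transpose σ (LinearMap.inr Aᵐᵒᵖ P Q)))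
    ((transpose σ (LinearMap.fst Aᵐᵒᵖ P Q)).coprod (transpose σ (LinearMap.snd Aᵐᵒᵖ P Q)))
    (by
      refine LinearMap.ext fun φ => Prod.ext (ext fun x => ?_) (ext fun x => ?_)
      · change φ.1 x + φ.2 0 = φ.1 x
        rw [apply_zero, add_zero]
      · change φ.1 0 + φ.2 x = φ.2 x
        rw [apply_zero, zero_add])
    (by
      refine LinearMap.ext fun φ => ext fun x => ?_
      change φ (x.1, 0) + φ (0, x.2) = φ x
      rw [← apply_add, Prod.mk_add_mk, add_zero, zero_add])

/-- The evaluation map into the double dual. -/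
def eval (σ : AlgInvolution R A) (P : Type*) [AddCommGroup P] [Module Aᵐᵒᵖ P] :
    P →ₗ[Aᵐᵒᵖ] StarDual σ (StarDual σ P) where
  toFun x := show StarDual σ P →ₗ[Aᵐᵒᵖ] A from
    { toFun := fun φ => σ (φ x)
      map_add' := fun φ ψ => by rw [add_apply, σ.map_add]
      map_smul' := fun a φ => by
        rw [smul_apply', σ.map_mul, σ.apply_apply]
        rfl }
  map_add' x y := ext fun φ => by
    change σ (φ (x + y)) = σ (φ x) + σ (φ y)
    rw [apply_add, σ.map_add]
  map_smul' a x := ext fun φ => by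
    change σ (φ (op a.unop • x)) = σ a.unop * σ (φ x)
    rw [apply_smul, σ.map_mul]

theorem eval_apply (x : P) (φ : StarDual σ P) : eval σ P x φ = σ (φ x) := rfl

/-- A dual basis, with functionals in the dual module. -/
theorem exists_dual_basis (σ : AlgInvolution R A) (P : Type*) [AddCommGroup P] [Module Aᵐᵒᵖ P]
    [Module.Finite Aᵐᵒᵖ P] [Module.Projective Aᵐᵒᵖ P] :
    ∃ (n : ℕ) (v : Fin n → P) (φ : Fin n → StarDual σ P),
      (∀ x, ∑ i, op (φ i x) • v i = x) ∧ ∀ ψ : StarDual σ P, ∑ i, op (σ (ψ (v i))) • φ i = ψ := by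
  obtain ⟨n, v, φ, h⟩ : ∃ (n : ℕ) (v : Fin n → P) (φ : Fin n → StarDual σ P),
      ∀ x, ∑ i, op (φ i x) • v i = x := AzumayaWitt.exists_dual_basis (A := A) P
  refine ⟨n, v, φ, h, fun ψ => ext fun x => ?_⟩
  conv_rhs => rw [← h x]
  rw [sum_apply, apply_sum]
  refine Finset.sum_congr rfl fun i _ => ?_
  rw [smul_apply, σ.apply_apply, apply_smul]

theorem eval_bijective (σ : AlgInvolution R A) (P : Type*) [AddCommGroup P] [Module Aᵐᵒᵖ P]
    [Module.Finite Aᵐᵒᵖ P] [Module.Projective Aᵐᵒᵖ P] : Function.Bijective (eval σ P) := by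
  obtain ⟨n, v, φ, h, h'⟩ := exists_dual_basis σ P
  constructor
  · rw [injective_iff_map_eq_zero]
    intro x hx
    rw [← h x]
    refine Finset.sum_eq_zero fun i _ => ?_
    have h1 : σ (φ i x) = 0 := DFunLike.congr_fun hx (φ i)
    rw [← σ.apply_apply (φ i x), h1, σ.map_zero, op_zero, zero_smul]
  · intro Ψ
    refine ⟨∑ i, op (σ (Ψ (φ i))) • v i, ext fun ψ => ?_⟩
    conv_rhs => rw [← h' ψ]
    rw [eval_apply, apply_sum, apply_sum]
    refine (_root_.map_sum σ.toLinearMap _ _).trans (Finset.sum_congr rfl fun i _ => ?_)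
    change σ (ψ _) = _
    rw [apply_smul, apply_smul, σ.map_mul, σ.apply_apply]

/-- A finitely generated projective module is its own double dual. -/
noncomputable def evalEquiv (σ : AlgInvolution R A) (P : Type*) [AddCommGroup P] [Module Aᵐᵒᵖ P]
    [Module.Finite Aᵐᵒᵖ P] [Module.Projective Aᵐᵒᵖ P] :
    P ≃ₗ[Aᵐᵒᵖ] StarDual σ (StarDual σ P) :=
  LinearEquiv.ofBijective _ (eval_bijective σ P)

theorem exists_retract (σ : AlgInvolution R A) (P : Type*) [AddCommGroup P] [Module Aᵐᵒᵖ P]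
    [Module.Finite Aᵐᵒᵖ P] [Module.Projective Aᵐᵒᵖ P] :
    ∃ (n : ℕ) (i : StarDual σ P →ₗ[Aᵐᵒᵖ] Fin n → A) (s : (Fin n → A) →ₗ[Aᵐᵒᵖ] StarDual σ P),
      s ∘ₗ i = LinearMap.id := by
  obtain ⟨n, v, φ, -, h⟩ := exists_dual_basis σ P
  refine ⟨n, LinearMap.pi fun i => eval σ P (v i),
    ∑ i, (show A →ₗ[Aᵐᵒᵖ] StarDual σ P from
      { toFun := fun a => op a • φ i
        map_add' := fun a b => by rw [op_add, add_smul]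
        map_smul' := fun a b => by
          rw [RingHom.id_apply, ← mul_smul]
          rfl }) ∘ₗ LinearMap.proj i, LinearMap.ext fun ψ => ?_⟩
  rw [LinearMap.comp_apply, LinearMap.sum_apply]
  exact h ψ

instance [Module.Finite Aᵐᵒᵖ P] [Module.Projective Aᵐᵒᵖ P] :
    Module.Projective Aᵐᵒᵖ (StarDual σ P) := by
  obtain ⟨n, i, s, h⟩ := exists_retract σ P
  exact Module.Projective.of_split i s h

instance [Module.Finite Aᵐᵒᵖ P] [Module.Projective Aᵐᵒᵖ P] :
    Module.Finite Aᵐᵒᵖ (StarDual σ P) := by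
  obtain ⟨n, i, s, h⟩ := exists_retract σ P
  exact Module.Finite.of_surjective s fun φ => ⟨i φ, LinearMap.congr_fun h φ⟩

end StarDual

namespace HermForm

theorem hypForm_isometric_congr (hε : ε ∈ Set.center A) (hεσ : σ ε * ε = 1)
    (g : V ≃ₗ[Aᵐᵒᵖ] W) : (hypForm σ ε hε hεσ V).Isometric (hypForm σ ε hε hεσ W) := by
  refine ⟨g.prodCongr (StarDual.congr σ g), fun x y => ?_⟩
  change x.2 (g.symm (g y.1)) + ε * σ (y.2 (g.symm (g x.1))) = x.2 y.1 + ε * σ (y.2 x.1)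
  rw [g.symm_apply_apply, g.symm_apply_apply]

theorem hypForm_isometric_prod (hε : ε ∈ Set.center A) (hεσ : σ ε * ε = 1) :
    ((hypForm σ ε hε hεσ V).prod (hypForm σ ε hε hεσ W)).Isometric
      (hypForm σ ε hε hεσ (V × W)) := by
  refine ⟨(LinearEquiv.prodProdProdComm Aᵐᵒᵖ V (StarDual σ V) W (StarDual σ W)).trans
    ((LinearEquiv.refl _ _).prodCongr (StarDual.prodEquiv σ V W).symm), fun x y => ?_⟩
  change (x.1.2 y.1.1 + x.2.2 y.2.1) + ε * σ (y.1.2 x.1.1 + y.2.2 x.2.1) =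
    (x.1.2 y.1.1 + ε * σ (y.1.2 x.1.1)) + (x.2.2 y.2.1 + ε * σ (y.2.2 x.2.1))
  rw [σ.map_add, mul_add]
  abel

/-- Exchange the two summands and use the double dual. The twist by `σ ε` compensates for the `ε` in
only one of the two terms of the form. -/
theorem hypForm_isometric_starDual (hε : ε ∈ Set.center A) (hεσ : σ ε * ε = 1)
    [Module.Finite Aᵐᵒᵖ V] [Module.Projective Aᵐᵒᵖ V] :
    (hypForm σ ε hε hεσ V).Isometric (hypForm σ ε hε hεσ (StarDual σ V)) := by
  have hc : ∀ c, ε * c = c * ε := (Set.mem_center_iff.1 hε).comm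
  have h1 : ε * σ ε = 1 := by rw [hc, hεσ]
  let m : V ≃ₗ[Aᵐᵒᵖ] V := LinearEquiv.ofLinearMap (centerMul V (σ.mem_center hε)) (centerMul V hε)
    (LinearMap.ext fun x => by
      change op (σ ε) • op ε • x = x
      rw [← mul_smul, ← op_mul, h1, op_one, one_smul])
    (LinearMap.ext fun x => by
      change op ε • op (σ ε) • x = x
      rw [← mul_smul, ← op_mul, hεσ, op_one, one_smul])
  refine ⟨(LinearEquiv.prodComm Aᵐᵒᵖ V (StarDual σ V)).trans
    ((LinearEquiv.refl _ _).prodCongr (m.trans (StarDual.evalEquiv σ V))), fun x y => ?_⟩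
  change σ (y.2 (op (σ ε) • x.1)) + ε * σ (σ (x.2 (op (σ ε) • y.1))) = x.2 y.1 + ε * σ (y.2 x.1)
  rw [StarDual.apply_smul, StarDual.apply_smul, σ.apply_apply, σ.map_mul, σ.apply_apply,
    hc (_ * _), mul_assoc, hεσ, mul_one, add_comm]

theorem hypForm_unimodular (hε : ε ∈ Set.center A) (hεσ : σ ε * ε = 1) [Module.Finite Aᵐᵒᵖ V]
    [Module.Projective Aᵐᵒᵖ V] : (hypForm σ ε hε hεσ V).Unimodular := by
  have hc : ∀ c, ε * c = c * ε := (Set.mem_center_iff.1 hε).comm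
  have h1 : ε * σ ε = 1 := by rw [hc, hεσ]
  constructor
  · intro z w h
    have h' : ∀ y : V × StarDual σ V, z.2 y.1 + ε * σ (y.2 z.1) = w.2 y.1 + ε * σ (y.2 w.1) :=
      fun y => LinearMap.congr_fun h y
    refine Prod.ext ((StarDual.eval_bijective σ V).1 (StarDual.ext fun φ => ?_))
      (StarDual.ext fun x => ?_)
    · have h2 := congrArg (σ ε * ·) (h' (0, φ))
      simp only [StarDual.apply_zero, zero_add, ← mul_assoc, hεσ, one_mul] at h2
      exact h2
    · simpa [StarDual.zero_apply, σ.map_zero] using h' (x, 0)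
  · intro Λ
    obtain ⟨x, hx⟩ := (StarDual.eval_bijective σ V).2
      (show StarDual σ V →ₗ[Aᵐᵒᵖ] A from Λ ∘ₗ LinearMap.inr Aᵐᵒᵖ V (StarDual σ V))
    refine ⟨(op ε • x, (show V →ₗ[Aᵐᵒᵖ] A from Λ ∘ₗ LinearMap.inl Aᵐᵒᵖ V (StarDual σ V))),
      LinearMap.ext fun y => ?_⟩
    have hx' : ∀ φ, σ (φ x) = Λ (0, φ) := fun φ => DFunLike.congr_fun hx φ
    change Λ (y.1, 0) + ε * σ (y.2 (op ε • x)) = Λ y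
    rw [StarDual.apply_smul, σ.map_mul, ← mul_assoc, h1, one_mul, hx', ← _root_.map_add,
      Prod.mk_add_mk, add_zero, zero_add]

theorem hypForm_hyperbolic (hε : ε ∈ Set.center A) (hεσ : σ ε * ε = 1) :
    (hypForm σ ε hε hεσ V).Hyperbolic := by
  refine ⟨LinearMap.range (LinearMap.inl Aᵐᵒᵖ V (StarDual σ V)),
    LinearMap.range (LinearMap.inr Aᵐᵒᵖ V (StarDual σ V)), LinearMap.isCompl_range_inl_inr, ?_, ?_⟩
  · rintro _ ⟨x, rfl⟩ _ ⟨y, rfl⟩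
    change (0 : StarDual σ V) y + ε * σ ((0 : StarDual σ V) x) = 0
    rw [StarDual.zero_apply, StarDual.zero_apply, σ.map_zero, mul_zero, add_zero]
  · rintro _ ⟨x, rfl⟩ _ ⟨y, rfl⟩
    change x 0 + ε * σ (y 0) = 0
    rw [StarDual.apply_zero, StarDual.apply_zero, σ.map_zero, mul_zero, add_zero]

theorem Hyperbolic.of_isometric {f : HermForm σ ε P} {g : HermForm σ ε Q} (hf : f.Hyperbolic)
    (h : f.Isometric g) : g.Hyperbolic := by
  obtain ⟨L, M, hLM, hL, hM⟩ := hf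
  obtain ⟨φ, hφ⟩ := h
  refine ⟨L.map φ.toLinearMap, M.map φ.toLinearMap, ?_, ?_, ?_⟩
  · exact (Submodule.orderIsoMapComap φ).isCompl hLM
  · rintro _ ⟨x, hx, rfl⟩ _ ⟨y, hy, rfl⟩
    exact (hφ x y).trans (hL x hx y hy)
  · rintro _ ⟨x, hx, rfl⟩ _ ⟨y, hy, rfl⟩
    exact (hφ x y).trans (hM x hx y hy)

theorem Hyperbolic.prod {f : HermForm σ ε P} {g : HermForm σ ε Q} (hf : f.Hyperbolic)
    (hg : g.Hyperbolic) : (f.prod g).Hyperbolic := by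
  obtain ⟨L, M, hLM, hL, hM⟩ := hf
  obtain ⟨L', M', hLM', hL', hM'⟩ := hg
  refine ⟨L.prod L', M.prod M', ?_, ?_, ?_⟩
  · rw [isCompl_iff, disjoint_iff, codisjoint_iff, Submodule.prod_inf_prod, Submodule.prod_sup_prod,
      hLM.inf_eq_bot, hLM'.inf_eq_bot, hLM.sup_eq_top, hLM'.sup_eq_top]
    exact ⟨Submodule.prod_bot, Submodule.prod_top⟩
  · rintro x hx y hy
    change f.toFun x.1 y.1 + g.toFun x.2 y.2 = 0
    rw [hL _ hx.1 _ hy.1, hL' _ hx.2 _ hy.2, add_zero]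
  · rintro x hx y hy
    change f.toFun x.1 y.1 + g.toFun x.2 y.2 = 0
    rw [hM _ hx.1 _ hy.1, hM' _ hx.2 _ hy.2, add_zero]

/-- A hyperbolic unimodular form is a standard hyperbolic form. -/
theorem Hyperbolic.exists_isometric_hypForm {f : HermForm σ ε P} (hf : f.Hyperbolic)
    (hu : f.Unimodular) (hε : ε ∈ Set.center A) (hεσ : σ ε * ε = 1) :
    ∃ L M : Submodule Aᵐᵒᵖ P, IsCompl L M ∧ f.Isometric (hypForm σ ε hε hεσ L) := by
  obtain ⟨L, M, hLM, hL, hM⟩ := hf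
  refine ⟨L, M, hLM, ?_⟩
  -- The form pairs `M` with `L`. As each is isotropic and the form on their sum is unimodular, this
  -- identifies `M` with the dual of `L`.
  let g : M →ₗ[Aᵐᵒᵖ] StarDual σ L :=
    { toFun := fun m => show L →ₗ[Aᵐᵒᵖ] A from f.toHom m ∘ₗ L.subtype
      map_add' := fun m m' => StarDual.ext fun x => f.add_left m m' x
      map_smul' := fun a m => StarDual.ext fun x => f.smul_left m x a.unop }
  have hg : ∀ m x, g m x = f.toFun m x := fun _ _ => rfl
  have hgb : Function.Bijective g := by
    constructor
    · rw [injective_iff_map_eq_zero]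
      intro m hm
      refine Subtype.ext (hu.1 (LinearMap.ext fun y => ?_))
      obtain ⟨l, m', rfl, -⟩ := Submodule.existsUnique_add_of_isCompl hLM y
      change f.toFun m (l + m') = f.toFun 0 _
      rw [f.add_right, hM _ m.2 _ m'.2, ← hg, hm, f.zero_left, add_zero]
      rfl
    · intro φ
      obtain ⟨p, hp⟩ := hu.2 ((show L →ₗ[Aᵐᵒᵖ] A from φ) ∘ₗ L.projectionOnto M hLM)
      obtain ⟨l, m, rfl, -⟩ := Submodule.existsUnique_add_of_isCompl hLM p
      refine ⟨m, StarDual.ext fun x => ?_⟩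
      have h1 : f.toFun (l + m) x = φ (L.projectionOnto M hLM x) := LinearMap.congr_fun hp x
      rw [Submodule.projectionOnto_apply_left, f.add_left, hL _ l.2 _ x.2, zero_add] at h1
      exact h1
  refine Isometric.symm ?_
  refine ⟨((LinearEquiv.refl _ _).prodCongr (LinearEquiv.ofBijective g hgb).symm).trans
    (Submodule.prodEquivOfIsCompl L M hLM), fun x y => ?_⟩
  obtain ⟨l, φ⟩ := x
  obtain ⟨l', φ'⟩ := y
  obtain ⟨m, rfl⟩ := hgb.2 φ
  obtain ⟨m', rfl⟩ := hgb.2 φ'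
  change f.toFun (l + ((LinearEquiv.ofBijective g hgb).symm (g m) : P))
    (l' + ((LinearEquiv.ofBijective g hgb).symm (g m') : P)) = g m l' + ε * σ (g m' l)
  rw [show ∀ m, (LinearEquiv.ofBijective g hgb).symm (g m) = m from
    (LinearEquiv.ofBijective g hgb).symm_apply_apply, show ∀ m,
    (LinearEquiv.ofBijective g hgb).symm (g m) = m from
    (LinearEquiv.ofBijective g hgb).symm_apply_apply, hg, hg, ← f.symm, f.add_left, f.add_right,
    f.add_right, hL _ l.2 _ l'.2, hM _ m.2 _ m'.2]
  abel

/-- The form `-f`. -/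
def neg (f : HermForm σ ε P) : HermForm σ ε P where
  toFun x y := -f.toFun x y
  add_left x x' y := by rw [f.add_left, neg_add]
  add_right x y y' := by rw [f.add_right, neg_add]
  smul_smul x y a b := by rw [f.smul_smul, mul_neg, neg_mul]
  symm x y := by rw [σ.map_neg, mul_neg, ← f.symm]

theorem Unimodular.neg {f : HermForm σ ε P} (hf : f.Unimodular) : f.neg.Unimodular := by
  have h : f.neg.toHom = fun x => -f.toHom x := rfl
  rw [Unimodular, h]
  exact (Equiv.neg _).bijective.comp hf

/-- The diagonal and the antidiagonal are isotropic, and they are complementary because `2` is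
invertible. -/
theorem prod_neg_hyperbolic (f : HermForm σ ε P) {κ : R} (hκ : κ + κ = 1) :
    (f.prod f.neg).Hyperbolic := by
  have hP : ∀ x : P, op (algebraMap R A κ) • x + op (algebraMap R A κ) • x = x := fun x => by
    rw [← add_smul, ← op_add, ← _root_.map_add, hκ, _root_.map_one, op_one, one_smul]
  let i : P →ₗ[Aᵐᵒᵖ] P × P := LinearMap.id.prod LinearMap.id
  let j : P →ₗ[Aᵐᵒᵖ] P × P := LinearMap.id.prod (-LinearMap.id)
  refine ⟨LinearMap.range i, LinearMap.range j, ?_, ?_, ?_⟩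
  · rw [isCompl_iff, Submodule.disjoint_def, codisjoint_iff, eq_top_iff]
    constructor
    · rintro _ ⟨x, rfl⟩ ⟨y, hy⟩
      have h1 : y = x := congrArg Prod.fst hy
      have h2 : -y = x := congrArg Prod.snd hy
      have h3 : x + x = 0 := by
        nth_rw 1 [← h1]
        rw [← h2, add_neg_cancel]
      have h4 : x = 0 := by rw [← hP x, ← smul_add, h3, smul_zero]
      rw [h4, _root_.map_zero]
    · rintro ⟨x, y⟩ -
      refine Submodule.mem_sup.2 ⟨_, ⟨op (algebraMap R A κ) • (x + y), rfl⟩, _,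
        ⟨op (algebraMap R A κ) • (x - y), rfl⟩, Prod.ext ?_ ?_⟩
      · change op (algebraMap R A κ) • (x + y) + op (algebraMap R A κ) • (x - y) = x
        conv_rhs => rw [← hP x]
        rw [smul_add, smul_sub]
        abel
      · change op (algebraMap R A κ) • (x + y) + -(op (algebraMap R A κ) • (x - y)) = y
        conv_rhs => rw [← hP y]
        rw [smul_add, smul_sub]
        abel
  · rintro _ ⟨x, rfl⟩ _ ⟨y, rfl⟩
    exact add_neg_cancel _
  · rintro _ ⟨x, rfl⟩ _ ⟨y, rfl⟩
    change f.toFun x y + -f.toFun (-x) (-y) = 0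
    rw [f.neg_left, f.neg_right, neg_neg, add_neg_cancel]

theorem isometric_prod_of_subsingleton (f : HermForm σ ε P) (g : HermForm σ ε Q) [Subsingleton Q] :
    (f.prod g).Isometric f := by
  have : Unique Q := ⟨⟨0⟩, fun _ => Subsingleton.elim _ _⟩
  refine ⟨LinearEquiv.prodUnique, fun x y => ?_⟩
  change f.toFun x.1 y.1 = f.toFun x.1 y.1 + g.toFun x.2 y.2
  rw [Subsingleton.elim x.2 0, g.zero_left, add_zero]

/-- Cancellation of the hyperbolic space of a free module. -/
theorem isometric_of_prod_hypForm_free [Finite (MaximalSpectrum R)]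
    (hA : IsAzumayaWithInvolution σ) (e : SeparabilityElement R A) [Module.Finite R A] {κ : R}
    (hκ : κ + κ = 1) (hε : ε ∈ Set.center A) (hεσ : σ ε * ε = 1) [Module.Finite Aᵐᵒᵖ P]
    [Module.Projective Aᵐᵒᵖ P] {f : HermForm σ ε P} (hf : f.Unimodular) {f' : HermForm σ ε Q}
    (n : ℕ) (h : (f'.prod (hypForm σ ε hε hεσ (Fin n → A))).Isometric
      (f.prod (hypForm σ ε hε hεσ (Fin n → A)))) : f'.Isometric f := by
  induction n with
  | zero =>
    have : Subsingleton (StarDual σ (Fin 0 → A)) := ⟨fun φ ψ => StarDual.ext fun x => by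
      rw [Subsingleton.elim x 0, StarDual.apply_zero, StarDual.apply_zero]⟩
    exact ((isometric_prod_of_subsingleton _ _).symm.trans h).trans
      (isometric_prod_of_subsingleton _ _)
  | succ n ih =>
    have key : (hypForm σ ε hε hεσ (Fin (n + 1) → A)).Isometric
        ((hypForm σ ε hε hεσ (Fin n → A)).prod (hypPlane σ ε hε hεσ)) :=
      ((hypForm_isometric_congr hε hεσ (Fin.consLinearEquiv Aᵐᵒᵖ fun _ => A).symm).trans
        (hypForm_isometric_prod hε hεσ).symm).trans ((isometric_prod_comm _ _).trans
        ((Isometric.refl _).prod (hypPlane_isometric hε hεσ).symm))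
    refine ih (isometric_of_prod_hypPlane hA e hκ hε hεσ
      (hf.prod (hypForm_unimodular hε hεσ)) ?_)
    exact (((isometric_prod_assoc _ _ _).trans ((Isometric.refl _).prod key.symm)).trans h).trans
      (((Isometric.refl _).prod key).trans (isometric_prod_assoc _ _ _).symm)

end HermForm

end Duals

/-! ### Fibre dimensions -/

section Fiber

variable {Z : Type*} [CommRing Z] {M N : Type*} [AddCommGroup M] [Module Z M] [AddCommGroup N]
  [Module Z N] (p : PrimeSpectrum Z)

theorem finrank_fiber_congr (g : M ≃ₗ[Z] N) :
    Module.finrank p.asIdeal.ResidueField (p.asIdeal.ResidueField ⊗[Z] M) =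
      Module.finrank p.asIdeal.ResidueField (p.asIdeal.ResidueField ⊗[Z] N) :=
  (g.baseChange Z p.asIdeal.ResidueField M N).finrank_eq

theorem finrank_fiber_prod [Module.Finite Z M] [Module.Finite Z N] :
    Module.finrank p.asIdeal.ResidueField (p.asIdeal.ResidueField ⊗[Z] (M × N)) =
      Module.finrank p.asIdeal.ResidueField (p.asIdeal.ResidueField ⊗[Z] M) +
        Module.finrank p.asIdeal.ResidueField (p.asIdeal.ResidueField ⊗[Z] N) := by
  rw [(TensorProduct.prodRight Z p.asIdeal.ResidueField p.asIdeal.ResidueField M N).finrank_eq,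
    Module.finrank_prod]

/-- Elements of `pM` die in the fibre at `p`, so right exactness identifies the two fibres. -/
theorem finrank_fiber_quotient (L : Submodule Z M) (hL : L ≤ p.asIdeal • ⊤) :
    Module.finrank p.asIdeal.ResidueField (p.asIdeal.ResidueField ⊗[Z] (M ⧸ L)) =
      Module.finrank p.asIdeal.ResidueField (p.asIdeal.ResidueField ⊗[Z] M) := by
  have hzero : LinearMap.lTensor p.asIdeal.ResidueField L.subtype = 0 := by
    refine TensorProduct.ext' fun c x => ?_
    rw [LinearMap.lTensor_tmul, LinearMap.zero_apply, Submodule.subtype_apply]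
    refine Submodule.smul_induction_on (p := fun x => c ⊗ₜ[Z] x = 0) (hL x.2) ?_ ?_
    · intro r hr y _
      rw [← TensorProduct.smul_tmul, Algebra.smul_def,
        Ideal.algebraMap_residueField_eq_zero.2 hr, zero_mul, TensorProduct.zero_tmul]
    · intro y y' h h'
      rw [TensorProduct.tmul_add, h, h', add_zero]
  refine (LinearEquiv.finrank_eq (LinearEquiv.ofBijective
    (L.mkQ.baseChange p.asIdeal.ResidueField) ⟨?_, ?_⟩)).symm
  · rw [injective_iff_map_eq_zero]
    intro t ht
    obtain ⟨s, rfl⟩ := (lTensor_exact p.asIdeal.ResidueField (f := L.subtype) (g := L.mkQ)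
      (LinearMap.exact_subtype_mkQ L) L.mkQ_surjective t).1 ht
    rw [hzero, LinearMap.zero_apply]
  · exact LinearMap.lTensor_surjective p.asIdeal.ResidueField L.mkQ_surjective

theorem finrank_fiber_eq_zero_iff [Module.Finite Z M] :
    Module.finrank p.asIdeal.ResidueField (p.asIdeal.ResidueField ⊗[Z] M) = 0 ↔
      p ∉ Module.support Z M := by
  rw [Module.mem_support_iff_nontrivial_residueField_tensorProduct, not_nontrivial_iff_subsingleton,
    Module.finrank_zero_iff]

theorem finrank_fiber_eq_zero_of_smul_eq [Module.Finite Z M] {z : Z} (hz : z ∈ p.asIdeal)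
    (h : ∀ x : M, z • x = x) :
    Module.finrank p.asIdeal.ResidueField (p.asIdeal.ResidueField ⊗[Z] M) = 0 := by
  rw [finrank_fiber_eq_zero_iff, Module.mem_support_iff_of_finite]
  intro hp
  refine p.2.ne_top ((Ideal.eq_top_iff_one _).2 ?_)
  rw [← sub_add_cancel 1 z]
  refine add_mem (hp (Module.mem_annihilator.2 fun x => ?_)) hz
  rw [sub_smul, one_smul, h, sub_self]

theorem finrank_fiber_eq_zero_of_smul_eq_zero [Module.Finite Z M] {z : Z} (hz : z ∉ p.asIdeal)
    (h : ∀ x : M, z • x = 0) :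
    Module.finrank p.asIdeal.ResidueField (p.asIdeal.ResidueField ⊗[Z] M) = 0 := by
  rw [finrank_fiber_eq_zero_iff, Module.mem_support_iff_of_finite]
  exact fun hp => hz (hp (Module.mem_annihilator.2 h))

theorem subsingleton_of_finrank_fiber_eq_zero [Module.Finite Z M]
    (h : ∀ p : PrimeSpectrum Z, p.asIdeal.IsMaximal →
      Module.finrank p.asIdeal.ResidueField (p.asIdeal.ResidueField ⊗[Z] M) = 0) :
    Subsingleton M := by
  rw [← Module.support_eq_empty_iff (R := Z), Set.eq_empty_iff_forall_notMem]
  intro p hp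
  obtain ⟨m, hm, hpm⟩ := Ideal.exists_le_maximal p.asIdeal p.2.ne_top
  exact (finrank_fiber_eq_zero_iff ⟨m, hm.isPrime⟩).1 (h ⟨m, hm.isPrime⟩ hm)
    (Module.mem_support_mono (show p ≤ ⟨m, hm.isPrime⟩ from hpm) hp)

/-- For finitely generated projective modules, comparing fibre dimensions defines a decomposition
of the spectrum. -/
theorem exists_idempotent_finrank_fiber_lt [Module.Finite Z M] [Module.Projective Z M]
    [Module.Finite Z N] [Module.Projective Z N] :
    ∃ e : Z, e * e = e ∧ ∀ p : PrimeSpectrum Z, e ∉ p.asIdeal ↔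
      Module.finrank p.asIdeal.ResidueField (p.asIdeal.ResidueField ⊗[Z] N) <
      Module.finrank p.asIdeal.ResidueField (p.asIdeal.ResidueField ⊗[Z] M) := by
  have : Module.FinitePresentation Z M := Module.finitePresentation_of_projective Z M
  have : Module.FinitePresentation Z N := Module.finitePresentation_of_projective Z N
  have h1 := (Module.isLocallyConstant_rankAtStalk (R := Z) (M := M)).prodMk
    (Module.isLocallyConstant_rankAtStalk (R := Z) (M := N))
  have h2 : IsClopen {p : PrimeSpectrum Z | Module.rankAtStalk N p < Module.rankAtStalk M p} :=
    ⟨isOpen_compl_iff.1 (h1 {x | x.2 < x.1}ᶜ), h1 {x | x.2 < x.1}⟩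
  obtain ⟨e, he, h3⟩ := PrimeSpectrum.isClopen_iff.1 h2
  refine ⟨e, he, fun p => ?_⟩
  rw [← Module.rankAtStalk_eq, ← Module.rankAtStalk_eq]
  exact (Set.ext_iff.1 h3 p).symm

end Fiber

/-! ### Projectivity over the centre -/

section CenterProjective

/-- Here `S` plays the role of the antisymmetric elements of a quadratic extension, and `κ(1 ⊗ 1 + ∑
sᵢ ⊗ tᵢ)` that of a separability element, used to make an `R`-linear section `Z`-linear. The centre
need not be quadratic everywhere: `k` is a correction for the part where `S` vanishes. -/
theorem projective_of_antisymmetric {R Z M : Type*} [CommRing R] [CommRing Z] [Algebra R Z]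
    [AddCommGroup M] [Module Z M] [Module R M] [IsScalarTower R Z M] [Module.Projective R M]
    {κ k : R} (hκ : κ + κ = 1) {S : Set Z}
    (hZ : ∀ z : Z, ∃ r : R, ∃ s ∈ S, z = algebraMap R Z r + s)
    (hS : ∀ s ∈ S, ∀ t ∈ S, ∃ r : R, s * t = algebraMap R Z r) (hk : ∀ s ∈ S, k • s = 0)
    {n : ℕ} (s t : Fin n → Z) (hs : ∀ i, s i ∈ S) (ht : ∀ i, t i ∈ S)
    (h1 : ∑ i, s i * t i + algebraMap R Z k = 1) : Module.Projective Z M := by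
  let q := Finsupp.linearCombination Z (id : M → M)
  have hq : Function.Surjective q := fun m => ⟨Finsupp.single m 1, by simp [q]⟩
  obtain ⟨g, hg⟩ := Module.projective_lifting_property (q.restrictScalars R)
    (LinearMap.id : M →ₗ[R] M) hq
  have hg' : ∀ m, q (g m) = m := fun m => LinearMap.congr_fun hg m
  have hgr : ∀ (r : R) m, g (algebraMap R Z r • m) = algebraMap R Z r • g m := fun r m => by
    rw [algebraMap_smul, map_smul, algebraMap_smul]
  -- The weight `1 + k` makes the coefficients add up: `∑ sᵢ tᵢ = 1 - k`, so `q ∘ G` is `κ((1 + k) +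
  -- (1 - k)) = 1`. Multiplication by an element of `S` exchanges the two terms, since `k` kills `S`
  -- and `S * S` lies in `R`.
  let G : M →ₗ[R] (M →₀ Z) := κ • ((1 + k) • g +
    ∑ i, ((LinearMap.lsmul Z (M →₀ Z) (s i)).restrictScalars R) ∘ₗ
      g ∘ₗ ((LinearMap.lsmul Z M (t i)).restrictScalars R))
  have hG : ∀ m, G m = κ • ((1 + k) • g m + ∑ i, s i • g (t i • m)) := fun m => by
    simp [G]
  have hkS : ∀ s ∈ S, ∀ m : M, k • s • m = 0 := fun s hs m => by
    rw [← smul_assoc, hk s hs, zero_smul]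
  have hkS' : ∀ s ∈ S, ∀ m : M →₀ Z, k • s • m = 0 := fun s hs m => by
    rw [← smul_assoc, hk s hs, zero_smul]
  have hk1 : ∑ i, s i * t i = 1 - algebraMap R Z k := eq_sub_of_add_eq h1
  have hGS : ∀ u ∈ S, ∀ m, G (u • m) = u • G m := by
    intro u hu m
    have h2 : ∑ i, s i • g (t i • u • m) = u • g m := by
      have h3 : ∀ i, s i • g (t i • u • m) = (s i * t i) • u • g m := fun i => by
        obtain ⟨r, hr⟩ := hS _ (ht i) _ hu
        rw [smul_smul, hr, hgr, ← hr, smul_smul, smul_smul, mul_assoc]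
      rw [Finset.sum_congr rfl fun i _ => h3 i, ← Finset.sum_smul, hk1, sub_smul, one_smul,
        algebraMap_smul, hkS' u hu, sub_zero]
    have h4 : ∑ i, u • s i • g (t i • m) = g (u • m) := by
      have h3 : ∀ i, u • s i • g (t i • m) = g ((s i * t i) • u • m) := fun i => by
        obtain ⟨r, hr⟩ := hS _ hu _ (hs i)
        rw [smul_smul, hr, ← hgr, ← hr, smul_smul, smul_smul]
        congr 2
        ring
      rw [Finset.sum_congr rfl fun i _ => h3 i, ← map_sum, ← Finset.sum_smul, hk1, sub_smul,
        one_smul, algebraMap_smul, hkS u hu, sub_zero]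
    rw [hG, hG, h2, smul_comm u κ, smul_add u, Finset.smul_sum, h4, add_smul, add_smul, one_smul,
      one_smul, ← map_smul, hkS u hu, map_zero, add_zero, smul_add u, smul_comm u k, hkS' u hu,
      add_zero, add_comm]
  have hGZ : ∀ (z : Z) m, G (z • m) = z • G m := by
    intro z m
    obtain ⟨r, u, hu, rfl⟩ := hZ z
    rw [add_smul, add_smul, map_add, hGS u hu, algebraMap_smul, algebraMap_smul, map_smul]
  refine Module.projective_def'.2 ⟨{ G with map_smul' := hGZ }, LinearMap.ext fun m => ?_⟩
  change q (G m) = m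
  rw [hG, ← algebraMap_smul Z κ, map_smul, map_add, ← algebraMap_smul Z (1 + k), map_smul, hg',
    map_sum]
  simp only [map_smul, hg']
  simp only [smul_smul]
  rw [← Finset.sum_smul, hk1, ← add_smul, smul_smul, map_add, map_one]
  have h5 : algebraMap R Z κ + algebraMap R Z κ = 1 := by rw [← map_add, hκ, map_one]
  rw [show algebraMap R Z κ * (1 + algebraMap R Z k + (1 - algebraMap R Z k)) =
    algebraMap R Z κ + algebraMap R Z κ by ring, h5, one_smul]

variable {R : Type u} {A : Type v} [CommRing R] [Ring A] [Algebra R A] {σ : AlgInvolution R A}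

/-- The elements of the base that are sums of products of antisymmetric central elements, together
with those annihilating all such elements, generate the unit ideal. -/
theorem exists_antisymmetric_sum_mul [Finite (MaximalSpectrum R)]
    (hA : IsAzumayaWithInvolution σ) (e : SeparabilityElement R A)
    [Module.Finite R A] {κ : R} (hκ : κ + κ = 1) :
    ∃ (n : ℕ) (s t : Fin n → A) (k : R), (∀ i, s i ∈ Set.center A ∧ σ (s i) = -s i) ∧
      (∀ i, t i ∈ Set.center A ∧ σ (t i) = -t i) ∧
      (∀ s ∈ Set.center A, σ s = -s → k • s = 0) ∧ ∑ i, s i * t i + algebraMap R A k = 1 := by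
  let ρ : A →ₗ[R] A := κ • (e.centerProj - σ.toLinearMap ∘ₗ e.centerProj)
  have hρ : ∀ a, ρ a = κ • (e.centerProj a - σ (e.centerProj a)) := fun _ => rfl
  have hρ1 : ∀ a, ρ a ∈ Set.center A ∧ σ (ρ a) = -ρ a := by
    intro a
    have h1 := e.centerProj_mem a
    refine ⟨?_, ?_⟩
    · rw [hρ, Algebra.smul_def, sub_eq_add_neg]
      exact Set.mul_mem_center (Set.algebraMap_mem_center κ)
        (Set.add_mem_center h1 (Set.neg_mem_center (σ.mem_center h1)))
    · rw [hρ, σ.map_smul, σ.map_sub, σ.apply_apply, ← smul_neg, neg_sub]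
  have hρ2 : ∀ s ∈ Set.center A, σ s = -s → ρ s = s := by
    intro s hs hσ
    rw [hρ, e.centerProj_of_mem hs, hσ, sub_neg_eq_add, ← two_smul R, smul_smul, mul_two, hκ,
      one_smul]
  let N := LinearMap.range ρ
  let K : Ideal R := N.annihilator
  let T : Ideal R := Ideal.span {r | ∃ a b, ρ a * ρ b = algebraMap R A r}
  have hTK : T ⊔ K = ⊤ := by
    by_contra hne
    obtain ⟨m, hm, hle⟩ := Ideal.exists_le_maximal _ hne
    have hJm : (⊥ : Ideal R).jacobson ≤ m := sInf_le ⟨bot_le, hm⟩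
    let D : Submodule R A := m • ⊤
    have hD : ∀ (g : A →ₗ[R] A) {a}, a ∈ D → g a ∈ D := fun g a ha => by
      have h1 : D.map g ≤ D := by
        rw [Submodule.map_smul'']
        exact Submodule.smul_mono le_rfl le_top
      exact h1 ⟨a, ha, rfl⟩
    have hcomm : ∀ s ∈ N, ∀ b, s * b = b * s := by
      rintro _ ⟨a, rfl⟩ b
      exact (Set.mem_center_iff.1 (hρ1 a).1).comm b
    -- Elements of `N` multiply each other into `T A`, hence lie in `I`. A central generator `z` of
    -- `I` satisfies `zs ∈ mA` and `zs ≡ s` modulo `JA`, so `N` lies in `mA`. Applying the projector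
    -- `ρ` improves this to `N = mN`, and Nakayama finishes.
    let I : Ideal A :=
      { carrier := {a | ∀ s ∈ N, s * a ∈ D}
        add_mem' := fun ha hb s hs => by
          rw [mul_add]
          exact D.add_mem (ha s hs) (hb s hs)
        zero_mem' := fun s _ => by
          rw [mul_zero]
          exact D.zero_mem
        smul_mem' := fun c a ha s hs => by
          rw [smul_eq_mul, ← mul_assoc, hcomm s hs, mul_assoc]
          exact hD (LinearMap.mulLeft R c) (ha s hs) }
    have : I.IsTwoSided := ⟨fun {a} b ha s hs => by
      rw [← mul_assoc]
      exact hD (LinearMap.mulRight R b) (ha s hs)⟩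
    obtain ⟨z, hzc, hzI, hz⟩ := e.exists_center_generator I
    have hNm : N ≤ m • N := by
      intro s hs
      have hsI : s ∈ I := by
        intro s' hs'
        obtain ⟨a, rfl⟩ := hs
        obtain ⟨b, rfl⟩ := hs'
        have h1 : ρ b * ρ a ∈ Set.range (algebraMap R A) := by
          rw [hA.range_eq]
          refine ⟨Set.mul_mem_center (hρ1 b).1 (hρ1 a).1, ?_⟩
          rw [σ.map_mul, (hρ1 a).2, (hρ1 b).2, neg_mul_neg,
            (Set.mem_center_iff.1 (hρ1 a).1).comm]
        obtain ⟨r, hr⟩ := h1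
        rw [← hr, Algebra.algebraMap_eq_smul_one]
        exact Submodule.smul_mem_smul (hle ((le_sup_left : T ≤ _)
          (Ideal.subset_span ⟨b, a, hr.symm⟩))) trivial
      have h1 : s ∈ D := by
        have h2 : z * s ∈ D := by
          rw [← hcomm s hs]
          exact hzI s hs
        have h3 : z * s - s ∈ D :=
          Submodule.smul_mono hJm le_rfl (hz s hsI)
        simpa using D.sub_mem h2 h3
      have h4 : ρ s ∈ D.map ρ := ⟨s, h1, rfl⟩
      obtain ⟨a, rfl⟩ := hs
      rw [hρ2 _ (hρ1 a).1 (hρ1 a).2, Submodule.map_smul'', Submodule.map_top] at h4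
      exact h4
    obtain ⟨r, hr, hr0⟩ := Submodule.exists_sub_one_mem_and_smul_eq_zero_of_fg_of_le_smul m N
      (by
        change (LinearMap.range ρ).FG
        rw [LinearMap.range_eq_map]
        exact Module.Finite.fg_top.map ρ) hNm
    have hrm : r ∈ m := hle ((le_sup_right : K ≤ _) (Submodule.mem_annihilator.2 hr0))
    exact hm.ne_top ((Ideal.eq_top_iff_one m).2 (by simpa using m.sub_mem hrm hr))
  have h1 : (1 : R) ∈ T ⊔ K := by rw [hTK]; trivial
  obtain ⟨a, ha, k, hk, hak⟩ := Submodule.mem_sup.1 h1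
  obtain ⟨n, c, g, hcg⟩ := Submodule.mem_span_set'.1 ha
  choose u w huw using fun i => (g i).2
  refine ⟨n, fun i => ρ (c i • u i), fun i => ρ (w i), k, fun i => hρ1 _, fun i => hρ1 _, ?_, ?_⟩
  · intro s hs hσ
    exact Submodule.mem_annihilator.1 hk s ⟨s, hρ2 s hs hσ⟩
  · rw [← map_one (algebraMap R A), ← hak, map_add, ← hcg, map_sum]
    congr 1
    refine Finset.sum_congr rfl fun i _ => ?_
    change ρ (c i • u i) * ρ (w i) = algebraMap R A (c i * g i)
    rw [ρ.map_smul, smul_mul_assoc, huw, map_mul, ← Algebra.smul_def]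

end CenterProjective

/-! ### Ranks of right modules over the centre -/

section CenterRank

variable {R : Type u} {A : Type v} [CommRing R] [Ring A] [Algebra R A]
  {P Q : Type*} [AddCommGroup P] [Module Aᵐᵒᵖ P] [AddCommGroup Q] [Module Aᵐᵒᵖ Q]

/-- A right module as a module over the centre. -/
abbrev centerModule (A : Type v) [Ring A] (P : Type*) [AddCommGroup P] [Module Aᵐᵒᵖ P] :
    Module (Subring.center A) P :=
  Module.compHom P (centerToOp A)

/-- A right module over an `R`-algebra as an `R`-module. -/
abbrev baseModule (R : Type u) (A : Type v) [CommRing R] [Ring A] [Algebra R A] (P : Type*)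
    [AddCommGroup P] [Module Aᵐᵒᵖ P] : Module R P :=
  Module.compHom P (algebraMap R Aᵐᵒᵖ)

/-- The base as a subring of the centre. -/
abbrev centerAlgebra (R : Type u) (A : Type v) [CommRing R] [Ring A] [Algebra R A] :
    Algebra R (Subring.center A) :=
  ((algebraMap R A).codRestrict (Subring.center A) fun r =>
    Set.algebraMap_mem_center r).toAlgebra

theorem finite_center (R : Type u) [CommRing R] [Algebra R A] [Module.Finite R A]
    (P : Type*) [AddCommGroup P] [Module Aᵐᵒᵖ P] [Module.Finite Aᵐᵒᵖ P] :
    letI := centerModule A P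
    Module.Finite (Subring.center A) P := by
  let _ := centerModule A P
  let _ := baseModule R A P
  let _ := centerAlgebra R A
  have : Module.Finite R Aᵐᵒᵖ := Module.Finite.equiv (opLinearEquiv R)
  have : IsScalarTower R Aᵐᵒᵖ P := ⟨fun r a x => by
    change (r • a) • x = algebraMap R Aᵐᵒᵖ r • a • x
    rw [Algebra.smul_def, mul_smul]⟩
  have : IsScalarTower R (Subring.center A) P := ⟨fun r z x => by
    change centerToOp A (r • z) • x = algebraMap R Aᵐᵒᵖ r • centerToOp A z • x
    rw [Algebra.smul_def, map_mul, mul_smul]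
    rfl⟩
  have : Module.Finite R P := Module.Finite.trans Aᵐᵒᵖ P
  exact Module.Finite.of_restrictScalars_finite R (Subring.center A) P

theorem centerRank_congr (g : P ≃ₗ[Aᵐᵒᵖ] Q) (p : PrimeSpectrum (Subring.center A)) :
    centerRank A P p = centerRank A Q p := by
  let _ := centerModule A P
  let _ := centerModule A Q
  exact finrank_fiber_congr p { g with map_smul' := fun z x => g.map_smul (centerToOp A z) x }

theorem centerRank_prod (R : Type u) [CommRing R] [Algebra R A] [Module.Finite R A]
    (P Q : Type*) [AddCommGroup P] [Module Aᵐᵒᵖ P] [AddCommGroup Q] [Module Aᵐᵒᵖ Q]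
    [Module.Finite Aᵐᵒᵖ P] [Module.Finite Aᵐᵒᵖ Q] (p : PrimeSpectrum (Subring.center A)) :
    centerRank A (P × Q) p = centerRank A P p + centerRank A Q p := by
  let _ := centerModule A P
  let _ := centerModule A Q
  have := finite_center (A := A) R P
  have := finite_center (A := A) R Q
  exact finrank_fiber_prod p

theorem centerRank_eq_zero_of_smul_eq (R : Type u) [CommRing R] [Algebra R A] [Module.Finite R A]
    [Module.Finite Aᵐᵒᵖ P] {p : PrimeSpectrum (Subring.center A)} {z : Subring.center A}
    (hz : z ∈ p.asIdeal) (h : ∀ x : P, op (z : A) • x = x) : centerRank A P p = 0 := by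
  let _ := centerModule A P
  have := finite_center (A := A) R P
  exact finrank_fiber_eq_zero_of_smul_eq p hz h

theorem centerRank_eq_zero_of_smul_eq_zero (R : Type u) [CommRing R] [Algebra R A]
    [Module.Finite R A] [Module.Finite Aᵐᵒᵖ P] {p : PrimeSpectrum (Subring.center A)}
    {z : Subring.center A} (hz : z ∉ p.asIdeal) (h : ∀ x : P, op (z : A) • x = 0) :
    centerRank A P p = 0 := by
  let _ := centerModule A P
  have := finite_center (A := A) R P
  exact finrank_fiber_eq_zero_of_smul_eq_zero p hz h

theorem subsingleton_of_centerRank_eq_zero (R : Type u) [CommRing R] [Algebra R A]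
    [Module.Finite R A] [Module.Finite Aᵐᵒᵖ P]
    (h : ∀ p : PrimeSpectrum (Subring.center A), p.asIdeal.IsMaximal → centerRank A P p = 0) :
    Subsingleton P := by
  let _ := centerModule A P
  have := finite_center (A := A) R P
  exact subsingleton_of_finrank_fiber_eq_zero h

/-- The centre acts faithfully on `A`, so the support of `A` is the whole spectrum. -/
theorem centerRank_self_pos (R : Type u) [CommRing R] [Algebra R A] [Module.Finite R A]
    (p : PrimeSpectrum (Subring.center A)) : 0 < centerRank A A p := by
  let _ := centerModule A A
  have := finite_center (A := A) R A
  refine Nat.pos_of_ne_zero fun h => (finrank_fiber_eq_zero_iff p).1 h ?_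
  rw [Module.mem_support_iff_of_finite]
  intro z hz
  have h1 : (1 : A) * z = 0 := Module.mem_annihilator.1 hz 1
  rw [one_mul] at h1
  rw [show z = 0 from Subtype.ext h1]
  exact zero_mem _

/-- Maximal ideals of the centre contain the Jacobson radical of the base. -/
theorem algebraMap_mem_of_isMaximal [Module.Finite R A] {p : PrimeSpectrum (Subring.center A)}
    (hp : p.asIdeal.IsMaximal) {r : R} (hr : r ∈ (⊥ : Ideal R).jacobson)
    (hmem : algebraMap R A r ∈ Subring.center A := Set.algebraMap_mem_center r) :
    (⟨algebraMap R A r, hmem⟩ : Subring.center A) ∈ p.asIdeal := by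
  by_contra hn
  obtain ⟨z, hz⟩ := hp.exists_inv hn
  obtain ⟨i, hi, h1⟩ := hz
  have hu : IsUnit (i : A) := by
    refine exists_mul_eq_one_of_sub_mem_jacIdeal (R := R) (b := 1) ?_
    have h2 : (z : A) * algebraMap R A r + i = 1 := congrArg Subtype.val h1
    rw [mul_one, ← h2, sub_add_cancel_right]
    exact neg_mem (Ideal.mul_mem_left _ _ (algebraMap_mem_jacIdeal hr))
  obtain ⟨b, hb1, hb2⟩ := isUnit_iff_exists.1 hu
  have hbc : b ∈ Subring.center A := by
    rw [Subring.mem_center_iff]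
    intro c
    have h3 := Subring.mem_center_iff.1 i.2 c
    calc c * b = b * i * c * b := by rw [hb2, one_mul]
      _ = b * (c * i) * b := by rw [h3]; simp only [mul_assoc]
      _ = b * c := by rw [mul_assoc, mul_assoc, hb1, mul_one]
  refine hp.ne_top ((Ideal.eq_top_iff_one _).2 ?_)
  rw [show (1 : Subring.center A) = ⟨b, hbc⟩ * i from Subtype.ext hb2.symm]
  exact Ideal.mul_mem_left _ _ hi

/-- The elements of a module divisible by the Jacobson radical of the base. -/
def jacSubmodule (R : Type u) [CommRing R] [Algebra R A] (P : Type*) [AddCommGroup P]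
    [Module Aᵐᵒᵖ P] : Submodule Aᵐᵒᵖ P :=
  Submodule.span Aᵐᵒᵖ {y | ∃ r ∈ (⊥ : Ideal R).jacobson, ∃ x : P, y = op (algebraMap R A r) • x}

theorem centerRank_quotient_jacSubmodule [Module.Finite R A]
    {p : PrimeSpectrum (Subring.center A)} (hp : p.asIdeal.IsMaximal) :
    centerRank A (P ⧸ jacSubmodule (A := A) R P) p = centerRank A P p := by
  let _ := centerModule A P
  let L : Submodule (Subring.center A) P :=
    { (jacSubmodule (A := A) R P).toAddSubgroup with
      smul_mem' := fun z x hx => (jacSubmodule (A := A) R P).smul_mem (centerToOp A z) hx }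
  refine finrank_fiber_quotient p L ?_
  intro x hx
  refine Submodule.span_induction
    (p := fun x _ => x ∈ p.asIdeal • (⊤ : Submodule (Subring.center A) P)) ?_ ?_ ?_ ?_
    (show x ∈ jacSubmodule (A := A) R P from hx)
  · rintro _ ⟨r, hr, x, rfl⟩
    exact Submodule.smul_mem_smul (algebraMap_mem_of_isMaximal hp hr) (trivial : x ∈ ⊤)
  · exact zero_mem _
  · intro x y _ _ h h'
    exact add_mem h h'
  · intro a x _ h
    refine Submodule.smul_induction_on h ?_ ?_
    · intro z hz y _
      have h1 : a • z • y = z • a • y := by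
        change a • op (z : A) • y = op (z : A) • a • y
        rw [← mul_smul, ← mul_smul]
        congr 1
        exact unop_injective (Subring.mem_center_iff.1 z.2 a.unop).symm
      rw [h1]
      exact Submodule.smul_mem_smul hz trivial
    · intro x y h h'
      rw [smul_add]
      exact add_mem h h'

theorem baseModule_isScalarTower (R : Type u) [CommRing R] [Algebra R A] (P : Type*)
    [AddCommGroup P] [Module Aᵐᵒᵖ P] :
    letI := baseModule R A P
    IsScalarTower R Aᵐᵒᵖ P :=
  letI := baseModule R A P
  ⟨fun r a x => by
    change (r • a) • x = algebraMap R Aᵐᵒᵖ r • a • x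
    rw [Algebra.smul_def, mul_smul]⟩

/-- Projective modules are projective over the centre. -/
theorem projective_center [Finite (MaximalSpectrum R)] {σ : AlgInvolution R A}
    (hA : IsAzumayaWithInvolution σ) (e : SeparabilityElement R A) [Module.Finite R A] {κ : R}
    (hκ : κ + κ = 1) (P : Type*) [AddCommGroup P] [Module Aᵐᵒᵖ P] [Module.Projective Aᵐᵒᵖ P] :
    letI := centerModule A P
    Module.Projective (Subring.center A) P := by
  let _ := centerModule A P
  let _ := baseModule R A P
  let _ := centerAlgebra R A
  have := baseModule_isScalarTower (A := A) R P
  have := hA.projective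
  have : Module.Projective R Aᵐᵒᵖ := Module.Projective.of_equiv (opLinearEquiv R)
  have : IsScalarTower R (Subring.center A) P := ⟨fun r z x => by
    change centerToOp A (r • z) • x = algebraMap R Aᵐᵒᵖ r • centerToOp A z • x
    rw [Algebra.smul_def, map_mul, mul_smul]
    rfl⟩
  have : Module.Projective R P := by
    obtain ⟨g, hg⟩ := Module.projective_def'.1 (inferInstance : Module.Projective Aᵐᵒᵖ P)
    have : DecidableEq P := Classical.decEq P
    have : ∀ a : Aᵐᵒᵖ, Decidable (a ≠ 0) := fun a => Classical.dec _
    have : Module.Projective R (P →₀ Aᵐᵒᵖ) :=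
      Module.Projective.of_equiv (finsuppLequivDFinsupp R).symm
    exact Module.Projective.of_split (g.restrictScalars R)
      ((Finsupp.linearCombination Aᵐᵒᵖ id).restrictScalars R)
      (LinearMap.ext fun x => LinearMap.congr_fun hg x)
  obtain ⟨n, s, t, k, hs, ht, hk, h1⟩ := exists_antisymmetric_sum_mul hA e hκ
  have hfix : ∀ z ∈ Set.center A, σ z = z → ∃ r, algebraMap R A r = z := fun z hz hσ =>
    (Set.ext_iff.1 hA.range_eq z).2 ⟨hz, hσ⟩
  have h2κ : algebraMap R A κ + algebraMap R A κ = 1 := by rw [← map_add, hκ, map_one]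
  refine projective_of_antisymmetric (R := R) (κ := κ) (k := k) hκ
    (S := {s : Subring.center A | σ (s : A) = -s}) ?_ ?_ ?_ (fun i => ⟨s i, (hs i).1⟩)
    (fun i => ⟨t i, (ht i).1⟩) (fun i => (hs i).2) (fun i => (ht i).2) ?_
  · intro z
    have hσz : σ z ∈ Subring.center A := σ.mem_center z.2
    have hcen : ∀ a : A, a ∈ Subring.center A → κ • a ∈ Subring.center A := fun a ha => by
      rw [Algebra.smul_def]
      exact mul_mem (Set.algebraMap_mem_center κ) ha
    obtain ⟨r, hr⟩ := hfix (κ • (z + σ z)) (hcen _ (add_mem z.2 hσz)) (by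
      rw [σ.map_smul, σ.map_add, σ.apply_apply, add_comm])
    refine ⟨r, ⟨κ • (z - σ z), hcen _ (sub_mem z.2 hσz)⟩, ?_, Subtype.ext ?_⟩
    · change σ (κ • ((z : A) - σ z)) = -(κ • ((z : A) - σ z))
      rw [σ.map_smul, σ.map_sub, σ.apply_apply, ← smul_neg, neg_sub]
    · change (z : A) = algebraMap R A r + κ • ((z : A) - σ z)
      rw [hr, ← smul_add, add_add_sub_cancel, smul_add, ← add_smul, hκ, one_smul]
  · intro a ha b hb
    obtain ⟨r, hr⟩ := hfix (a * b) (mul_mem a.2 b.2) (by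
      rw [σ.map_mul, show σ (a : A) = -a from ha, show σ (b : A) = -b from hb, neg_mul_neg]
      exact Subring.mem_center_iff.1 a.2 b)
    exact ⟨r, Subtype.ext hr.symm⟩
  · intro a ha
    refine Subtype.ext ((?_ : _ = k • (a : A)).trans (hk a a.2 ha))
    rw [Algebra.smul_def, Algebra.smul_def]
    rfl
  · refine Subtype.ext (Eq.trans ?_ h1)
    rw [Subring.coe_add, AddSubmonoidClass.coe_finsetSum]
    rfl

/-- Projectivity over the centre makes the ranks locally constant, so the comparison defines a
clopen set and hence an idempotent. -/
theorem exists_center_idempotent_centerRank_lt [Finite (MaximalSpectrum R)] {σ : AlgInvolution R A}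
    (hA : IsAzumayaWithInvolution σ) (e : SeparabilityElement R A) [Module.Finite R A] {κ : R}
    (hκ : κ + κ = 1) (P Q : Type*) [AddCommGroup P] [Module Aᵐᵒᵖ P] [AddCommGroup Q]
    [Module Aᵐᵒᵖ Q] [Module.Finite Aᵐᵒᵖ P] [Module.Projective Aᵐᵒᵖ P] [Module.Finite Aᵐᵒᵖ Q]
    [Module.Projective Aᵐᵒᵖ Q] :
    ∃ z : Subring.center A, z * z = z ∧
      ∀ p, z ∉ p.asIdeal ↔ centerRank A Q p < centerRank A P p := by
  let _ := centerModule A P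
  let _ := centerModule A Q
  have := finite_center (A := A) R P
  have := finite_center (A := A) R Q
  have := projective_center hA e hκ P
  have := projective_center hA e hκ Q
  exact exists_idempotent_finrank_fiber_lt

end CenterRank

/-! ### Ranks decide direct summands over a semilocal base -/

section Splitting

variable {R : Type u} {A : Type v} [CommRing R] [Ring A] [Algebra R A]
  {P Q X Y K C : Type*} [AddCommGroup P] [Module Aᵐᵒᵖ P] [AddCommGroup Q] [Module Aᵐᵒᵖ Q]
  [AddCommGroup X] [Module Aᵐᵒᵖ X] [AddCommGroup Y] [Module Aᵐᵒᵖ Y]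
  [AddCommGroup K] [Module Aᵐᵒᵖ K] [AddCommGroup C] [Module Aᵐᵒᵖ C]

theorem SeparabilityElement.isSemisimpleModule_of_jacobson [Finite (MaximalSpectrum R)]
    (e : SeparabilityElement R A)
    (h : ∀ r ∈ (⊥ : Ideal R).jacobson, ∀ x : P, op (algebraMap R A r) • x = 0) :
    IsSemisimpleModule Aᵐᵒᵖ P := by
  let _ := baseModule R A P
  have := baseModule_isScalarTower (A := A) R P
  have : IsSemisimpleModule R P := isSemisimpleModule_of_jacobson_smul h
  exact e.isSemisimpleModule

theorem op_smul_eq_zero_of_mem_jacIdeal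
    (h : ∀ r ∈ (⊥ : Ideal R).jacobson, ∀ x : P, op (algebraMap R A r) • x = 0) {a : A}
    (ha : a ∈ jacIdeal R A) (x : P) : op a • x = 0 := by
  refine Submodule.smul_induction_on (p := fun a => op a • x = 0) (mem_jacIdeal.1 ha) ?_ ?_
  · intro r hr b _
    rw [Algebra.smul_def, Algebra.commutes, op_mul, mul_smul, h r hr]
  · intro b c hb hc
    rw [op_add, add_smul, hb, hc, add_zero]

/-- The image of a map from `C` to `K` embeds back into `C` through a complement of the kernel, and
a retraction of `K` onto it gives a map in the other direction. -/
theorem eq_zero_of_hom_eq_zero [IsSemisimpleModule Aᵐᵒᵖ K] [IsSemisimpleModule Aᵐᵒᵖ C]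
    (h : ∀ g : K →ₗ[Aᵐᵒᵖ] C, g = 0) (g : C →ₗ[Aᵐᵒᵖ] K) : g = 0 := by
  obtain ⟨N, hN⟩ := exists_isCompl (LinearMap.ker g)
  have hinj : Function.Injective (g ∘ₗ N.subtype) := by
    rw [injective_iff_map_eq_zero]
    intro x hx
    exact Subtype.ext (Submodule.disjoint_def.1 hN.disjoint x hx x.2)
  obtain ⟨r, hr⟩ := exists_retraction (LinearMap.range (g ∘ₗ N.subtype))
  have h1 := h (N.subtype ∘ₗ (LinearEquiv.ofInjective _ hinj).symm.toLinearMap ∘ₗ r)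
  have hN0 : N = ⊥ := by
    rw [eq_bot_iff]
    intro x hx
    have h2 := LinearMap.congr_fun h1 (g x)
    have h3 : r (g x) = LinearEquiv.ofInjective _ hinj ⟨x, hx⟩ := hr ⟨g x, ⟨⟨x, hx⟩, rfl⟩⟩
    rw [LinearMap.comp_apply, LinearMap.comp_apply, h3, LinearEquiv.coe_coe,
      LinearEquiv.symm_apply_apply] at h2
    exact h2
  rw [hN0] at hN
  exact LinearMap.ker_eq_top.1 (eq_top_of_isCompl_bot hN)

/-- Semisimple modules without common constituents are separated by a central element. -/
theorem SeparabilityElement.exists_center_separating [Finite (MaximalSpectrum R)]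
    (e : SeparabilityElement R A) [Module.Finite R A] [Module.Finite Aᵐᵒᵖ C]
    (hK : ∀ r ∈ (⊥ : Ideal R).jacobson, ∀ x : K, op (algebraMap R A r) • x = 0)
    (hC : ∀ r ∈ (⊥ : Ideal R).jacobson, ∀ x : C, op (algebraMap R A r) • x = 0)
    (h : ∀ g : K →ₗ[Aᵐᵒᵖ] C, g = 0) :
    ∃ z : Subring.center A, (∀ x : K, op (z : A) • x = x) ∧ ∀ x : C, op (z : A) • x = 0 := by
  have := e.isSemisimpleModule_of_jacobson hK
  have := e.isSemisimpleModule_of_jacobson hC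
  have : IsSemisimpleModule Aᵐᵒᵖ (K × C) := e.isSemisimpleModule_of_jacobson fun r hr x =>
    Prod.ext (hK r hr x.1) (hC r hr x.2)
  have h' := eq_zero_of_hom_eq_zero h
  let I : Ideal A :=
    { carrier := {a | ∀ x : C, op a • x = 0}
      add_mem' := fun ha hb x => by rw [op_add, add_smul, ha, hb, add_zero]
      zero_mem' := fun x => by rw [op_zero, zero_smul]
      smul_mem' := fun c a ha x => by rw [smul_eq_mul, op_mul, mul_smul, ha] }
  have : I.IsTwoSided := ⟨fun {a} b ha x => by rw [op_mul, mul_smul, ha, smul_zero]⟩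
  obtain ⟨z, hzc, hzI, hz⟩ := e.exists_center_generator I
  refine ⟨⟨z, hzc⟩, fun k => ?_, hzI⟩
  -- Without maps between `K` and `C` in either direction, the projection onto `K` commutes with all
  -- endomorphisms of `K × C`. By density some ring element acts like it on `k` and on generators of
  -- `C`, so it lies in `I` and fixes `k`. As `z` is a unit of `I` modulo `JA`, it fixes `k` too.
  let p : Module.End (Module.End Aᵐᵒᵖ (K × C)) (K × C) :=
    { toFun := fun x => (x.1, 0)
      map_add' := fun x y => by simp
      map_smul' := fun φ x => by
        have h1 : (φ (x.1, 0)).2 = 0 :=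
          LinearMap.congr_fun (h (LinearMap.snd _ _ _ ∘ₗ φ ∘ₗ LinearMap.inl _ _ _)) x.1
        have h2 : (φ (0, x.2)).1 = 0 :=
          LinearMap.congr_fun (h' (LinearMap.fst _ _ _ ∘ₗ φ ∘ₗ LinearMap.inr _ _ _)) x.2
        have h3 : φ x = φ (x.1, 0) + φ (0, x.2) := by
          rw [← map_add, Prod.mk_add_mk, add_zero, zero_add]
        change ((φ x).1, 0) = φ (x.1, 0)
        rw [h3, Prod.fst_add, h2, add_zero]
        exact Prod.ext rfl h1.symm }
  let _ := baseModule R A C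
  have := baseModule_isScalarTower (A := A) R C
  have : Module.Finite R Aᵐᵒᵖ := Module.Finite.equiv (opLinearEquiv R)
  have : Module.Finite R C := Module.Finite.trans Aᵐᵒᵖ C
  obtain ⟨s, hs⟩ := (Module.Finite.fg_top : (⊤ : Submodule R C).FG)
  classical
  obtain ⟨a, ha⟩ := jacobson_density p (insert (k, 0) (s.image fun c => (0, c)))
  have hak : k = op a.unop • k :=
    congrArg Prod.fst (ha (k, 0) (Finset.mem_insert_self _ _))
  have haI : a.unop ∈ I := by
    intro x
    have hx : x ∈ Submodule.span R (s : Set C) := by rw [hs]; trivial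
    induction hx using Submodule.span_induction with
    | mem c hc =>
      exact (congrArg Prod.snd (ha (0, c) (Finset.mem_insert_of_mem
        (Finset.mem_image_of_mem _ hc)))).symm
    | zero => rw [smul_zero]
    | add x y _ _ hx hy => rw [smul_add, hx, hy, add_zero]
    | smul r x _ hx =>
      change op a.unop • (op (algebraMap R A r)) • x = 0
      rw [← mul_smul, ← op_mul, Algebra.commutes, op_mul, mul_smul, hx, smul_zero]
  have h1 := op_smul_eq_zero_of_mem_jacIdeal hK (hz _ haI) k
  rw [op_sub, sub_smul, ← hak, (Set.mem_center_iff.1 hzc).comm, op_mul, mul_smul, ← hak] at h1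
  exact sub_eq_zero.1 h1

theorem map_mem_jacSubmodule (g : P →ₗ[Aᵐᵒᵖ] Q) {x : P} (hx : x ∈ jacSubmodule (A := A) R P) :
    g x ∈ jacSubmodule (A := A) R Q := by
  have : (jacSubmodule (A := A) R P).map g ≤ jacSubmodule (A := A) R Q := by
    rw [jacSubmodule, Submodule.map_span, Submodule.span_le]
    rintro _ ⟨_, ⟨r, hr, x, rfl⟩, rfl⟩
    exact Submodule.subset_span ⟨r, hr, g x, g.map_smul _ _⟩
  exact this ⟨x, hx, rfl⟩

theorem smul_quotient_jacSubmodule (P : Type*) [AddCommGroup P] [Module Aᵐᵒᵖ P] :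
    ∀ r ∈ (⊥ : Ideal R).jacobson, ∀ x : P ⧸ jacSubmodule (A := A) R P,
      op (algebraMap R A r) • x = 0 := by
  intro r hr x
  obtain ⟨x, rfl⟩ := Submodule.mkQ_surjective _ x
  rw [← map_smul]
  exact (Submodule.Quotient.mk_eq_zero _).2 (Submodule.subset_span ⟨r, hr, x, rfl⟩)

/-- Nakayama: the cokernel is divisible by `J`, so its rank vanishes at every maximal ideal of the
centre. -/
theorem surjective_of_mkQ_comp_surjective [Module.Finite R A] [Module.Finite Aᵐᵒᵖ X]
    (g : Y →ₗ[Aᵐᵒᵖ] X)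
    (hg : Function.Surjective ((jacSubmodule (A := A) R X).mkQ ∘ₗ g)) : Function.Surjective g := by
  have : Subsingleton (X ⧸ LinearMap.range g) := by
    refine subsingleton_of_centerRank_eq_zero (A := A) R fun p hp => ?_
    rw [← centerRank_quotient_jacSubmodule (R := R) hp]
    have h1 : jacSubmodule (A := A) R (X ⧸ LinearMap.range g) = ⊤ := by
      rw [eq_top_iff]
      intro q _
      obtain ⟨x, rfl⟩ := Submodule.mkQ_surjective _ q
      obtain ⟨y, hy⟩ := hg (Submodule.mkQ _ x)
      have h2 : x - g y ∈ jacSubmodule (A := A) R X := (Submodule.Quotient.eq _).1 hy.symm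
      have h3 := map_mem_jacSubmodule (LinearMap.range g).mkQ h2
      rw [map_sub, show (LinearMap.range g).mkQ (g y) = 0 from
        (Submodule.Quotient.mk_eq_zero _).2 ⟨y, rfl⟩, sub_zero] at h3
      exact h3
    have : Subsingleton ((X ⧸ LinearMap.range g) ⧸ jacSubmodule (A := A) R (X ⧸ LinearMap.range g)) :=
      Submodule.Quotient.subsingleton_iff.2 h1
    refine centerRank_eq_zero_of_smul_eq (A := A) R (z := 0) p.asIdeal.zero_mem fun x =>
      Subsingleton.elim _ _
  exact LinearMap.range_eq_top.1 (Submodule.Quotient.subsingleton_iff.1 this)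

theorem exists_equiv_prod_ker [Module.Projective Aᵐᵒᵖ X] (g : Y →ₗ[Aᵐᵒᵖ] X)
    (hg : Function.Surjective g) : Nonempty (Y ≃ₗ[Aᵐᵒᵖ] X × LinearMap.ker g) := by
  obtain ⟨s, hs⟩ := Module.projective_lifting_property g LinearMap.id hg
  have hs' : ∀ x, g (s x) = x := fun x => LinearMap.congr_fun hs x
  refine ⟨LinearEquiv.ofLinearMap
    (g.prod ((LinearMap.id - s ∘ₗ g).codRestrict _ fun y => by simp [hs']))
    (s.coprod (LinearMap.ker g).subtype) ?_ ?_⟩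
  · refine LinearMap.ext fun x => Prod.ext ?_ (Subtype.ext ?_)
    · change g (s x.1 + x.2) = x.1
      rw [map_add, hs', show g x.2 = 0 from x.2.2, add_zero]
    · change (s x.1 + (x.2 : Y)) - s (g (s x.1 + x.2)) = x.2
      rw [map_add, hs', show g x.2 = 0 from x.2.2, add_zero, add_sub_cancel_left]
  · ext y
    change s (g y) + (y - s (g y)) = y
    rw [add_sub_cancel]

/-- Over a semilocal base, a projective module of smaller rank is a direct summand. -/
theorem exists_equiv_prod_of_centerRank_le [Finite (MaximalSpectrum R)]
    (e : SeparabilityElement R A) [Module.Finite R A] (X Y : Type*) [AddCommGroup X]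
    [Module Aᵐᵒᵖ X] [AddCommGroup Y] [Module Aᵐᵒᵖ Y] [Module.Finite Aᵐᵒᵖ X]
    [Module.Projective Aᵐᵒᵖ X] [Module.Finite Aᵐᵒᵖ Y] [Module.Projective Aᵐᵒᵖ Y]
    (h : ∀ p : PrimeSpectrum (Subring.center A), p.asIdeal.IsMaximal →
      centerRank A X p ≤ centerRank A Y p) :
    ∃ W : Submodule Aᵐᵒᵖ Y, Nonempty (Y ≃ₗ[Aᵐᵒᵖ] X × W) := by
  let JX := jacSubmodule (A := A) R X
  let JY := jacSubmodule (A := A) R Y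
  have hX := smul_quotient_jacSubmodule (R := R) (A := A) X
  have hY := smul_quotient_jacSubmodule (R := R) (A := A) Y
  have : IsSemisimpleModule Aᵐᵒᵖ (X ⧸ JX) := e.isSemisimpleModule_of_jacobson hX
  have : IsSemisimpleModule Aᵐᵒᵖ (Y ⧸ JY) := e.isSemisimpleModule_of_jacobson hY
  -- A map modulo `J` with maximal image is surjective and lifts to a surjection `Y → X`, which
  -- splits.
  obtain ⟨_, ⟨g, rfl⟩, hmax⟩ := set_has_maximal_iff_noetherian.2
    (inferInstance : IsNoetherian Aᵐᵒᵖ (X ⧸ JX))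
    (Set.range fun g : (Y ⧸ JY) →ₗ[Aᵐᵒᵖ] X ⧸ JX => LinearMap.range g) ⟨_, 0, rfl⟩
  obtain ⟨C, hC⟩ := exists_isCompl (LinearMap.range g)
  obtain ⟨K', hK'⟩ := exists_isCompl (LinearMap.ker g)
  have hgs : Function.Surjective g := by
    have f1 : Module.Finite Aᵐᵒᵖ (LinearMap.range g) := inferInstance
    have f2 : Module.Finite Aᵐᵒᵖ C := inferInstance
    have f3 : Module.Finite Aᵐᵒᵖ (LinearMap.ker g) := inferInstance
    have hCr : ∀ r ∈ (⊥ : Ideal R).jacobson, ∀ x : C, op (algebraMap R A r) • x = 0 :=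
      fun r hr x => Subtype.ext (hX r hr x)
    have hKr : ∀ r ∈ (⊥ : Ideal R).jacobson, ∀ x : LinearMap.ker g,
      op (algebraMap R A r) • x = 0 := fun r hr x => Subtype.ext (hY r hr x)
    by_cases hhom : ∀ θ : LinearMap.ker g →ₗ[Aᵐᵒᵖ] C, θ = 0
    · obtain ⟨z, hz1, hz0⟩ := e.exists_center_separating hKr hCr hhom
      have : Subsingleton C := by
        refine subsingleton_of_centerRank_eq_zero (A := A) R fun p hp => ?_
        -- If `z` lies in `p`, the kernel of `g` has rank zero there, and comparing the ranks of `X`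
        -- and `Y` leaves no room for `C`. If not, `z` kills `C` at `p`.
        by_cases hzp : z ∈ p.asIdeal
        · have h1 := h p hp
          rw [← centerRank_quotient_jacSubmodule (R := R) hp,
            ← centerRank_quotient_jacSubmodule (R := R) (P := Y) hp,
            ← centerRank_congr (Submodule.prodEquivOfIsCompl _ _ hC),
            ← centerRank_congr (Submodule.prodEquivOfIsCompl _ _ hK'),
            centerRank_prod R, centerRank_prod R,
            centerRank_eq_zero_of_smul_eq (P := LinearMap.ker g) R hzp hz1,
            centerRank_congr ((Submodule.quotientEquivOfIsCompl _ _ hK').symm.trans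
              g.quotKerEquivRange)] at h1
          omega
        · exact centerRank_eq_zero_of_smul_eq_zero R hzp hz0
      have hC0 : C = ⊥ := Submodule.eq_bot_of_subsingleton
      rw [hC0] at hC
      exact LinearMap.range_eq_top.1 (eq_top_of_isCompl_bot hC)
    · exfalso
      push Not at hhom
      obtain ⟨θ, hθ⟩ := hhom
      obtain ⟨k, hk⟩ : ∃ k, θ k ≠ 0 := by
        by_contra! h0
        exact hθ (LinearMap.ext h0)
      -- A nonzero map from the kernel to the missing part `C` would enlarge the image.
      let g' := g + C.subtype ∘ₗ θ ∘ₗ (LinearMap.ker g).projectionOnto K' hK'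
      refine hmax _ ⟨g', rfl⟩ (lt_of_le_of_ne ?_ ?_)
      · rintro _ ⟨y, rfl⟩
        obtain ⟨l, m, rfl, -⟩ := Submodule.existsUnique_add_of_isCompl hK' y
        refine ⟨m, ?_⟩
        change g m + θ ((LinearMap.ker g).projectionOnto K' hK' m) = g (l + m)
        rw [Submodule.projectionOnto_apply_right, map_zero, map_add, show g l = 0 from l.2, zero_add]
        exact add_zero _
      · intro heq
        have h1 : (θ k : X ⧸ JX) ∈ LinearMap.range g := by
          change _ ∈ (fun g : (Y ⧸ JY) →ₗ[Aᵐᵒᵖ] X ⧸ JX => LinearMap.range g) g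
          rw [heq]
          refine ⟨k, ?_⟩
          change g k + θ ((LinearMap.ker g).projectionOnto K' hK' k) = θ k
          rw [Submodule.projectionOnto_apply_left, show g k = 0 from k.2, zero_add]
        exact hk (Subtype.ext (Submodule.disjoint_def.1 hC.disjoint _ h1 (θ k).2))
  obtain ⟨G, hG⟩ := Module.projective_lifting_property JX.mkQ (g ∘ₗ JY.mkQ) JX.mkQ_surjective
  have hGs : Function.Surjective G := surjective_of_mkQ_comp_surjective (R := R) G (by
    change Function.Surjective (JX.mkQ ∘ₗ G)
    rw [hG]
    exact hgs.comp JY.mkQ_surjective)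
  exact ⟨_, exists_equiv_prod_ker G hGs⟩

end Splitting

/-! ### Central idempotents and the rank of the dual -/

section Components

variable {R : Type u} {A : Type v} [CommRing R] [Ring A] [Algebra R A] {σ : AlgInvolution R A}
  {ε : A} {P : Type*} [AddCommGroup P] [Module Aᵐᵒᵖ P]

theorem finite_of_isCompl [Module.Finite Aᵐᵒᵖ P] {L M : Submodule Aᵐᵒᵖ P} (h : IsCompl L M) :
    Module.Finite Aᵐᵒᵖ L :=
  Module.Finite.of_surjective (L.projectionOnto M h) fun x =>
    ⟨x, Submodule.projectionOnto_apply_left h x⟩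

theorem projective_of_isCompl [Module.Projective Aᵐᵒᵖ P] {L M : Submodule Aᵐᵒᵖ P}
    (h : IsCompl L M) : Module.Projective Aᵐᵒᵖ L :=
  Module.Projective.of_split L.subtype (L.projectionOnto M h)
    (LinearMap.ext fun x => Submodule.projectionOnto_apply_left h x)

theorem finite_snd_of_equiv_prod {X W : Type*} [AddCommGroup X] [Module Aᵐᵒᵖ X] [AddCommGroup W]
    [Module Aᵐᵒᵖ W] [Module.Finite Aᵐᵒᵖ P] (g : P ≃ₗ[Aᵐᵒᵖ] X × W) : Module.Finite Aᵐᵒᵖ W :=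
  Module.Finite.of_surjective (LinearMap.snd Aᵐᵒᵖ X W ∘ₗ g.toLinearMap)
    fun w => ⟨g.symm (0, w), by simp⟩

theorem projective_snd_of_equiv_prod {X W : Type*} [AddCommGroup X] [Module Aᵐᵒᵖ X]
    [AddCommGroup W] [Module Aᵐᵒᵖ W] [Module.Projective Aᵐᵒᵖ P] (g : P ≃ₗ[Aᵐᵒᵖ] X × W) :
    Module.Projective Aᵐᵒᵖ W :=
  Module.Projective.of_split (g.symm.toLinearMap ∘ₗ LinearMap.inr Aᵐᵒᵖ X W)
    (LinearMap.snd Aᵐᵒᵖ X W ∘ₗ g.toLinearMap) (LinearMap.ext fun x => by simp)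

/-- The part of a right module supported on a central element. -/
def component (P : Type*) [AddCommGroup P] [Module Aᵐᵒᵖ P] (z : Subring.center A) :
    Submodule Aᵐᵒᵖ P := LinearMap.range (centerMul P z.2)

section Idempotent

variable {z : Subring.center A} (hz : z * z = z)
include hz

theorem smul_component (x : component P z) : op (z : A) • x = x := by
  obtain ⟨_, y, rfl⟩ := x
  refine Subtype.ext ?_
  change op (z : A) • op (z : A) • y = op (z : A) • y
  rw [← mul_smul, ← op_mul, show (z : A) * z = z from congrArg Subtype.val hz]

theorem one_sub_mul_self : (1 - z) * (1 - z) = 1 - z := by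
  linear_combination hz

theorem isCompl_component : IsCompl (component P z) (component P (1 - z)) := by
  have h1 : ((1 - z : Subring.center A) : A) = 1 - z := rfl
  rw [isCompl_iff, Submodule.disjoint_def, codisjoint_iff, eq_top_iff]
  constructor
  · intro x hx hx'
    have h2 : op (z : A) • x = x := congrArg Subtype.val (smul_component hz ⟨x, hx⟩)
    have h3 : op ((1 - z : Subring.center A) : A) • x = x :=
      congrArg Subtype.val (smul_component (one_sub_mul_self hz) ⟨x, hx'⟩)
    rw [h1, op_sub, op_one, sub_smul, one_smul, h2, sub_self] at h3
    exact h3.symm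
  · intro x _
    refine Submodule.mem_sup.2 ⟨op (z : A) • x, ⟨x, rfl⟩,
      op ((1 - z : Subring.center A) : A) • x, ⟨x, rfl⟩, ?_⟩
    rw [h1, ← add_smul, ← op_add, add_sub_cancel, op_one, one_smul]

/-- A module is the direct sum of the parts cut out by complementary central idempotents. -/
noncomputable def componentEquiv (P : Type*) [AddCommGroup P] [Module Aᵐᵒᵖ P] :
    (component P z × component P (1 - z)) ≃ₗ[Aᵐᵒᵖ] P :=
  Submodule.prodEquivOfIsCompl _ _ (isCompl_component hz)

theorem finite_component [Module.Finite Aᵐᵒᵖ P] : Module.Finite Aᵐᵒᵖ (component P z) :=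
  finite_of_isCompl (isCompl_component hz)

theorem projective_component [Module.Projective Aᵐᵒᵖ P] :
    Module.Projective Aᵐᵒᵖ (component P z) :=
  projective_of_isCompl (isCompl_component hz)

end Idempotent

/-- The action of an involution on the centre. -/
def AlgInvolution.center (σ : AlgInvolution R A) (z : Subring.center A) : Subring.center A :=
  ⟨σ z, σ.mem_center z.2⟩

theorem AlgInvolution.center_center (σ : AlgInvolution R A) (z : Subring.center A) :
    σ.center (σ.center z) = z := Subtype.ext (σ.apply_apply z)

theorem AlgInvolution.center_mul (σ : AlgInvolution R A) (z w : Subring.center A) :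
    σ.center (z * w) = σ.center z * σ.center w :=
  Subtype.ext ((σ.map_mul _ _).trans (Subring.mem_center_iff.1 (σ.mem_center z.2) _))

theorem AlgInvolution.center_one_sub (σ : AlgInvolution R A) (z : Subring.center A) :
    σ.center (1 - z) = 1 - σ.center z :=
  Subtype.ext ((σ.map_sub _ _).trans (congrArg (· - _) σ.map_one))

variable {p : PrimeSpectrum (Subring.center A)} {z : Subring.center A}

theorem notMem_of_one_sub_mem (h : 1 - z ∈ p.asIdeal) : z ∉ p.asIdeal := fun h' =>
  p.2.ne_top ((Ideal.eq_top_iff_one _).2 (by simpa using add_mem h h'))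

theorem one_sub_mem_of_notMem (hz : z * z = z) (h : z ∉ p.asIdeal) : 1 - z ∈ p.asIdeal := by
  refine (p.2.mem_or_mem (x := z) (y := 1 - z) ?_).resolve_left h
  rw [mul_sub, mul_one, hz, sub_self]
  exact zero_mem _

theorem centerRank_component [Module.Finite R A] [Module.Finite Aᵐᵒᵖ P] (hz : z * z = z)
    (h : z ∉ p.asIdeal) : centerRank A (component P z) p = centerRank A P p := by
  have := finite_component (P := P) hz
  have := finite_component (P := P) (one_sub_mul_self hz)
  rw [← centerRank_congr (componentEquiv hz P), centerRank_prod R,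
    centerRank_eq_zero_of_smul_eq (P := component P (1 - z)) R (one_sub_mem_of_notMem hz h)
      (smul_component (one_sub_mul_self hz)), add_zero]

theorem centerRank_component_eq_zero [Module.Finite R A] [Module.Finite Aᵐᵒᵖ P] (hz : z * z = z)
    (h : z ∈ p.asIdeal) : centerRank A (component P z) p = 0 :=
  have := finite_component (P := P) hz
  centerRank_eq_zero_of_smul_eq R h (smul_component hz)

/-- Dualising moves the part of a module at `z` to the part at `σ z`; this is why a module and its
dual can have different ranks. -/
theorem smul_starDual_component (hz : z * z = z) (φ : StarDual σ (component P z)) :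
    op (σ.center z : A) • φ = φ := by
  refine StarDual.ext fun x => ?_
  change σ (σ z) * φ x = φ x
  rw [σ.apply_apply, ← Subring.mem_center_iff.1 z.2, ← StarDual.apply_smul, smul_component hz]

theorem centerRank_starDual_component_eq_zero [Module.Finite R A] [Module.Finite Aᵐᵒᵖ P]
    [Module.Projective Aᵐᵒᵖ P] (hz : z * z = z) (h : σ.center z ∈ p.asIdeal) :
    centerRank A (StarDual σ (component P z)) p = 0 :=
  have := finite_component (P := P) hz
  have := projective_component (P := P) hz
  centerRank_eq_zero_of_smul_eq R h (smul_starDual_component hz)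

theorem centerRank_starDual_component [Module.Finite R A] [Module.Finite Aᵐᵒᵖ P]
    [Module.Projective Aᵐᵒᵖ P] (hz : z * z = z) (h : σ.center z ∉ p.asIdeal) :
    centerRank A (StarDual σ (component P z)) p = centerRank A (StarDual σ P) p := by
  have := finite_component (P := P) hz
  have := projective_component (P := P) hz
  have := finite_component (P := P) (one_sub_mul_self hz)
  have := projective_component (P := P) (one_sub_mul_self hz)
  have hσz : σ.center z * σ.center z = σ.center z := by rw [← σ.center_mul, hz]
  rw [centerRank_congr ((StarDual.congr σ (componentEquiv hz P)).symm.trans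
    (StarDual.prodEquiv σ _ _)), centerRank_prod R,
    centerRank_starDual_component_eq_zero (one_sub_mul_self hz) (by
      rw [σ.center_one_sub]
      exact one_sub_mem_of_notMem hσz h), add_zero]

/-- A projective module that contains its dual as a direct summand, or is contained in it, has the
same ranks as its dual. -/
theorem centerRank_starDual_eq_of_le [Finite (MaximalSpectrum R)] (e : SeparabilityElement R A)
    [Module.Finite R A] [Module.Finite Aᵐᵒᵖ P] [Module.Projective Aᵐᵒᵖ P]
    (h : (∀ p, centerRank A (StarDual σ P) p ≤ centerRank A P p) ∨
      ∀ p, centerRank A P p ≤ centerRank A (StarDual σ P) p)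
    (p : PrimeSpectrum (Subring.center A)) :
    centerRank A (StarDual σ P) p = centerRank A P p := by
  rcases h with h | h
  -- From `P ≅ P* ⊕ W` follows `P* ≅ P ⊕ W*` by dualising. Adding the rank equations gives rank zero
  -- for `W` and `W*`.
  · obtain ⟨W, ⟨g⟩⟩ := exists_equiv_prod_of_centerRank_le e (StarDual σ P) P fun p _ => h p
    have := finite_snd_of_equiv_prod g
    have := projective_snd_of_equiv_prod g
    have h1 := centerRank_congr g p
    have h2 := centerRank_congr ((StarDual.congr σ g).trans (StarDual.prodEquiv σ _ _)) p
    rw [centerRank_prod R] at h1 h2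
    rw [← centerRank_congr (StarDual.evalEquiv σ P)] at h2
    omega
  · obtain ⟨W, ⟨g⟩⟩ := exists_equiv_prod_of_centerRank_le e P (StarDual σ P) fun p _ => h p
    have := finite_snd_of_equiv_prod g
    have := projective_snd_of_equiv_prod g
    have h1 := centerRank_congr g p
    have h2 := centerRank_congr ((StarDual.congr σ g).trans (StarDual.prodEquiv σ _ _)) p
    rw [centerRank_prod R] at h1 h2
    rw [← centerRank_congr (StarDual.evalEquiv σ P)] at h2
    omega

/-- A hyperbolic space is unchanged when one component of its module is dualised; this allows rank
to be moved between conjugate parts of the spectrum. -/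
theorem hypForm_isometric_component (hε : ε ∈ Set.center A) (hεσ : σ ε * ε = 1)
    [Module.Finite Aᵐᵒᵖ P] [Module.Projective Aᵐᵒᵖ P] (hz : z * z = z) :
    (hypForm σ ε hε hεσ P).Isometric
      (hypForm σ ε hε hεσ (component P z × StarDual σ (component P (1 - z)))) := by
  have := finite_component (P := P) (one_sub_mul_self hz)
  have := projective_component (P := P) (one_sub_mul_self hz)
  exact ((HermForm.hypForm_isometric_congr hε hεσ (componentEquiv hz P).symm).trans
    (HermForm.hypForm_isometric_prod hε hεσ).symm).trans
    (((HermForm.Isometric.refl _).prod (HermForm.hypForm_isometric_starDual hε hεσ)).trans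
      (HermForm.hypForm_isometric_prod hε hεσ))

theorem centerRank_starDual_free [Module.Finite R A] (hε : ε ∈ Set.center A)
    (hεσ : σ ε * ε = 1) (n : ℕ) (p : PrimeSpectrum (Subring.center A)) :
    centerRank A (StarDual σ (Fin n → A)) p = centerRank A (Fin n → A) p := by
  induction n with
  | zero =>
    rw [centerRank_eq_zero_of_smul_eq (P := Fin 0 → A) R p.asIdeal.zero_mem fun x =>
        Subsingleton.elim _ _,
      centerRank_eq_zero_of_smul_eq (P := StarDual σ (Fin 0 → A)) R p.asIdeal.zero_mem fun φ =>
        StarDual.ext fun x => by rw [Subsingleton.elim x 0, StarDual.apply_zero, StarDual.apply_zero]]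
  | succ n ih =>
    have g := (Fin.consLinearEquiv Aᵐᵒᵖ fun _ : Fin (n + 1) => A).symm
    rw [centerRank_congr g, centerRank_congr ((StarDual.congr σ g).trans (StarDual.prodEquiv σ _ _)),
      centerRank_prod R, centerRank_prod R, centerRank_congr (HermForm.selfDualEquiv σ ε hε hεσ).symm]
    exact congrArg _ ih

theorem eq_zero_of_mul_self_of_forall_mem (hz : z * z = z)
    (h : ∀ p : PrimeSpectrum (Subring.center A), z ∈ p.asIdeal) : z = 0 := by
  have h1 : IsUnit (1 - z) := by
    by_contra hn
    obtain ⟨m, hm, hmem⟩ := exists_max_ideal_of_mem_nonunits hn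
    exact notMem_of_one_sub_mem (p := ⟨m, hm.isPrime⟩) hmem (h _)
  refine (h1.mul_right_eq_zero).1 ?_
  rw [sub_mul, one_mul, hz, sub_self]

/-- Away from an idempotent and its conjugate, which are orthogonal, a projective module has the
ranks of its dual. -/
theorem exists_center_idempotent_starDual [Finite (MaximalSpectrum R)]
    (hA : IsAzumayaWithInvolution σ) (e : SeparabilityElement R A) [Module.Finite R A] {κ : R}
    (hκ : κ + κ = 1) (L : Type*) [AddCommGroup L] [Module Aᵐᵒᵖ L] [Module.Finite Aᵐᵒᵖ L]
    [Module.Projective Aᵐᵒᵖ L] :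
    ∃ z : Subring.center A, z * z = z ∧ z * σ.center z = 0 ∧
      ∀ p : PrimeSpectrum (Subring.center A), z ∈ p.asIdeal → σ.center z ∈ p.asIdeal →
        centerRank A (StarDual σ L) p = centerRank A L p := by
  obtain ⟨z, hz, hzp⟩ := exists_center_idempotent_centerRank_lt hA e hκ L (StarDual σ L)
  have hw : σ.center z * σ.center z = σ.center z := by rw [← σ.center_mul, hz]
  have hnotMem : ∀ {a b : Subring.center A} {p : PrimeSpectrum (Subring.center A)},
      a * b ∉ p.asIdeal ↔ a ∉ p.asIdeal ∧ b ∉ p.asIdeal := fun {a b p} => by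
    rw [p.2.mul_mem_iff_mem_or_mem, not_or]
  -- The idempotent `z` marks where the dual has smaller rank. On the `σ`-stable part `z σ(z)` this
  -- would hold throughout, which `centerRank_starDual_eq_of_le` excludes. On the part away from
  -- both `z` and `σ(z)` the opposite inequality holds, and the same lemma turns it into equality.
  have hzw : z * σ.center z = 0 := by
    have hg : z * σ.center z * (z * σ.center z) = z * σ.center z := by
      rw [mul_mul_mul_comm, hz, hw]
    have hσg : σ.center (z * σ.center z) = z * σ.center z := by
      rw [σ.center_mul, σ.center_center, mul_comm]
    have := finite_component (P := L) hg
    have := projective_component (P := L) hg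
    refine eq_zero_of_mul_self_of_forall_mem hg fun p => ?_
    by_contra hp
    have h1 := centerRank_starDual_eq_of_le (σ := σ) (P := component L (z * σ.center z)) e
      (Or.inl fun q => by
        by_cases hq : z * σ.center z ∈ q.asIdeal
        · rw [centerRank_starDual_component_eq_zero hg (by rwa [hσg])]
          exact Nat.zero_le _
        · rw [centerRank_starDual_component hg (by rwa [hσg]), centerRank_component (R := R) hg hq]
          exact ((hzp q).1 (hnotMem.1 hq).1).le) p
    rw [centerRank_starDual_component hg (by rwa [hσg]), centerRank_component (R := R) hg hp] at h1
    exact ((hzp p).1 (hnotMem.1 hp).1).ne h1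
  refine ⟨z, hz, hzw, ?_⟩
  · intro p hp hp'
    have hg : (1 - z) * (1 - σ.center z) * ((1 - z) * (1 - σ.center z)) =
        (1 - z) * (1 - σ.center z) := by
      rw [mul_mul_mul_comm, one_sub_mul_self hz, one_sub_mul_self hw]
    have hσg : σ.center ((1 - z) * (1 - σ.center z)) = (1 - z) * (1 - σ.center z) := by
      rw [σ.center_mul, σ.center_one_sub, σ.center_one_sub, σ.center_center, mul_comm]
    have := finite_component (P := L) hg
    have := projective_component (P := L) hg
    have hgp : (1 - z) * (1 - σ.center z) ∉ p.asIdeal := hnotMem.2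
      ⟨notMem_of_one_sub_mem (by rwa [sub_sub_cancel]),
        notMem_of_one_sub_mem (by rwa [sub_sub_cancel])⟩
    have h1 := centerRank_starDual_eq_of_le (σ := σ)
      (P := component L ((1 - z) * (1 - σ.center z))) e
      (Or.inr fun q => by
        by_cases hq : (1 - z) * (1 - σ.center z) ∈ q.asIdeal
        · rw [centerRank_component_eq_zero (R := R) hg hq]
          exact Nat.zero_le _
        · rw [centerRank_starDual_component hg (by rwa [hσg]), centerRank_component (R := R) hg hq]
          refine not_lt.1 (mt (hzp q).2 (not_not.2 ?_))
          have := one_sub_mem_of_notMem (one_sub_mul_self hz) (hnotMem.1 hq).1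
          rwa [sub_sub_cancel] at this) p
    rwa [centerRank_starDual_component hg (by rwa [hσg]), centerRank_component (R := R) hg hgp] at h1

/-- A standard hyperbolic form of sufficiently large rank splits off that of a free module. -/
theorem exists_hypForm_isometric_prod_free [Finite (MaximalSpectrum R)]
    (hA : IsAzumayaWithInvolution σ) (e : SeparabilityElement R A) [Module.Finite R A] {κ : R}
    (hκ : κ + κ = 1) (hε : ε ∈ Set.center A) (hεσ : σ ε * ε = 1) (L : Type v) [AddCommGroup L]
    [Module Aᵐᵒᵖ L] [Module.Finite Aᵐᵒᵖ L] [Module.Projective Aᵐᵒᵖ L] (n : ℕ)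
    (h : ∀ p, centerRank A (Fin n → A) p + centerRank A (Fin n → A) p ≤
      centerRank A L p + centerRank A (StarDual σ L) p) :
    ∃ (W : Type v) (_ : AddCommGroup W) (_ : Module Aᵐᵒᵖ W), Module.Finite Aᵐᵒᵖ W ∧
      Module.Projective Aᵐᵒᵖ W ∧ (hypForm σ ε hε hεσ L).Isometric
        ((hypForm σ ε hε hεσ W).prod (hypForm σ ε hε hεσ (Fin n → A))) := by
  obtain ⟨z, hz, hzw, hrest⟩ := exists_center_idempotent_starDual hA e hκ L
  have hw : σ.center z * σ.center z = σ.center z := by rw [← σ.center_mul, hz]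
  -- Dualising the part of `L` at `σ z` moves its rank to `z`. The new module has rank `rk L + rk
  -- L*` at `z`, rank zero at `σ z`, and rank `rk L = rk L*` elsewhere. The same move on `Aⁿ` gives
  -- ranks `2 rk Aⁿ`, zero and `rk Aⁿ`, so the hypothesis on sums becomes a pointwise inequality.
  let c := 1 - σ.center z
  have hc : c * c = c := one_sub_mul_self hw
  have hc' : 1 - c = σ.center z := sub_sub_cancel _ _
  have hc'' : σ.center (1 - c) = z := by rw [hc', σ.center_center]
  have hrank : ∀ (P : Type v) [AddCommGroup P] [Module Aᵐᵒᵖ P] [Module.Finite Aᵐᵒᵖ P]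
      [Module.Projective Aᵐᵒᵖ P] (p : PrimeSpectrum (Subring.center A)),
      centerRank A (component P c × StarDual σ (component P (1 - c))) p =
        (by classical exact if σ.center z ∈ p.asIdeal then centerRank A P p else 0) +
        (by classical exact if z ∈ p.asIdeal then 0 else centerRank A (StarDual σ P) p) := by
    intro P _ _ _ _ p
    have := finite_component (P := P) hc
    have := finite_component (P := P) (one_sub_mul_self hc)
    have := projective_component (P := P) (one_sub_mul_self hc)
    rw [centerRank_prod R]
    congr 1
    · split_ifs with hp
      · exact centerRank_component (R := R) hc (notMem_of_one_sub_mem (by rwa [hc']))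
      · exact centerRank_component_eq_zero (R := R) hc (one_sub_mem_of_notMem hw hp)
    · split_ifs with hp
      · exact centerRank_starDual_component_eq_zero (one_sub_mul_self hc) (by rwa [hc''])
      · exact centerRank_starDual_component (one_sub_mul_self hc) (by rwa [hc''])
  have hproj : ∀ (P : Type v) [AddCommGroup P] [Module Aᵐᵒᵖ P] [Module.Finite Aᵐᵒᵖ P]
      [Module.Projective Aᵐᵒᵖ P],
      Module.Finite Aᵐᵒᵖ (component P c × StarDual σ (component P (1 - c))) ∧
      Module.Projective Aᵐᵒᵖ (component P c × StarDual σ (component P (1 - c))) := by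
    intro P _ _ _ _
    have := finite_component (P := P) hc
    have := projective_component (P := P) hc
    have := finite_component (P := P) (one_sub_mul_self hc)
    have := projective_component (P := P) (one_sub_mul_self hc)
    exact ⟨inferInstance, inferInstance⟩
  obtain ⟨_, _⟩ := hproj L
  obtain ⟨_, _⟩ := hproj (Fin n → A)
  obtain ⟨W, ⟨g⟩⟩ := exists_equiv_prod_of_centerRank_le e
    (component (Fin n → A) c × StarDual σ (component (Fin n → A) (1 - c)))
    (component L c × StarDual σ (component L (1 - c))) fun p _ => by
      rw [hrank, hrank, centerRank_starDual_free hε hεσ]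
      have h1 := h p
      have h2 : z ∈ p.asIdeal ∨ σ.center z ∈ p.asIdeal :=
        p.2.mem_or_mem (by rw [hzw]; exact zero_mem _)
      have h3 := hrest p
      split_ifs with h4 h5 <;> simp_all
      omega
  refine ⟨W, inferInstance, inferInstance, finite_snd_of_equiv_prod g,
    projective_snd_of_equiv_prod g, ?_⟩
  exact ((hypForm_isometric_component hε hεσ hc).trans
    (HermForm.hypForm_isometric_congr hε hεσ g)).trans
    (((HermForm.hypForm_isometric_prod hε hεσ).symm.trans (HermForm.isometric_prod_comm _ _)).trans
      ((HermForm.Isometric.refl _).prod (hypForm_isometric_component hε hεσ hc).symm))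

end Components

/-! ### From Witt classes to isometries -/

section Witt

variable {R : Type u} {A : Type v} [CommRing R] [Ring A] [Algebra R A] {σ : AlgInvolution R A}
  {ε : A}

namespace HermSpace

theorem grothendieckClass_sum (F G : HermSpace σ ε) :
    (F.sum G).grothendieckClass = F.grothendieckClass + G.grothendieckClass :=
  (Algebra.GrothendieckAddGroup.of (M := IsometryClass σ ε)).map_add
    (Quotient.mk (isometrySetoid σ ε) F) (Quotient.mk (isometrySetoid σ ε) G)

theorem grothendieckClass_zero : (zero σ ε).grothendieckClass = 0 :=
  (Algebra.GrothendieckAddGroup.of (M := IsometryClass σ ε)).map_zero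

theorem wittClass_zero : (zero σ ε).wittClass = 0 := by
  rw [wittClass, grothendieckClass_zero]
  rfl

theorem zero_hyperbolic : (zero σ ε).form.Hyperbolic :=
  ⟨⊥, ⊤, isCompl_bot_top, fun _ _ _ _ => rfl, fun _ _ _ _ => rfl⟩

/-- The space with the opposite form. -/
def neg (F : HermSpace σ ε) : HermSpace σ ε where
  carrier := F.carrier
  form := F.form.neg
  unimodular := F.unimodular.neg

/-- Orthogonal sums of hyperbolic spaces are hyperbolic, so every element of the subgroup is a
difference of two hyperbolic classes. -/
theorem exists_hyperbolic_of_mem_hyperbolicSubgroup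
    {c : Algebra.GrothendieckAddGroup (IsometryClass σ ε)} (hc : c ∈ hyperbolicSubgroup σ ε) :
    ∃ G H : HermSpace σ ε, G.form.Hyperbolic ∧ H.form.Hyperbolic ∧
      c + H.grothendieckClass = G.grothendieckClass := by
  induction hc using AddSubgroup.closure_induction with
  | mem c hc =>
    obtain ⟨G, hG, rfl⟩ := hc
    exact ⟨G, zero σ ε, hG, zero_hyperbolic, by rw [grothendieckClass_zero, add_zero]⟩
  | zero => exact ⟨zero σ ε, zero σ ε, zero_hyperbolic, zero_hyperbolic, zero_add _⟩
  | add c d _ _ hc hd =>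
    obtain ⟨G, H, hG, hH, h⟩ := hc
    obtain ⟨G', H', hG', hH', h'⟩ := hd
    exact ⟨G.sum G', H.sum H', hG.prod hG', hH.prod hH', by
      rw [grothendieckClass_sum, grothendieckClass_sum, add_add_add_comm, h, h']⟩
  | neg c _ hc =>
    obtain ⟨G, H, hG, hH, h⟩ := hc
    exact ⟨H, G, hH, hG, by rw [← h, neg_add_cancel_left]⟩

theorem exists_isometric_of_grothendieckClass_eq {F G : HermSpace σ ε}
    (h : F.grothendieckClass = G.grothendieckClass) :
    ∃ X : HermSpace σ ε, (F.sum X).form.Isometric (G.sum X).form := by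
  obtain ⟨⟨⟨X⟩, _⟩, hX⟩ := (AddSubmonoid.LocalizationMap.eq_iff_exists
    (AddLocalization.addMonoidOf (⊤ : AddSubmonoid (IsometryClass σ ε)))).1 h
  have h1 : (X.sum F).form.Isometric (X.sum G).form := Quotient.exact hX
  exact ⟨X, ((HermForm.isometric_prod_comm _ _).trans h1).trans (HermForm.isometric_prod_comm _ _)⟩

/-- Witt equivalent spaces become isometric after adding hyperbolic spaces. -/
theorem exists_isometric_of_wittClass_eq {κ : R} (hκ : κ + κ = 1) {F F' : HermSpace σ ε}
    (h : F.wittClass = F'.wittClass) :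
    ∃ G G' : HermSpace σ ε, G.form.Hyperbolic ∧ G'.form.Hyperbolic ∧
      (F.form.prod G.form).Isometric (F'.form.prod G'.form) := by
  obtain ⟨G, H, hG, hH, h1⟩ := exists_hyperbolic_of_mem_hyperbolicSubgroup (QuotientAddGroup.eq.1 h)
  have h2 : (F.sum G).grothendieckClass = (F'.sum H).grothendieckClass := by
    rw [grothendieckClass_sum, grothendieckClass_sum, ← h1]
    abel
  obtain ⟨X, hX⟩ := exists_isometric_of_grothendieckClass_eq h2
  -- Equality in the Grothendieck group only holds after adding some `X`; adding `-X` as well makes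
  -- the extra summand hyperbolic.
  have hXX : (X.form.prod X.neg.form).Hyperbolic := X.form.prod_neg_hyperbolic hκ
  refine ⟨G.sum (X.sum X.neg), H.sum (X.sum X.neg), hG.prod hXX, hH.prod hXX, ?_⟩
  have h3 : ∀ F G : HermSpace σ ε, (F.form.prod (G.sum (X.sum X.neg)).form).Isometric
      (((F.sum G).sum X).form.prod X.neg.form) := fun F G =>
    (HermForm.isometric_prod_assoc F.form G.form (X.sum X.neg).form).symm.trans
      (HermForm.isometric_prod_assoc (F.sum G).form X.form X.neg.form).symm
  exact ((h3 F G).trans (hX.prod (HermForm.Isometric.refl _))).trans (h3 F' H).symm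

end HermSpace

theorem exists_free_equiv_prod (σ : AlgInvolution R A) (L : Type v) [AddCommGroup L]
    [Module Aᵐᵒᵖ L] [Module.Finite Aᵐᵒᵖ L] [Module.Projective Aᵐᵒᵖ L] :
    ∃ (n : ℕ) (C : Submodule Aᵐᵒᵖ (Fin n → A)), Nonempty ((Fin n → A) ≃ₗ[Aᵐᵒᵖ] L × C) := by
  obtain ⟨n, i, s, h⟩ := StarDual.exists_retract σ (StarDual σ L)
  refine ⟨n, _, exists_equiv_prod_ker ((StarDual.evalEquiv σ L).symm.toLinearMap ∘ₗ s)
    ((StarDual.evalEquiv σ L).symm.surjective.comp fun φ => ⟨i φ, LinearMap.congr_fun h φ⟩)⟩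

/-- The degree is positive at every point, so dividing by it does not affect comparisons. -/
theorem centerRank_le_of_reducedRank_le (R : Type u) [CommRing R] [Algebra R A]
    [Module.Finite R A] {P Q : Type*} [AddCommGroup P] [Module Aᵐᵒᵖ P] [AddCommGroup Q]
    [Module Aᵐᵒᵖ Q] {p : PrimeSpectrum (Subring.center A)}
    (h : reducedRank A P p ≤ reducedRank A Q p) : centerRank A P p ≤ centerRank A Q p := by
  have h1 : (0 : ℚ) < degree A p := Nat.cast_pos.2 (Nat.sqrt_pos.2 (centerRank_self_pos R p))
  exact_mod_cast (div_le_div_iff_of_pos_right h1).1 h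

theorem exists_prod_hypForm_isometric [Finite (MaximalSpectrum R)]
    (hA : IsAzumayaWithInvolution σ) (e : SeparabilityElement R A) [Module.Finite R A] {κ : R}
    (hκ : κ + κ = 1) (hε : ε ∈ Set.center A) (hεσ : σ ε * ε = 1) {F F' : HermSpace σ ε}
    (h : F.wittClass = F'.wittClass)
    (hr : ∀ p, centerRank A F.carrier p ≤ centerRank A F'.carrier p) :
    ∃ (V : Type v) (_ : AddCommGroup V) (_ : Module Aᵐᵒᵖ V), Module.Finite Aᵐᵒᵖ V ∧
      Module.Projective Aᵐᵒᵖ V ∧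
        (F.form.prod (hypForm σ ε hε hεσ V)).Isometric F'.form := by
  obtain ⟨G, G', hG, hG', hi⟩ := HermSpace.exists_isometric_of_wittClass_eq hκ h
  obtain ⟨L, M, hLM, hL⟩ := hG.exists_isometric_hypForm G.unimodular hε hεσ
  obtain ⟨L', M', hLM', hL'⟩ := hG'.exists_isometric_hypForm G'.unimodular hε hεσ
  have := finite_of_isCompl hLM
  have := projective_of_isCompl hLM
  have := finite_of_isCompl hLM'
  have := projective_of_isCompl hLM'
  -- Adding the hyperbolic space of a complement `C` to both sides makes the module on the side of
  -- `F'` free, as cancellation requires.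
  obtain ⟨n, C, ⟨g⟩⟩ := exists_free_equiv_prod σ L'
  have := finite_snd_of_equiv_prod g
  have := projective_snd_of_equiv_prod g
  have h1 : (F.form.prod (hypForm σ ε hε hεσ (L × C))).Isometric
      (F'.form.prod (hypForm σ ε hε hεσ (Fin n → A))) := by
    have key : ∀ (F G : HermSpace σ ε) (L : Submodule Aᵐᵒᵖ G.carrier),
        G.form.Isometric (hypForm σ ε hε hεσ L) →
        (F.form.prod (hypForm σ ε hε hεσ (L × C))).Isometric
          ((F.form.prod G.form).prod (hypForm σ ε hε hεσ C)) := fun F G L hL =>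
      (((HermForm.Isometric.refl _).prod (HermForm.hypForm_isometric_prod hε hεσ).symm).trans
        (HermForm.isometric_prod_assoc _ _ _).symm).trans
        (((HermForm.Isometric.refl _).prod hL.symm).prod (HermForm.Isometric.refl _))
    exact ((key F G L hL).trans (hi.prod (HermForm.Isometric.refl _))).trans
      ((key F' G' L' hL').symm.trans ((HermForm.Isometric.refl _).prod
        (HermForm.hypForm_isometric_congr hε hεσ g.symm)))
  obtain ⟨W, _, _, _, _, hW⟩ := exists_hypForm_isometric_prod_free hA e hκ hε hεσ (L × C) n
    fun p => by
      obtain ⟨φ, -⟩ := h1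
      have h2 := centerRank_congr φ p
      rw [centerRank_prod R, centerRank_prod R F'.carrier, centerRank_prod R (L × C),
        centerRank_prod R (Fin n → A), centerRank_starDual_free hε hεσ] at h2
      have h3 := hr p
      omega
  refine ⟨W, inferInstance, inferInstance, inferInstance, inferInstance, ?_⟩
  exact HermForm.isometric_of_prod_hypForm_free hA e hκ hε hεσ F'.unimodular n
    (((HermForm.isometric_prod_assoc _ _ _).trans
      ((HermForm.Isometric.refl _).prod hW.symm)).trans h1)

end Witt

end AzumayaWitt

/-! ### The three statements -/

theorem mainTheorem12 {R : Type u} {A : Type v} [CommRing R] [Ring A] [Algebra R A]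
    [Finite (MaximalSpectrum R)] (h2 : IsUnit (2 : R))
    (σ : AzumayaWitt.AlgInvolution R A) (hA : AzumayaWitt.IsAzumayaWithInvolution σ)
    (ε : A) (hε : ε ∈ Set.center A) (hεσ : σ ε * ε = 1)
    (F F' : AzumayaWitt.HermSpace σ ε) :
    (F.wittClass = F'.wittClass →
      (∀ p, AzumayaWitt.reducedRank A F.carrier p ≤ AzumayaWitt.reducedRank A F'.carrier p) →
      ∃ (V : Type v) (_ : AddCommGroup V) (_ : Module Aᵐᵒᵖ V),
        Module.Finite Aᵐᵒᵖ V ∧ Module.Projective Aᵐᵒᵖ V ∧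
          (F.form.prod (AzumayaWitt.hypForm σ ε hε hεσ V)).Isometric F'.form) ∧
    (F.wittClass = 0 → F.form.Hyperbolic) ∧
    (F.wittClass = F'.wittClass →
      (∀ p, AzumayaWitt.reducedRank A F.carrier p = AzumayaWitt.reducedRank A F'.carrier p) →
      F.form.Isometric F'.form) := by
  obtain ⟨e⟩ := hA.separable.nonempty_separabilityElement
  have := hA.projective
  have : Module.Finite R A := e.module_finite
  obtain ⟨κ, hκ⟩ : ∃ κ : R, κ + κ = 1 := by
    obtain ⟨κ, hκ⟩ := h2.exists_right_inv
    exact ⟨κ, by rw [← two_mul, hκ]⟩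
  refine ⟨fun h hr => ?_, fun h => ?_, fun h hr => ?_⟩
  · exact AzumayaWitt.exists_prod_hypForm_isometric hA e hκ hε hεσ h fun p =>
      AzumayaWitt.centerRank_le_of_reducedRank_le R (hr p)
  · obtain ⟨V, _, _, _, _, hV⟩ := AzumayaWitt.exists_prod_hypForm_isometric hA e hκ hε hεσ
      (F := AzumayaWitt.HermSpace.zero σ ε) (F' := F)
      (AzumayaWitt.HermSpace.wittClass_zero.trans h.symm) fun p => by
        rw [AzumayaWitt.centerRank_eq_zero_of_smul_eq
          (P := (AzumayaWitt.HermSpace.zero σ ε).carrier) R p.asIdeal.zero_mem fun _ => rfl]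
        exact Nat.zero_le _
    exact (AzumayaWitt.HermSpace.zero_hyperbolic.prod
      (AzumayaWitt.HermForm.hypForm_hyperbolic hε hεσ)).of_isometric hV
  · obtain ⟨V, _, _, _, _, hV⟩ := AzumayaWitt.exists_prod_hypForm_isometric hA e hκ hε hεσ h
      fun p => AzumayaWitt.centerRank_le_of_reducedRank_le R (hr p).le
    -- Equal ranks leave rank zero for the hyperbolic summand, which is therefore the zero module.
    have hz : ∀ p, AzumayaWitt.centerRank A (V × AzumayaWitt.StarDual σ V) p = 0 := fun p => by
      obtain ⟨φ, -⟩ := hV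
      have h3 := AzumayaWitt.centerRank_congr φ p
      rw [AzumayaWitt.centerRank_prod R] at h3
      have h4 := AzumayaWitt.centerRank_le_of_reducedRank_le R (hr p).ge
      omega
    have := AzumayaWitt.subsingleton_of_centerRank_eq_zero (A := A) R fun p _ => hz p
    exact (AzumayaWitt.HermForm.isometric_prod_of_subsingleton _ _).symm.trans hV
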